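/- Let $q\in\mathbb C^\times$ be not a root of unity and $\lambda=q-q^{-1}$. Let $\hat{\mathcal H}$ be the affine Hecke algebra over $\mathbb C$: it has generators $\sigma_i,\tau_i$ $(i\ge1)$ and $\tau_1^{-1}$, with relations $\sigma_i\sigma_{i+1}\sigma_i=\sigma_{i+1}\sigma_i\sigma_{i+1}$; $\sigma_i\sigma_k=\sigma_k\sigma_i$ for $|i-k|>1$; $(\sigma_i-q)(\sigma_i+q^{-1})=0$; $\tau_{i+1}=\sigma_i\tau_i\sigma_i$; $\tau_l\tau_i=\tau_i\tau_l$; $\tau_k\sigma_i=\sigma_i\tau_k$ for $k\ne i,i+1$; $\tau_1\tau_1^{-1}=\tau_1^{-1}\tau_1=1$. More generally, fix any polynomial $f\in\mathbb C[t]$ and add the relation $f(\tau_1)=0$; for $f=0$ this is the affine Hecke algebra itself. Let $\hat{\mathcal H}_n$ be the subalgebra generated by $\tau_1^{\pm1},\sigma_1,\dots,\sigma_{n-1}$, and $\hat{\mathcal H}_0=\mathbb C$. Let $\mathrm{Tr}_{n+1}:\hat{\mathcal H}_{n+1}\to\hat{\mathcal H}_n$ $(n\ge0)$ be linear maps (the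 Ocneanu–Markov trace) such that for some constants $Q_0,Q_\pm,Q_\tau^{(l)}\in\mathbb C$ $(l\in\mathbb Z)$ and all $X,X'\in\hat{\mathcal H}_n$, $Y\in\hat{\mathcal H}_{n+1}$: $\mathrm{Tr}_{n+1}(X)=Q_0X$; $\mathrm{Tr}_{n+1}(XYX')=X\,\mathrm{Tr}_{n+1}(Y)X'$; $\mathrm{Tr}_1(\tau_1^l)=Q^{(l)}_\tau$; and, for $n\ge1$, $\mathrm{Tr}_{n+1}(\sigma_n^{\pm1}X\sigma_n^{\mp1})=\mathrm{Tr}_n(X)$; $\mathrm{Tr}_{n+1}(X\sigma_n^{\pm1}X')=Q_\pm XX'$; $\mathrm{Tr}_n\mathrm{Tr}_{n+1}(\sigma_nY)=\mathrm{Tr}_n\mathrm{Tr}_{n+1}(Y\sigma_n)$. The spectral parameters and the boundary parameter $\xi$ are taken from $\mathbb C[[h]]\supset\mathbb C$, operators from $\hat{\mathcal H}[[h]]$, and $\mathrm{Tr}_n$ acts on coefficients. Put $$X_i(y)=\sigma_i+\frac{\lambda y}{1-y},\qquad \tau_1(y)=\frac{\tau_1-\xi y}{\tau_1-\xi y^{-1}}=\frac{y\tau_1-\xi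 y^2}{y\tau_1-\xi},\qquad \tau_j(y)=X_{j-1}(y)\cdots X_1(y)\,\tau_1(y)\,X_1(y)\cdots X_{j-1}(y).$$ Let $\mathcal T_m$ be a standard Young tableau with $m$ nodes, $\alpha_k$ the node of the number $k$, $c_k=q^{2(\mathrm{column}-\mathrm{row})}$ the quantum content of $\alpha_k$, and $\mathcal T_{k-1}$ the subtableau with the numbers $1,\dots,k-1$. For $j\ge1$ let $J_{1,j}=1$, $J_{i+1,j}=\sigma_{j+i-1}J_{i,j}\sigma_{j+i-1}$, and let $$A_j^{\mathcal T_m}=\prod_{k=1,\dots,m}^{\rightarrow}\ \prod_{\alpha}\frac{J_{k,j}-c_\alpha}{c_k-c_\alpha},$$ where $\alpha$ runs over the addable nodes of $\mathcal T_{k-1}$ other than $\alpha_k$, and $c_\alpha$ is the quantum content of $\alpha$. The fused projected boundary operator and its Markov trace, the projected transfer matrix, are $$\bar B_j^{\mathcal T_m}(x)=A_j^{\mathcal T_m}\prod_{i=1,\dots,m}^{\rightarrow}\Big(X_{j+i-2}(x^2c_ic_1)\,X_{j+i-3}(x^2c_ic_2)\cdots X_j(x^2c_ic_{i-1})\;\tau_j(x\,c_i)\Big),$$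 $$t_j^{\mathcal T_m}(x)=\mathrm{Tr}_j\,\mathrm{Tr}_{j+1}\cdots\mathrm{Tr}_{j+m-1}\big(\bar B_j^{\mathcal T_m}(x)\big).$$ Call $x$ regular for $\mathcal T_m$ (and $j,\xi$) if all denominators in $\bar B_j^{\mathcal T_m}(x)$ are invertible, that is, the elements $x c_i\tau_1-\xi$, the elements $1-xc_i$ (if $j\ge2$), and the elements $1-x^2c_ic_k$ for $k<i$. Then for every $j\ge1$, all standard tableaux $\mathcal T_m,\mathcal T'_n$, every $\xi$, every $x$ regular for $\mathcal T_m$ and every $z$ regular for $\mathcal T'_n$, $$\big[\,t_j^{\mathcal T_m}(x),\;t_j^{\mathcal T'_n}(z)\,\big]=0 .$$ -/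

import Mathlib

noncomputable section

namespace BaxterizedHecke

open Polynomial (aeval)

/-! All indices are counted from `0`: the index `i` of `σ i`, `τ i`, `X i` stands for the
subscript `i + 1` of the usual notation, and `p` stands for `j - 1`. -/

/-! ### The affine Hecke algebra -/

/-- Generators: `s i` is `σ_{i+1}`, `t i` is `τ_{i+1}`, and `tInv` is the inverse of `τ_1`. -/
inductive Gen : Type
  | s (i : ℕ)
  | t (i : ℕ)
  | tInv

/-- The generator `g` in the free algebra. -/
abbrev gen (g : Gen) : FreeAlgebra ℂ Gen := FreeAlgebra.ι ℂ g

open Gen in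
/-- The defining relations of the affine Hecke algebra, together with the relation `f(τ_1) = 0`.
For `f = 0` the last relation says nothing, and one has the affine Hecke algebra itself. -/
inductive Rel (q : ℂ) (f : Polynomial ℂ) : FreeAlgebra ℂ Gen → FreeAlgebra ℂ Gen → Prop
  | braid (i : ℕ) :
      Rel q f (gen (s i) * gen (s (i + 1)) * gen (s i))
        (gen (s (i + 1)) * gen (s i) * gen (s (i + 1)))
  | far (i j : ℕ) (h : i + 1 < j) : Rel q f (gen (s i) * gen (s j)) (gen (s j) * gen (s i))
  | quad (i : ℕ) :
      Rel q f ((gen (s i) - algebraMap ℂ _ q) * (gen (s i) + algebraMap ℂ _ q⁻¹)) 0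
  | t_succ (j : ℕ) : Rel q f (gen (t (j + 1))) (gen (s j) * gen (t j) * gen (s j))
  | t_comm (l j : ℕ) : Rel q f (gen (t l) * gen (t j)) (gen (t j) * gen (t l))
  | t_s (j i : ℕ) (h : j ≠ i) (h' : j ≠ i + 1) :
      Rel q f (gen (t j) * gen (s i)) (gen (s i) * gen (t j))
  | t_inv : Rel q f (gen (t 0) * gen tInv) 1
  | inv_t : Rel q f (gen tInv * gen (t 0)) 1
  | poly : Rel q f (aeval (gen (t 0)) f) 0

/-- The affine Hecke algebra on infinitely many strands (for `f = 0`), and its quotient by the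
relation `f(τ_1) = 0` in general. The algebra on `n` strands is its subalgebra `level q f n`. -/
def Hecke (q : ℂ) (f : Polynomial ℂ) : Type := RingQuot (Rel q f)

instance (q : ℂ) (f : Polynomial ℂ) : Ring (Hecke q f) := inferInstanceAs (Ring (RingQuot _))

instance (q : ℂ) (f : Polynomial ℂ) : Algebra ℂ (Hecke q f) :=
  inferInstanceAs (Algebra ℂ (RingQuot _))

variable (q : ℂ) (f : Polynomial ℂ)

/-- The quotient map from the free algebra. -/
def Hecke.mk : FreeAlgebra ℂ Gen →ₐ[ℂ] Hecke q f := RingQuot.mkAlgHom ℂ (Rel q f)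

theorem Hecke.mk_rel {a b : FreeAlgebra ℂ Gen} (h : Rel q f a b) :
    Hecke.mk q f a = Hecke.mk q f b :=
  RingQuot.mkAlgHom_rel ℂ h

/-- The generator `σ_{i+1}`. -/
def σ (i : ℕ) : Hecke q f := Hecke.mk q f (gen (.s i))

/-- The inverse of `σ_{i+1}`, which is `σ_{i+1} - (q - q⁻¹)` by the quadratic relation. -/
def σInv (i : ℕ) : Hecke q f := σ q f i - algebraMap ℂ _ (q - q⁻¹)

/-- `τ_{i+1}`. -/
def τ (i : ℕ) : Hecke q f := Hecke.mk q f (gen (.t i))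

/-- `τ_1` as a unit of the algebra. -/
def τUnit : (Hecke q f)ˣ where
  val := τ q f 0
  inv := Hecke.mk q f (gen .tInv)
  val_inv := by
    have h := Hecke.mk_rel q f (Rel.t_inv)
    rwa [map_mul, map_one] at h
  inv_val := by
    have h := Hecke.mk_rel q f (Rel.inv_t)
    rwa [map_mul, map_one] at h

theorem σ_mul_σInv (hq : q ≠ 0) (i : ℕ) :
    σ q f i * σInv q f i = 1 ∧ σInv q f i * σ q f i = 1 := by
  have h := Hecke.mk_rel q f (Rel.quad (q := q) (f := f) i)
  have hs : Hecke.mk q f (gen (.s i)) = σ q f i := rfl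
  have hc : algebraMap ℂ (Hecke q f) q * algebraMap ℂ (Hecke q f) q⁻¹ = 1 := by
    rw [← map_mul, mul_inv_cancel₀ hq, map_one]
  have hx := Algebra.commutes q (σ q f i)
  simp only [map_mul, map_sub, map_add, map_zero, AlgHom.commutes, hs] at h
  have h2 : σ q f i * σ q f i + σ q f i * algebraMap ℂ (Hecke q f) q⁻¹
      - σ q f i * algebraMap ℂ (Hecke q f) q - 1 = 0 := by
    rw [← h, sub_mul, mul_add, mul_add, hc, hx]; abel
  have h3 : σ q f i * σInv q f i = 1 := by
    rw [σInv, map_sub, mul_sub, mul_sub, ← sub_eq_zero, ← h2]; abel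
  refine ⟨h3, ?_⟩
  rw [← h3, σInv, sub_mul, mul_sub, Algebra.commutes]

/-- The algebra on `n` strands, generated by `τ_1`, its inverse and `σ_1, …, σ_{n-1}`;
for `n = 0` it consists of the scalars. -/
def level (n : ℕ) : Subalgebra ℂ (Hecke q f) :=
  Algebra.adjoin ℂ
    ({a | ∃ i, i + 1 < n ∧ a = σ q f i} ∪
      {a | 0 < n ∧ (a = τ q f 0 ∨ a = ((τUnit q f)⁻¹ : (Hecke q f)ˣ))})

/-- The Ocneanu–Markov trace: `tr n` is the map `Tr_{n+1}` from the algebra on `n + 1` strands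
to the algebra on `n` strands. Nothing is said about its values outside the algebra on
`n + 1` strands, and they are never used. -/
structure MarkovTrace where
  tr : ℕ → Hecke q f →ₗ[ℂ] Hecke q f
  Q0 : ℂ
  Qplus : ℂ
  Qminus : ℂ
  Qτ : ℤ → ℂ
  tr_mem : ∀ n, ∀ Y ∈ level q f (n + 1), tr n Y ∈ level q f n
  tr_of_level : ∀ n, ∀ X ∈ level q f n, tr n X = Q0 • X
  tr_bimodule : ∀ n, ∀ X ∈ level q f n, ∀ X' ∈ level q f n, ∀ Y ∈ level q f (n + 1),
    tr n (X * Y * X') = X * tr n Y * X'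
  tr_conj : ∀ n, ∀ X ∈ level q f (n + 1), tr (n + 1) (σ q f n * X * σInv q f n) = tr n X
  tr_conj' : ∀ n, ∀ X ∈ level q f (n + 1), tr (n + 1) (σInv q f n * X * σ q f n) = tr n X
  tr_σ : ∀ n, ∀ X ∈ level q f (n + 1), ∀ X' ∈ level q f (n + 1),
    tr (n + 1) (X * σ q f n * X') = Qplus • (X * X')
  tr_σInv : ∀ n, ∀ X ∈ level q f (n + 1), ∀ X' ∈ level q f (n + 1),
    tr (n + 1) (X * σInv q f n * X') = Qminus • (X * X')
  tr_τ : ∀ l : ℤ, tr 0 ((τUnit q f ^ l : (Hecke q f)ˣ) : Hecke q f) = algebraMap ℂ _ (Qτ l)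
  tr_cyclic : ∀ n, ∀ Y ∈ level q f (n + 2),
    tr n (tr (n + 1) (σ q f n * Y)) = tr n (tr (n + 1) (Y * σ q f n))

/-! ### Standard tableaux and idempotents -/

/-- A standard Young tableau with `m` nodes: `pos k` is the node (row, column) that holds the
number `k + 1`; the numbers increase along rows and down columns. -/
structure StandardTableau (m : ℕ) where
  shape : YoungDiagram
  pos : Fin m ≃ shape.cells
  row_increasing : ∀ k l, (pos k).1.1 = (pos l).1.1 → (pos k).1.2 < (pos l).1.2 → k < l
  col_increasing : ∀ k l, (pos k).1.2 = (pos l).1.2 → (pos k).1.1 < (pos l).1.1 → k < l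

/-- The quantum content `q^{2(column - row)}` of a node. -/
def qContent (c : ℕ × ℕ) : ℂ := q ^ (2 * ((c.2 : ℤ) - (c.1 : ℤ)))

/-- The addable nodes of a diagram `D`. Both coordinates of an addable node are at most the
number of nodes of `D`, whence the search range. -/
def addable (D : Finset (ℕ × ℕ)) : Finset (ℕ × ℕ) :=
  open Classical in
  (Finset.range (D.card + 1) ×ˢ Finset.range (D.card + 1)).filter
    fun c => c ∉ D ∧ IsLowerSet ((insert c D : Finset (ℕ × ℕ)) : Set (ℕ × ℕ))

namespace StandardTableau

variable {m : ℕ} (T : StandardTableau m)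

/-- The node of the number `k + 1`. -/
def node (k : Fin m) : ℕ × ℕ := (T.pos k).1

/-- The quantum content `c_{k+1}` of the number `k + 1`. -/
def content (k : Fin m) : ℂ := qContent q (T.node k)

/-- The nodes of the subtableau that holds the numbers `1, …, k`. -/
def initialNodes (k : Fin m) : Finset (ℕ × ℕ) := (Finset.univ.filter (· < k)).image T.node

end StandardTableau

/-- The shifted Jucys–Murphy element `J_{k+1,p+1}`. -/
def jucysMurphy (p : ℕ) : ℕ → Hecke q f
  | 0 => 1
  | k + 1 => σ q f (p + k) * jucysMurphy p k * σ q f (p + k)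

/-- The primitive idempotent `A_{p+1}^T`: the ordered product over `k` of the factors
`∏ (J_{k+1,p+1} - c) / (c_{k+1} - c)`, where `c` runs over the contents of the addable nodes of
the subtableau with the numbers `1, …, k` other than the node of `k + 1`. -/
def idempotent {m : ℕ} (T : StandardTableau m) (p : ℕ) : Hecke q f :=
  (List.ofFn fun k : Fin m =>
    aeval (jucysMurphy q f p k)
      (∏ a ∈ (addable (T.initialNodes k)).erase (T.node k),
        Polynomial.C (T.content q k - qContent q a)⁻¹ *
          (Polynomial.X - Polynomial.C (qContent q a)))).prod

/-! ### Baxterized elements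

The parameters are formal power series in one variable over `ℂ` (complex numbers are the
constant ones), and the operators are formal power series over the algebra. -/

/-- A power series over `ℂ` as a scalar of the algebra of power series. -/
def scalar : PowerSeries ℂ →+* PowerSeries (Hecke q f) :=
  PowerSeries.map (algebraMap ℂ (Hecke q f))

/-- `X_{i+1}(y) = σ_{i+1} + λ y / (1 - y)` with `λ = q - q⁻¹`, where `1 - y` is invertible. -/
def X (i : ℕ) (y : PowerSeries ℂ) : PowerSeries (Hecke q f) :=
  PowerSeries.C (σ q f i) + scalar q f (PowerSeries.C (q - q⁻¹) * y * (1 - y)⁻¹)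

/-- `τ_1(y) = (τ_1 - ξ y) / (τ_1 - ξ y⁻¹)`, with numerator and denominator multiplied by `y`,
where the denominator is invertible. -/
def tauOne (ξ y : PowerSeries ℂ) : PowerSeries (Hecke q f) :=
  (scalar q f y * PowerSeries.C (τ q f 0) - scalar q f (ξ * y ^ 2)) *
    Ring.inverse (scalar q f y * PowerSeries.C (τ q f 0) - scalar q f ξ)

/-- `τ_{p+1}(y) = X_p(y) ⋯ X_1(y) τ_1(y) X_1(y) ⋯ X_p(y)`. -/
def tauX (ξ : PowerSeries ℂ) : ℕ → PowerSeries ℂ → PowerSeries (Hecke q f)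
  | 0, y => tauOne q f ξ y
  | p + 1, y => X q f p y * tauX ξ p y * X q f p y

/-- The product `X_{p+n}(y_1) X_{p+n-1}(y_2) ⋯ X_{p+1}(y_n)`. -/
def backX (p n : ℕ) (y : Fin n → PowerSeries ℂ) : PowerSeries (Hecke q f) :=
  (List.ofFn fun k : Fin n => X q f (p + k.rev) (y k)).prod

/-- The fused boundary operator `B_{p+1}(x)` with parameters `u_1, …, u_m`: the ordered product
over `i` of `backX (x² u_i u_1, …, x² u_i u_{i-1}) τ_{p+1}(x u_i)`. -/
def fusedB (ξ : PowerSeries ℂ) (p : ℕ) {m : ℕ} (u : Fin m → ℂ) (x : PowerSeries ℂ) :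
    PowerSeries (Hecke q f) :=
  (List.ofFn fun i : Fin m =>
    backX q f p i (fun k => x ^ 2 * PowerSeries.C (u i * u (Fin.castLE i.isLt.le k))) *
      tauX q f ξ p (x * PowerSeries.C (u i))).prod

/-- The fused projected boundary operator `A^T B^T(x)`. -/
def projectedB (ξ : PowerSeries ℂ) (p : ℕ) {m : ℕ} (T : StandardTableau m)
    (x : PowerSeries ℂ) : PowerSeries (Hecke q f) :=
  PowerSeries.C (idempotent q f T p) * fusedB q f ξ p (T.content q) x

variable {q f} in
/-- The map `Tr_{n+1}`, applied to each coefficient. -/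
def MarkovTrace.trSeries (M : MarkovTrace q f) (n : ℕ) (F : PowerSeries (Hecke q f)) :
    PowerSeries (Hecke q f) :=
  PowerSeries.mk fun k => M.tr n (PowerSeries.coeff k F)

variable {q f} in
/-- The composition `Tr_{p+1} Tr_{p+2} ⋯ Tr_{p+m}`. -/
def MarkovTrace.trRange (M : MarkovTrace q f) (p : ℕ) :
    ℕ → PowerSeries (Hecke q f) → PowerSeries (Hecke q f)
  | 0, F => F
  | m + 1, F => M.trRange p m (M.trSeries (p + m) F)

variable {q f} in
/-- The transfer matrix `t_{p+1}^T(x)`. -/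
def transferMatrix (M : MarkovTrace q f) (ξ : PowerSeries ℂ) (p : ℕ) {m : ℕ}
    (T : StandardTableau m) (x : PowerSeries ℂ) : PowerSeries (Hecke q f) :=
  M.trRange p m (projectedB q f ξ p T x)

/-- The parameter `x` is not a pole: every denominator that occurs in the projected boundary
operator `A^T B^T(x)` is invertible. -/
structure IsRegular (ξ : PowerSeries ℂ) (p : ℕ) {m : ℕ} (T : StandardTableau m)
    (x : PowerSeries ℂ) : Prop where
  /-- the denominators of `τ_1(x c_i)` -/
  boundary : ∀ i, IsUnit (scalar q f (x * PowerSeries.C (T.content q i)) *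
    PowerSeries.C (τ q f 0) - scalar q f ξ)
  /-- the denominators of `X_1(x c_i), …, X_p(x c_i)` -/
  dressing : 0 < p → ∀ i, IsUnit (1 - x * PowerSeries.C (T.content q i))
  /-- the denominators of the elements `X_l(x² c_i c_k)` -/
  bulk : ∀ i k, k < i → IsUnit (1 - x ^ 2 * PowerSeries.C (T.content q i * T.content q k))

end BaxterizedHecke

end

/-! The proof is Sklyanin's argument for transfer matrices with a boundary, carried out for fused
operators in a Hecke algebra. Denominators are cleared first: `bax q r a b` is a polynomial multiple
of the Baxterized generator at y = a / b, and every transfer matrix is a scalar multiple of the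
corresponding `transfer`.

The Yang–Baxter equation and the reflection equation `IsAffine.dressed_refl` give an operator that
exchanges two blocks of parameters of the boundary operator, `Reflection.exchange_mul_prod`. On the
trace side there is a crossing relation, `TraceFrame.tr_bax`: for a suitable ratio P : P' of complex
numbers, a generator with parameters (P, P' y) on the left cancels one with parameters (y, 1) on the
right under the Markov trace. The left factors form a dual boundary operator D, `dualProd`, which
obeys an exchange relation with a trivial boundary element. Let E be the idempotent of the tableau
and B the boundary operator. The trace of D E B for two concatenated blocks is, up to a scalar, the
product of the two separate traces (`traces_cat`). Inserting an exchange operator and its inverse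
and using cyclicity reverses the order of the blocks (`traces_swap`). So the transfer matrices that
contain D commute.

The dual operator is then removed. On the reversed idempotent it is a scalar times the inverse of
the lift of the longest permutation (`flipAt_mul_dualProd`), and E is primitive
(`IsHecke.primitive`); hence the traces with and without D are related by scalars
(`dualTransfer_smul`).

For this, idempotents must move through all products of Baxterized generators. The basis is the
spectrum of the Jucys–Murphy elements, `IsHecke.spectral`, which is derived from the Hecke relations
alone, by induction and without representation theory. It yields the eigenvalues on E, idempotency
and primitivity. A row whose parameters are proportional to the contents collapses on E to a linear
function of the next Jucys–Murphy element times a cycle (`IsHecke.idem_mul_row`); from this follow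
the passage through rows in both directions and through the boundary operator itself
(`idem_mul_prod`).

Many scalars have to be cancelled, which is possible only for generic parameters. The parameters are
therefore deformed in an additional formal variable, and the variable is set to zero at the end
(`transfer_comm_of_isUnit`); regularity keeps all denominators invertible under the deformation. The
trace axioms hold only inside the algebra on finitely many strands, so the inverses of the boundary
denominators must be shown to lie there (`inverse_den_mem_level`). -/

noncomputable section

namespace HeckeFusion

open Polynomial
open BaxterizedHecke (addable qContent)

/-! ### Ordered products -/

section Products

variable {A B : Type*} [Monoid A] [Monoid B]

/-- The ordered product `f 0 * f 1 * ⋯ * f (n - 1)`. -/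
def up : ℕ → (ℕ → A) → A
  | 0, _ => 1
  | n + 1, f => up n f * f n

/-- The ordered product `f (n - 1) * ⋯ * f 1 * f 0`. -/
def down : ℕ → (ℕ → A) → A
  | 0, _ => 1
  | n + 1, f => f n * down n f

theorem up_succ (n : ℕ) (f : ℕ → A) : up (n + 1) f = up n f * f n := rfl

theorem down_succ (n : ℕ) (f : ℕ → A) : down (n + 1) f = f n * down n f := rfl

theorem up_zero (f : ℕ → A) : up 0 f = 1 := rfl

theorem down_zero (f : ℕ → A) : down 0 f = 1 := rfl

theorem up_one (f : ℕ → A) : up 1 f = f 0 := one_mul _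

theorem down_one (f : ℕ → A) : down 1 f = f 0 := mul_one _

theorem up_add (m n : ℕ) (f : ℕ → A) : up (m + n) f = up m f * up n fun i => f (m + i) := by
  induction n with
  | zero => simp [up_zero]
  | succ n ih => rw [← add_assoc, up_succ, up_succ, ih, mul_assoc]

theorem down_add (m n : ℕ) (f : ℕ → A) :
    down (m + n) f = (down n fun i => f (m + i)) * down m f := by
  induction n with
  | zero => simp [down_zero]
  | succ n ih => rw [← add_assoc, down_succ, down_succ, ih, mul_assoc]

theorem up_succ_left (n : ℕ) (f : ℕ → A) : up (n + 1) f = f 0 * up n fun i => f (i + 1) := by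
  rw [add_comm, up_add, up_one]; simp only [add_comm]

theorem down_succ_right (n : ℕ) (f : ℕ → A) :
    down (n + 1) f = (down n fun i => f (i + 1)) * f 0 := by
  rw [add_comm, down_add, down_one]; simp only [add_comm]

theorem up_congr {n : ℕ} {f g : ℕ → A} (h : ∀ i < n, f i = g i) : up n f = up n g := by
  induction n with
  | zero => rfl
  | succ n ih => rw [up_succ, up_succ, ih fun i hi => h i (by omega), h n (by omega)]

theorem down_congr {n : ℕ} {f g : ℕ → A} (h : ∀ i < n, f i = g i) : down n f = down n g := by
  induction n with
  | zero => rfl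
  | succ n ih => rw [down_succ, down_succ, ih fun i hi => h i (by omega), h n (by omega)]

theorem commute_up {n : ℕ} {f : ℕ → A} {a : A} (h : ∀ i < n, Commute a (f i)) :
    Commute a (up n f) := by
  induction n with
  | zero => exact Commute.one_right a
  | succ n ih => exact (ih fun i hi => h i (by omega)).mul_right (h n (by omega))

theorem commute_down {n : ℕ} {f : ℕ → A} {a : A} (h : ∀ i < n, Commute a (f i)) :
    Commute a (down n f) := by
  induction n with
  | zero => exact Commute.one_right a
  | succ n ih => exact (h n (by omega)).mul_right (ih fun i hi => h i (by omega))

theorem map_up {F : Type*} [FunLike F A B] [MonoidHomClass F A B] (φ : F) (n : ℕ) (f : ℕ → A) :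
    φ (up n f) = up n fun i => φ (f i) := by
  induction n with
  | zero => exact map_one φ
  | succ n ih => rw [up_succ, map_mul, ih, up_succ]

theorem map_down {F : Type*} [FunLike F A B] [MonoidHomClass F A B] (φ : F) (n : ℕ)
    (f : ℕ → A) : φ (down n f) = down n fun i => φ (f i) := by
  induction n with
  | zero => exact map_one φ
  | succ n ih => rw [down_succ, map_mul, ih, down_succ]

theorem op_down (n : ℕ) (f : ℕ → A) :
    MulOpposite.op (down n f) = up n fun i => MulOpposite.op (f i) := by
  induction n with
  | zero => rfl
  | succ n ih => rw [down_succ, MulOpposite.op_mul, ih, up_succ]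

theorem up_mem {C : Type*} [SetLike C A] [SubmonoidClass C A] {s : C} {n : ℕ} {f : ℕ → A}
    (h : ∀ i < n, f i ∈ s) : up n f ∈ s := by
  induction n with
  | zero => exact one_mem s
  | succ n ih => exact mul_mem (ih fun i hi => h i (by omega)) (h n (by omega))

theorem down_mem {C : Type*} [SetLike C A] [SubmonoidClass C A] {s : C} {n : ℕ} {f : ℕ → A}
    (h : ∀ i < n, f i ∈ s) : down n f ∈ s := by
  induction n with
  | zero => exact one_mem s
  | succ n ih => exact mul_mem (h n (by omega)) (ih fun i hi => h i (by omega))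

/-- Two ordered products interleave when the later factors of the first commute with the
earlier factors of the second. -/
theorem up_mul_up {n : ℕ} {f g : ℕ → A} (h : ∀ i j, j < i → i < n → Commute (f i) (g j)) :
    up n f * up n g = up n fun i => f i * g i := by
  induction n with
  | zero => exact one_mul 1
  | succ n ih =>
    have hc : Commute (f n) (up n g) := commute_up fun j hj => h n j hj (by omega)
    rw [up_succ, up_succ, up_succ, ← ih fun i j hj hi => h i j hj (by omega)]
    simp only [mul_assoc]
    rw [← mul_assoc (f n), hc.eq, mul_assoc]

/-- Rows and columns of an array of factors may be exchanged. -/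
theorem up_up_comm {m n : ℕ} {f : ℕ → ℕ → A}
    (h : ∀ k i k' i', k < k' → k' < n → i' < i → i < m → Commute (f k i) (f k' i')) :
    (up n fun k => up m fun i => f k i) = up m fun i => up n fun k => f k i := by
  induction n with
  | zero => 
    simp only [up_zero]
    induction m with
    | zero => rfl
    | succ m ih => rw [up_succ, ← ih fun _ _ _ _ _ h2 => by omega, mul_one]
  | succ n ih =>
    rw [up_succ, ih fun k i k' i' h1 h2 => h k i k' i' h1 (by omega), up_mul_up]
    · rfl
    · intro i j hj hi
      exact (commute_up fun k hk => (h k i n j hk (by omega) hj hi).symm).symm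

theorem down_down_comm {m n : ℕ} {f : ℕ → ℕ → A}
    (h : ∀ k i k' i', k < k' → k' < n → i' < i → i < m → Commute (f k i) (f k' i')) :
    (down n fun k => down m fun i => f k i) = down m fun i => down n fun k => f k i := by
  have := up_up_comm (A := Aᵐᵒᵖ) (m := m) (n := n) (f := fun k i => MulOpposite.op (f k i))
    fun k i k' i' h1 h2 h3 h4 => (h k i k' i' h1 h2 h3 h4).op
  simpa only [← op_down, MulOpposite.op_inj] using this

theorem down_up_comm {m n : ℕ} {f : ℕ → ℕ → A}
    (h : ∀ k i k' i', k < k' → k' < n → i < i' → i' < m → Commute (f k i) (f k' i')) :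
    (down n fun k => up m fun i => f k i) = up m fun i => down n fun k => f k i := by
  induction n with
  | zero => 
    simp only [down_zero]
    induction m with
    | zero => rfl
    | succ m ih => rw [up_succ, ← ih fun _ _ _ _ _ h2 => by omega, mul_one]
  | succ n ih =>
    rw [down_succ, ih fun k i k' i' h1 h2 => h k i k' i' h1 (by omega), up_mul_up]
    · rfl
    · intro i j hj hi
      exact commute_down fun k hk => (h k j n i hk (by omega) hj hi).symm

/-- Idempotents that can be copied through each factor can be copied through the product. -/
theorem down_absorb {n : ℕ} {e f : ℕ → A} (he : ∀ k, e k * e k = e k)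
    (h : ∀ k < n, e (k + 1) * f k = e (k + 1) * f k * e k) :
    e n * down n f = e n * down n f * e 0 := by
  induction n with
  | zero => rw [down_zero, mul_one, he]
  | succ n ih =>
    rw [down_succ, ← mul_assoc, h n (by omega), mul_assoc _ (e n), ih fun k hk => h k (by omega)]
    simp only [mul_assoc, he]

theorem up_absorb {n : ℕ} {e f : ℕ → A} (he : ∀ k, e k * e k = e k)
    (h : ∀ k < n, e k * f k = e k * f k * e (k + 1)) :
    e 0 * up n f = e 0 * up n f * e n := by
  induction n with
  | zero => rw [up_zero, mul_one, he]
  | succ n ih =>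
    rw [up_succ, ← mul_assoc, ih fun k hk => h k (by omega), mul_assoc _ (e n), h n (by omega)]
    simp only [mul_assoc, he]

end Products

/-! ### Hecke relations and Baxterized generators -/

/-- The parameter `λ = q - q⁻¹`. -/
def lam (q : ℂ) : ℂ := q - q⁻¹

/-- `q` is neither zero nor a root of unity. -/
structure Generic (q : ℂ) : Prop where
  ne_zero : q ≠ 0
  pow_ne_one : ∀ k : ℕ, 0 < k → q ^ k ≠ 1

/-- The elements `r 0, …, r (N - 1)` satisfy the relations of the Hecke algebra. -/
structure IsHecke {A : Type*} [Ring A] [Algebra ℂ A] (q : ℂ) (N : ℕ) (r : ℕ → A) : Prop where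
  quad : ∀ i < N, r i * r i = 1 + lam q • r i
  braid : ∀ i, i + 1 < N → r i * r (i + 1) * r i = r (i + 1) * r i * r (i + 1)
  far : ∀ i j, i + 1 < j → j < N → Commute (r i) (r j)

namespace IsHecke

variable {A : Type*} [Ring A] [Algebra ℂ A] {q : ℂ} {N : ℕ} {r : ℕ → A}

theorem shift (h : IsHecke q N r) {M k : ℕ} (hM : M + k ≤ N) :
    IsHecke q M fun i => r (k + i) where
  quad i hi := h.quad _ (by omega)
  braid i hi := h.braid _ (by omega)
  far i j hi hj := h.far _ _ (by omega) (by omega)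

/-- The relations are symmetric under reversal of the generators, and a boundary operator reverses
the strands that it is moved through. Truncated subtraction makes the reversed family constant
beyond its range, which is why `IsHecke` carries a bound. -/
theorem flip (h : IsHecke q N r) {M k : ℕ} (hM : M + k ≤ N) :
    IsHecke q M fun i => r (k + (M - 1 - i)) where
  quad i hi := h.quad _ (by omega)
  braid i hi := by
    have := h.braid (k + (M - 1 - (i + 1))) (by omega)
    rw [show k + (M - 1 - (i + 1)) + 1 = k + (M - 1 - i) by omega] at this
    exact this.symm
  far i j hi hj := (h.far _ _ (by omega) (by omega)).symm

theorem far' (h : IsHecke q N r) {i j : ℕ} (hi : i < N) (hj : j < N)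
    (hij : i + 1 < j ∨ j + 1 < i) : Commute (r i) (r j) := by
  rcases hij with hij | hij
  · exact h.far i j hij hj
  · exact (h.far j i hij hi).symm

theorem map {B : Type*} [Ring B] [Algebra ℂ B] (h : IsHecke q N r) (φ : A →ₐ[ℂ] B) :
    IsHecke q N fun i => φ (r i) where
  quad i hi := by rw [← map_mul, h.quad i hi, map_add, map_one, map_smul]
  braid i hi := by simp only [← map_mul, h.braid i hi]
  far i j hi hj := (h.far i j hi hj).map φ

end IsHecke

section Inverse

variable {A : Type*} [Ring A] [Algebra ℂ A] {q : ℂ} {N : ℕ} {r : ℕ → A}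

/-- The inverse of a Hecke generator. -/
def hinv (q : ℂ) (a : A) : A := a - lam q • 1

theorem IsHecke.mul_hinv (h : IsHecke q N r) {i : ℕ} (hi : i < N) : r i * hinv q (r i) = 1 := by
  rw [hinv, mul_sub, h.quad i hi, mul_smul_comm, mul_one, add_sub_cancel_right]

theorem IsHecke.hinv_mul (h : IsHecke q N r) {i : ℕ} (hi : i < N) : hinv q (r i) * r i = 1 := by
  rw [hinv, sub_mul, h.quad i hi, smul_mul_assoc, one_mul, add_sub_cancel_right]

theorem commute_hinv {a b : A} (h : Commute a b) : Commute a (hinv q b) :=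
  h.sub_right ((Commute.one_right a).smul_right _)

end Inverse

/-! ### Baxterized generators: the Yang–Baxter equation and unitarity -/

section Baxterized

variable {S A : Type*} [CommRing S] [Ring A] [Algebra S A]

/-- The Baxterized generator `(b - a) r + λ a`, which is `b - a` times `r + λ y / (1 - y)` for
`y = a / b`. -/
def bax [Algebra ℂ S] (q : ℂ) (r : A) (a b : S) : A := (b - a) • r + (algebraMap ℂ S (lam q) * a) • 1

variable {q : ℂ}

theorem commute_bax [Algebra ℂ S] {a r : A} (h : Commute a r) (u v : S) : Commute a (bax q r u v) :=
  (h.smul_right _).add_right ((Commute.one_right a).smul_right _)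

theorem bax_commute_bax [Algebra ℂ S] {a r : A} (h : Commute a r) (u v u' v' : S) :
    Commute (bax q a u v) (bax q r u' v') :=
  (commute_bax (commute_bax h _ _).symm _ _).symm

/-- The Yang–Baxter relation for `a r + a'`, `b t + b'`, `c r + c'`. -/
theorem yangBaxter {r t : A} {l : S} (hr : r * r = 1 + l • r) (ht : t * t = 1 + l • t)
    (hrt : r * t * r = t * r * t) {a a' b b' c c' : S}
    (h : l * a * b' * c + b' * (a * c' + a' * c) = a' * b * c') :
    (a • r + a' • 1) * (b • t + b' • 1) * (c • r + c' • 1) =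
      (c • t + c' • 1) * (b • r + b' • 1) * (a • t + a' • 1) := by
  have e1 : (a • r + a' • 1) * (b • t + b' • 1) * (c • r + c' • 1) =
      (a * b * c) • (r * t * r) + (a * b * c') • (r * t) + (a' * b * c) • (t * r)
      + (a * b' * c) • (r * r) + (b' * (a * c' + a' * c)) • r + (a' * b * c') • t
      + (a' * b' * c') • (1 : A) := by
    simp only [mul_add, add_mul, smul_mul_assoc, mul_smul_comm, mul_one, one_mul, smul_add]
    module
  have e2 : (c • t + c' • 1) * (b • r + b' • 1) * (a • t + a' • 1) =
      (a * b * c) • (t * r * t) + (a * b * c') • (r * t) + (a' * b * c) • (t * r)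
      + (a * b' * c) • (t * t) + (b' * (a * c' + a' * c)) • t + (a' * b * c') • r
      + (a' * b' * c') • (1 : A) := by
    simp only [mul_add, add_mul, smul_mul_assoc, mul_smul_comm, mul_one, one_mul, smul_add]
    module
  rw [e1, e2, hr, ht, hrt, ← h]
  module

end Baxterized

section Tower

variable {S A : Type*} [CommRing S] [Algebra ℂ S] [Ring A] [Algebra S A] [Algebra ℂ A]
  [IsScalarTower ℂ S A] {q : ℂ} {N : ℕ} {r : ℕ → A}

theorem IsHecke.quad' (h : IsHecke q N r) {i : ℕ} (hi : i < N) :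
    r i * r i = 1 + algebraMap ℂ S (lam q) • r i := by
  rw [h.quad i hi, algebraMap_smul]

/-- Unitarity. The zeros of the scalar, at b = q^{±2} a, are the fusion points; elsewhere the
Baxterized generator is invertible over a field. -/
theorem bax_mul_bax (h : IsHecke q N r) {i : ℕ} (hi : i < N) (a b : S) :
    bax q (r i) a b * bax q (r i) b a =
      ((algebraMap ℂ S (lam q)) ^ 2 * a * b - (b - a) ^ 2) • (1 : A) := by
  simp only [bax, mul_add, add_mul, smul_mul_assoc, mul_smul_comm, mul_one, one_mul, smul_add,
    h.quad' (S := S) hi]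
  module

/-- The scalar in `bax_mul_bax`, factorized. -/
theorem bax_norm (hq : q ≠ 0) (a b : S) :
    (algebraMap ℂ S (lam q)) ^ 2 * a * b - (b - a) ^ 2 =
      -((b - algebraMap ℂ S (q ^ 2) * a) * (b - algebraMap ℂ S (q⁻¹ ^ 2) * a)) := by
  have h : algebraMap ℂ S q * algebraMap ℂ S q⁻¹ = 1 := by
    rw [← map_mul, mul_inv_cancel₀ hq, map_one]
  simp only [lam, map_sub, map_pow]
  linear_combination (a * a * (algebraMap ℂ S q * algebraMap ℂ S q⁻¹ + 1) - 2 * a * b) * h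

/-- Up to the factor λ², the hypothesis reads a' b c' = b' a c: the middle ratio is the product of
the outer ones. As a polynomial identity it is settled by `ring` in each application. -/
theorem IsHecke.bax_braid (h : IsHecke q N r) {i : ℕ} (hi : i + 1 < N) {a a' b b' c c' : S}
    (hs : algebraMap ℂ S (lam q) * (b - a) * (algebraMap ℂ S (lam q) * a') * (c' - c)
      + (algebraMap ℂ S (lam q) * a') * ((b - a) * (algebraMap ℂ S (lam q) * c)
      + (algebraMap ℂ S (lam q) * a) * (c' - c)) =
      (algebraMap ℂ S (lam q) * a) * (b' - a') * (algebraMap ℂ S (lam q) * c)) :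
    bax q (r i) a b * bax q (r (i + 1)) a' b' * bax q (r i) c c' =
      bax q (r (i + 1)) c c' * bax q (r i) a' b' * bax q (r (i + 1)) a b :=
  yangBaxter (h.quad' (by omega)) (h.quad' (by omega)) (h.braid i hi) hs

end Tower

/-! ### Jucys–Murphy elements -/

section JucysMurphy

variable {A : Type*} [Ring A]

/-- The Jucys–Murphy elements of a family of Hecke generators. -/
def jm (r : ℕ → A) : ℕ → A
  | 0 => 1
  | k + 1 => r k * jm r k * r k

theorem jm_succ (r : ℕ → A) (k : ℕ) : jm r (k + 1) = r k * jm r k * r k := rfl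

theorem jm_congr {r t : ℕ → A} {k : ℕ} (h : ∀ i < k, r i = t i) : jm r k = jm t k := by
  induction k with
  | zero => rfl
  | succ k ih => rw [jm_succ, jm_succ, ih fun i hi => h i (by omega), h k (by omega)]

theorem map_jm {B : Type*} [Ring B] (φ : A →+* B) (r : ℕ → A) (k : ℕ) :
    φ (jm r k) = jm (fun i => φ (r i)) k := by
  induction k with
  | zero => exact map_one φ
  | succ k ih => rw [jm_succ, map_mul, map_mul, ih, jm_succ]

theorem commute_jm {r : ℕ → A} {a : A} {k : ℕ} (h : ∀ i < k, Commute a (r i)) :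
    Commute a (jm r k) := by
  induction k with
  | zero => exact Commute.one_right a
  | succ k ih =>
    exact ((h k (by omega)).mul_right (ih fun i hi => h i (by omega))).mul_right (h k (by omega))

variable [Algebra ℂ A] {q : ℂ} {N : ℕ} {r : ℕ → A}

theorem IsHecke.commute_jm_of_lt (h : IsHecke q N r) {i k : ℕ} (hi : i < N) (hk : k < i) :
    Commute (r i) (jm r k) :=
  commute_jm fun j hj => h.far' hi (by omega) (by omega)

/-- In the first nontrivial case the braid relation turns r_i on the left into r_{i+1}, which
commutes with J_i, and turns it back on the right. Every further conjugating generator commutes with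
r_i. -/
theorem IsHecke.commute_jm_of_gt (h : IsHecke q N r) {i k : ℕ} (hk : k ≤ N) (hi : i + 1 < k) :
    Commute (r i) (jm r k) := by
  obtain ⟨d, rfl⟩ := Nat.exists_eq_add_of_lt hi
  induction d with
  | zero =>
    have hb := h.braid i (by omega)
    have hc := h.commute_jm_of_lt (i := i + 1) (k := i) (by omega) (by omega)
    show r i * (r (i + 1) * (r i * jm r i * r i) * r (i + 1)) =
      (r (i + 1) * (r i * jm r i * r i) * r (i + 1)) * r i
    calc r i * (r (i + 1) * (r i * jm r i * r i) * r (i + 1))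
        = (r i * r (i + 1) * r i) * jm r i * (r i * r (i + 1)) := by simp only [mul_assoc]
      _ = r (i + 1) * r i * (r (i + 1) * jm r i) * (r i * r (i + 1)) := by
        rw [hb]; simp only [mul_assoc]
      _ = r (i + 1) * r i * jm r i * (r (i + 1) * r i * r (i + 1)) := by
        rw [hc.eq]; simp only [mul_assoc]
      _ = _ := by rw [← hb]; simp only [mul_assoc]
  | succ d ih =>
    have hc : Commute (r i) (r (i + 1 + d + 1)) := h.far _ _ (by omega) (by omega)
    exact (hc.mul_right (ih (by omega) (by omega))).mul_right hc

theorem IsHecke.commute_jm_jm (h : IsHecke q N r) {k l : ℕ} (hk : k ≤ N) (hl : l ≤ N) :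
    Commute (jm r k) (jm r l) := by
  wlog hkl : k ≤ l generalizing k l
  · exact (this hl hk (by omega)).symm
  rcases hkl.eq_or_lt with rfl | hkl
  · exact Commute.refl _
  · exact (commute_jm fun i hi => (h.commute_jm_of_gt hl (by omega)).symm).symm

theorem IsHecke.mul_jm (h : IsHecke q N r) {k : ℕ} (hk : k < N) :
    r k * jm r k = jm r (k + 1) * r k - lam q • jm r (k + 1) := by
  have := h.mul_hinv hk
  calc r k * jm r k = r k * jm r k * (r k * hinv q (r k)) := by rw [this, mul_one]
    _ = jm r (k + 1) * hinv q (r k) := by rw [jm_succ]; simp only [mul_assoc]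
    _ = _ := by rw [hinv, mul_sub, mul_smul_comm, mul_one]

theorem IsHecke.mul_jm_succ (h : IsHecke q N r) {k : ℕ} (hk : k < N) :
    r k * jm r (k + 1) = jm r k * r k + lam q • jm r (k + 1) := by
  have e : hinv q (r k) * jm r (k + 1) = jm r k * r k := by
    rw [jm_succ, ← mul_assoc, ← mul_assoc, h.hinv_mul hk, one_mul]
  rw [hinv, sub_mul, smul_mul_assoc, one_mul, sub_eq_iff_eq_add] at e
  exact e

end JucysMurphy

/-! ### Vectors of given weight -/

section Weights

variable {A : Type*} [Ring A] [Algebra ℂ A]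

theorem mul_aeval_of_eigen {v J : A} {c : ℂ} (h : v * J = c • v) (P : ℂ[X]) :
    v * aeval J P = P.eval c • v := by
  induction P using Polynomial.induction_on' with
  | add P Q hP hQ => rw [map_add, mul_add, hP, hQ, eval_add, add_smul]
  | monomial n a =>
    have hn : v * J ^ n = c ^ n • v := by
      induction n with
      | zero => simp
      | succ n ih => rw [pow_succ, ← mul_assoc, ih, smul_mul_assoc, h, smul_smul, pow_succ]
    rw [aeval_monomial, ← Algebra.smul_def, mul_smul_comm, hn, eval_monomial, smul_smul]

theorem commute_aeval {a J : A} (h : Commute a J) (P : ℂ[X]) : Commute a (aeval J P) := by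
  induction P using Polynomial.induction_on' with
  | add P Q hP hQ =>
    rw [map_add]
    exact hP.add_right hQ
  | monomial n b =>
    rw [aeval_monomial, ← Algebra.smul_def]
    exact (h.pow_right n).smul_right b

/-- `v` is a common right eigenvector of the first `n` Jucys–Murphy elements. -/
def HasWeight (r : ℕ → A) (n : ℕ) (a : ℕ → ℂ) (v : A) : Prop :=
  ∀ k < n, v * jm r k = a k • v

variable {q : ℂ} {N : ℕ} {r : ℕ → A}

/-- A Baxterized generator exchanges two adjacent weights. -/
theorem IsHecke.hasWeight_bax (h : IsHecke q N r) {n i : ℕ} {a : ℕ → ℂ} {v : A}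
    (hv : HasWeight r n a v) (hn : n ≤ N + 1) (hi : i + 1 < n) :
    HasWeight r n (fun k => a (Equiv.swap i (i + 1) k)) (v * bax q (r i) (a (i + 1)) (a i)) := by
  intro k hk
  have hiN : i < N := by omega
  have h0 := hv i (by omega)
  have h1 := hv (i + 1) hi
  by_cases hki : k = i
  · subst hki
    simp only [Equiv.swap_apply_left, bax, Algebra.algebraMap_self, RingHom.id_apply, mul_add,
      add_mul, mul_smul_comm, smul_mul_assoc, mul_one]
    rw [mul_assoc v, h.mul_jm hiN, mul_sub, ← mul_assoc, mul_smul_comm, h1, h0]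
    simp only [smul_mul_assoc]
    module
  by_cases hki' : k = i + 1
  · subst hki'
    simp only [Equiv.swap_apply_right, bax, Algebra.algebraMap_self, RingHom.id_apply, mul_add,
      add_mul, mul_smul_comm, smul_mul_assoc, mul_one]
    rw [mul_assoc v, h.mul_jm_succ hiN, mul_add, ← mul_assoc, mul_smul_comm, h1, h0]
    simp only [smul_mul_assoc]
    module
  · have hc : Commute (r i) (jm r k) := by
      rcases lt_or_ge k i with hlt | hge
      · exact h.commute_jm_of_lt hiN hlt
      · exact h.commute_jm_of_gt (by omega) (by omega)
    simp only [Equiv.swap_apply_of_ne_of_ne hki hki']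
    rw [mul_assoc, ← (commute_bax hc.symm _ _).eq,
      ← mul_assoc, hv k hk, smul_mul_assoc]

/-- Unitarity makes the factor invertible away from the fusion points, so an exchange of weights
that are not adjacent does not destroy a vector. -/
theorem IsHecke.eq_zero_of_mul_bax (h : IsHecke q N r) (hq : q ≠ 0) {i : ℕ} (hi : i < N)
    {a b : ℂ} {v : A} (h1 : b ≠ q ^ 2 * a) (h2 : b ≠ q⁻¹ ^ 2 * a)
    (hv : v * bax q (r i) a b = 0) : v = 0 := by
  have e := bax_mul_bax (S := ℂ) h hi a b
  rw [bax_norm hq] at e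
  have e2 : v * (bax q (r i) a b * bax q (r i) b a) = 0 := by rw [← mul_assoc, hv, zero_mul]
  rw [e, mul_smul_comm, mul_one, smul_eq_zero] at e2
  refine e2.resolve_left ?_
  simp only [Algebra.algebraMap_self, RingHom.id_apply, neg_eq_zero, mul_eq_zero, not_or,
    sub_eq_zero]
  exact ⟨h1, h2⟩

end Weights

/-! ### Contents and addable nodes -/

section Nodes

/-- The content `column - row` of a node. -/
def diag (c : ℕ × ℕ) : ℤ := (c.2 : ℤ) - (c.1 : ℤ)

variable {q : ℂ}

theorem Generic.zpow_injective (hq : Generic q) {k l : ℤ} (h : q ^ k = q ^ l) : k = l := by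
  have key : ∀ n : ℤ, q ^ n = 1 → n = 0 := by
    intro n hn
    by_contra h0
    refine hq.pow_ne_one n.natAbs (Int.natAbs_pos.mpr h0) ?_
    rcases Int.natAbs_eq n with h' | h'
    · rw [h', zpow_natCast] at hn; exact hn
    · rw [h', zpow_neg, zpow_natCast, inv_eq_one] at hn; exact hn
  have := key (k - l) (by rw [zpow_sub₀ hq.ne_zero, h, div_self (zpow_ne_zero _ hq.ne_zero)])
  omega

theorem qContent_eq (c : ℕ × ℕ) : qContent q c = q ^ (2 * diag c) := rfl

theorem Generic.qContent_inj (hq : Generic q) {a b : ℕ × ℕ} (h : qContent q a = qContent q b) :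
    diag a = diag b := by
  rw [qContent_eq, qContent_eq] at h
  have := hq.zpow_injective h
  omega

theorem Generic.qContent_ne_zero (hq : Generic q) (a : ℕ × ℕ) : qContent q a ≠ 0 :=
  zpow_ne_zero _ hq.ne_zero

theorem sq_mul_qContent (hq : q ≠ 0) (a : ℕ × ℕ) :
    q ^ 2 * qContent q a = q ^ (2 * (diag a + 1)) := by
  rw [qContent_eq, ← zpow_natCast q 2, ← zpow_add₀ hq]; congr 1; push_cast; ring

theorem inv_sq_mul_qContent (hq : q ≠ 0) (a : ℕ × ℕ) :
    q⁻¹ ^ 2 * qContent q a = q ^ (2 * (diag a - 1)) := by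
  rw [qContent_eq, inv_pow, ← zpow_natCast q 2, ← zpow_neg, ← zpow_add₀ hq]
  congr 1; push_cast; ring

theorem Generic.lam_ne_zero (hq : Generic q) : lam q ≠ 0 := by
  intro h
  have : q ^ (1 : ℤ) = q ^ (-1 : ℤ) := by
    rw [zpow_one, zpow_neg_one]; exact sub_eq_zero.mp h
  have := hq.zpow_injective this
  omega

/-- The nodes above `c` in its column and to the left of `c` in its row all lie in `D`, so counting
them bounds both coordinates. -/
theorem mem_addable {D : Finset (ℕ × ℕ)} {c : ℕ × ℕ} :
    c ∈ addable D ↔ c ∉ D ∧ IsLowerSet ((insert c D : Finset (ℕ × ℕ)) : Set (ℕ × ℕ)) := by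
  simp only [addable, Finset.mem_filter, Finset.mem_product, Finset.mem_range,
    and_iff_right_iff_imp]
  rintro ⟨hc, hl⟩
  have key : ∀ x : ℕ × ℕ, x ≤ c → x ≠ c → x ∈ D := fun x hx hne => by
    have : x ∈ ((insert c D : Finset (ℕ × ℕ)) : Set (ℕ × ℕ)) := hl hx (by simp)
    simpa [hne] using this
  constructor
  · have : ((Finset.range c.1).image fun i => (i, c.2)) ⊆ D := by
      intro x hx
      simp only [Finset.mem_image, Finset.mem_range] at hx
      obtain ⟨i, hi, rfl⟩ := hx
      exact key _ ⟨hi.le, le_rfl⟩ fun h => by rw [← h] at hi; simp at hi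
    have h2 := Finset.card_le_card this
    rw [Finset.card_image_of_injective _ fun i j h => by simpa using h, Finset.card_range] at h2
    omega
  · have : ((Finset.range c.2).image fun i => (c.1, i)) ⊆ D := by
      intro x hx
      simp only [Finset.mem_image, Finset.mem_range] at hx
      obtain ⟨i, hi, rfl⟩ := hx
      exact key _ ⟨le_rfl, hi.le⟩ fun h => by rw [← h] at hi; simp at hi
    have h2 := Finset.card_le_card this
    rw [Finset.card_image_of_injective _ fun i j h => by simpa using h, Finset.card_range] at h2
    omega

theorem mem_of_le_addable {D : Finset (ℕ × ℕ)} {c x : ℕ × ℕ} (hc : c ∈ addable D) (hx : x ≤ c)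
    (hne : x ≠ c) : x ∈ D := by
  have : x ∈ ((insert c D : Finset (ℕ × ℕ)) : Set (ℕ × ℕ)) :=
    (mem_addable.mp hc).2 hx (by simp)
  simpa [hne] using this

theorem mem_addable_of {D : Finset (ℕ × ℕ)} (hD : IsLowerSet (D : Set (ℕ × ℕ))) {c : ℕ × ℕ}
    (hc : c ∉ D) (h : ∀ x, x ≤ c → x ≠ c → x ∈ D) : c ∈ addable D := by
  refine mem_addable.mpr ⟨hc, fun a b hba ha => ?_⟩
  simp only [Finset.coe_insert, Set.mem_insert_iff, Finset.mem_coe] at ha ⊢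
  rcases ha with rfl | ha
  · by_cases hb : b = a
    · exact Or.inl hb
    · exact Or.inr (h b hba hb)
  · exact Or.inr (hD hba ha)

/-- The contents of different addable nodes differ by at least two. -/
theorem addable_diag {D : Finset (ℕ × ℕ)} {a b : ℕ × ℕ} (ha : a ∈ addable D)
    (hb : b ∈ addable D) (hab : a ≠ b) : diag a + 2 ≤ diag b ∨ diag b + 2 ≤ diag a := by
  have h1 : ¬ a ≤ b := fun h => (mem_addable.mp ha).1 (mem_of_le_addable hb h hab)
  have h2 : ¬ b ≤ a := fun h => (mem_addable.mp hb).1 (mem_of_le_addable ha h hab.symm)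
  rw [Prod.le_def] at h1 h2
  simp only [diag]
  omega

end Nodes

/-! ### Standard sequences of nodes and their idempotents -/

section Standard

/-- The set of the first `k` nodes of a sequence. -/
def nodes (ν : ℕ → ℕ × ℕ) (k : ℕ) : Finset (ℕ × ℕ) := (Finset.range k).image ν

/-- Each of the first `m` nodes is addable to the set of its predecessors: the sequence is a
standard tableau. -/
def IsStandard (ν : ℕ → ℕ × ℕ) (m : ℕ) : Prop := ∀ k < m, ν k ∈ addable (nodes ν k)

variable {ν : ℕ → ℕ × ℕ} {m : ℕ}

theorem nodes_zero (ν : ℕ → ℕ × ℕ) : nodes ν 0 = ∅ := by simp [nodes]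

theorem nodes_succ (ν : ℕ → ℕ × ℕ) (k : ℕ) : nodes ν (k + 1) = insert (ν k) (nodes ν k) := by
  rw [nodes, Finset.range_add_one, Finset.image_insert, nodes]

theorem mem_nodes {k : ℕ} {x : ℕ × ℕ} : x ∈ nodes ν k ↔ ∃ l < k, ν l = x := by
  simp [nodes]

theorem nodes_congr {μ : ℕ → ℕ × ℕ} {k : ℕ} (h : ∀ i < k, ν i = μ i) : nodes ν k = nodes μ k := by
  ext x; simp only [mem_nodes]
  exact ⟨fun ⟨l, hl, e⟩ => ⟨l, hl, (h l hl).symm.trans e⟩, fun ⟨l, hl, e⟩ => ⟨l, hl, (h l hl).trans e⟩⟩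

theorem IsStandard.mono (h : IsStandard ν m) {k : ℕ} (hk : k ≤ m) : IsStandard ν k :=
  fun l hl => h l (by omega)

theorem IsStandard.isLowerSet (h : IsStandard ν m) {k : ℕ} (hk : k ≤ m) :
    IsLowerSet ((nodes ν k : Finset (ℕ × ℕ)) : Set (ℕ × ℕ)) := by
  cases k with
  | zero => simp [nodes_zero, isLowerSet_empty]
  | succ k => rw [nodes_succ]; exact (mem_addable.mp (h k hk)).2

theorem IsStandard.injective (h : IsStandard ν m) {k l : ℕ} (hk : k < m) (hl : l < m)
    (he : ν k = ν l) : k = l := by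
  by_contra hne
  wlog hkl : k < l generalizing k l
  · exact this hl hk he.symm (Ne.symm hne) (by omega)
  exact (mem_addable.mp (h l hl)).1 (mem_nodes.mpr ⟨k, hkl, he⟩)

theorem IsStandard.extend (h : IsStandard ν m) {α : ℕ × ℕ} (hα : α ∈ addable (nodes ν m)) :
    IsStandard (Function.update ν m α) (m + 1) := by
  intro k hk
  have e : nodes (Function.update ν m α) k = nodes ν k :=
    nodes_congr fun i hi => Function.update_of_ne (by omega) _ _
  rw [e]
  rcases (Nat.lt_succ_iff.mp hk).eq_or_lt with rfl | hk
  · rwa [Function.update_self]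
  · rw [Function.update_of_ne (by omega)]; exact h k hk

end Standard

/-! ### Interpolation products and their weights -/

section Idempotent

variable {A : Type*} [Ring A] [Algebra ℂ A]

/-- The Lagrange polynomial of an addable node among the contents of all addable nodes. -/
def lagrange (q : ℂ) (D : Finset (ℕ × ℕ)) (α : ℕ × ℕ) : ℂ[X] :=
  ∏ a ∈ (addable D).erase α, C (qContent q α - qContent q a)⁻¹ * (X - C (qContent q a))

/-- The polynomial whose roots are the contents of a finite set of nodes. -/
def contentPoly (q : ℂ) (s : Finset (ℕ × ℕ)) : ℂ[X] := ∏ a ∈ s, (X - C (qContent q a))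

/-- The product of the interpolation factors of a standard tableau. -/
def idem (q : ℂ) (r : ℕ → A) (ν : ℕ → ℕ × ℕ) (m : ℕ) : A :=
  up m fun k => aeval (jm r k) (lagrange q (nodes ν k) (ν k))

variable {q : ℂ} {N : ℕ} {r : ℕ → A} {ν : ℕ → ℕ × ℕ} {m : ℕ}

theorem Generic.sub_ne_zero (hq : Generic q) {D : Finset (ℕ × ℕ)} {a b : ℕ × ℕ}
    (ha : a ∈ addable D) (hb : b ∈ addable D) (hab : a ≠ b) :
    qContent q a - qContent q b ≠ 0 := by
  intro h
  have := hq.qContent_inj (sub_eq_zero.mp h)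
  have := addable_diag ha hb hab
  omega

theorem lagrange_eval (hq : Generic q) {D : Finset (ℕ × ℕ)} {α : ℕ × ℕ} (hα : α ∈ addable D) :
    (lagrange q D α).eval (qContent q α) = 1 := by
  rw [lagrange, eval_prod]
  refine Finset.prod_eq_one fun a ha => ?_
  rw [Finset.mem_erase] at ha
  rw [eval_mul, eval_C, eval_sub, eval_X, eval_C, inv_mul_cancel₀]
  exact hq.sub_ne_zero hα ha.2 ha.1.symm

/-- The one missing linear factor completes the annihilating polynomial. This is how a statement
about the spectrum becomes an eigenvalue equation for the idempotent. -/
theorem lagrange_mul (D : Finset (ℕ × ℕ)) {α : ℕ × ℕ} (hα : α ∈ addable D) :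
    ∃ c : ℂ, lagrange q D α * (X - C (qContent q α)) = C c * contentPoly q (addable D) := by
  refine ⟨∏ a ∈ (addable D).erase α, (qContent q α - qContent q a)⁻¹, ?_⟩
  rw [lagrange, contentPoly, ← Finset.prod_erase_mul _ _ hα, Finset.prod_mul_distrib, map_prod,
    mul_assoc]

theorem idem_succ (q : ℂ) (r : ℕ → A) (ν : ℕ → ℕ × ℕ) (m : ℕ) : idem q r ν (m + 1) =
    idem q r ν m * aeval (jm r m) (lagrange q (nodes ν m) (ν m)) := rfl

theorem commute_idem {a : A} (h : ∀ k < m, Commute a (jm r k)) : Commute a (idem q r ν m) :=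
  commute_up fun k hk => commute_aeval (h k hk) _

theorem commute_idem_of_gens {a : A} (h : ∀ i, i + 1 < m → Commute a (r i)) :
    Commute a (idem q r ν m) :=
  commute_idem fun _ hk => commute_jm fun i hi => h i (by omega)

theorem map_idem {B : Type*} [Ring B] [Algebra ℂ B] (φ : A →ₐ[ℂ] B) (r : ℕ → A) :
    φ (idem q r ν m) = idem q (fun i => φ (r i)) ν m := by
  rw [idem, map_up, idem]
  congr 1; funext k
  rw [← aeval_algHom_apply]
  exact congrArg (fun z => aeval z _) (map_jm (φ : A →+* B) r k)

theorem idem_congr {t : ℕ → A} (h : ∀ i, i + 1 < m → r i = t i) :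
    idem q r ν m = idem q t ν m :=
  up_congr fun k hk => by rw [jm_congr fun i hi => h i (by omega)]

theorem IsHecke.commute_idem_jm (h : IsHecke q N r) {k : ℕ} (hm : m ≤ N + 1) (hk : k ≤ N) :
    Commute (idem q r ν m) (jm r k) :=
  (commute_idem fun _ hl => h.commute_jm_jm hk (by omega)).symm

theorem IsHecke.commute_gen_idem (h : IsHecke q N r) {i : ℕ} (hi : i < N) (hm : m ≤ i) :
    Commute (r i) (idem q r ν m) :=
  commute_idem fun _ hk => h.commute_jm_of_lt hi (by omega)

/-- Each interpolation factor takes the value one at the content of its own node. Idempotency,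
nesting of the idempotents and the fusion of the boundary operator are all deduced from this. -/
theorem HasWeight.mul_idem (hq : Generic q) (hν : IsStandard ν m) {n : ℕ} {a : ℕ → ℂ} {v : A}
    (hv : HasWeight r n a v) (hm : m ≤ n) (ha : ∀ k < m, a k = qContent q (ν k)) :
    v * idem q r ν m = v := by
  induction m with
  | zero => exact mul_one v
  | succ m ih =>
    rw [idem_succ, ← mul_assoc, ih (hν.mono (by omega)) (by omega) fun k hk => ha k (by omega),
      mul_aeval_of_eigen (hv m (by omega)), ha m (by omega), lagrange_eval hq (hν m (by omega)),
      one_smul]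

/-- On the idempotent of a standard tableau with `m` nodes, the next Jucys–Murphy element takes
the contents of the addable nodes as its only values. -/
def Spectral (q : ℂ) (r : ℕ → A) (m : ℕ) : Prop :=
  ∀ ν, IsStandard ν m →
    idem q r ν m * aeval (jm r m) (contentPoly q (addable (nodes ν m))) = 0

/-- The last factor times J minus its content is a multiple of the annihilating polynomial supplied
by `Spectral`. The earlier eigenvalues survive because the Jucys–Murphy elements commute. -/
theorem IsHecke.hasWeight_idem (h : IsHecke q N r) (hm : m ≤ N + 1)
    (hs : ∀ k < m, Spectral q r k) (hν : IsStandard ν m) :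
    HasWeight r m (fun k => qContent q (ν k)) (idem q r ν m) := by
  induction m with
  | zero => intro k hk; omega
  | succ m ih =>
    intro k hk
    rcases (Nat.lt_succ_iff.mp hk).eq_or_lt with rfl | hk
    · obtain ⟨c, hc⟩ := lagrange_mul (q := q) (nodes ν k) (hν k (by omega))
      have e : idem q r ν (k + 1) * aeval (jm r k) (X - C (qContent q (ν k))) = 0 := by
        rw [idem_succ, mul_assoc, ← map_mul, hc, map_mul, aeval_C, Algebra.commutes, ← mul_assoc,
          hs k (by omega) ν (hν.mono (by omega)), zero_mul]
      rw [map_sub, aeval_X, aeval_C, mul_sub, sub_eq_zero] at e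
      rw [e, Algebra.algebraMap_eq_smul_one, mul_smul_comm, mul_one]
    · have := ih (by omega) (fun k hk => hs k (by omega)) (hν.mono (by omega)) k hk
      have hc : Commute (aeval (jm r m) (lagrange q (nodes ν m) (ν m))) (jm r k) :=
        (commute_aeval (h.commute_jm_jm (by omega) (by omega)) _).symm
      rw [idem_succ, mul_assoc, hc.eq, ← mul_assoc, this, smul_mul_assoc]

/-- An eigenvector is annihilated by the content polynomial evaluated at its next weight. It serves
mainly in contrapositive form: a vector with an inadmissible weight is zero. -/
theorem HasWeight.exists_addable (hq : Generic q) (hs : Spectral q r m) (hν : IsStandard ν m)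
    {n : ℕ} {a : ℕ → ℂ} {v : A} (hv : HasWeight r n a v) (hm : m < n)
    (ha : ∀ k < m, a k = qContent q (ν k)) (h0 : v ≠ 0) :
    ∃ γ ∈ addable (nodes ν m), a m = qContent q γ := by
  have e := hv.mul_idem hq hν (by omega) ha
  have e2 := mul_aeval_of_eigen (hv m hm) (contentPoly q (addable (nodes ν m)))
  rw [← e, mul_assoc, hs ν hν, mul_zero, e, eq_comm, smul_eq_zero] at e2
  have e3 := e2.resolve_right h0
  rw [contentPoly, eval_prod, Finset.prod_eq_zero_iff] at e3
  obtain ⟨γ, hγ, e4⟩ := e3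
  rw [eval_sub, eval_X, eval_C, sub_eq_zero] at e4
  exact ⟨γ, hγ, e4⟩

end Idempotent

/-! ### The spectrum of the Jucys–Murphy elements -/

section Spectrum

variable {A : Type*} [Ring A] [Algebra ℂ A] {q : ℂ} {N : ℕ} {r : ℕ → A}

/-- The value at `k` of the sequence that is obtained from `a` by moving the term with index `k`
behind the term with index `M`. -/
def moveTo {B : Type*} (k M : ℕ) (a : ℕ → B) (j : ℕ) : B :=
  if j < k then a j else if j < M then a (j + 1) else if j = M then a k else a j

/-- The weight moves by one place at a time through `IsHecke.hasWeight_bax`. The hypothesis keeps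
every step away from the fusion points, so the vector stays nonzero. -/
theorem IsHecke.exists_moveTo (h : IsHecke q N r) (hq : q ≠ 0) {n k M : ℕ} {a : ℕ → ℂ} {v : A}
    (hv : HasWeight r n a v) (h0 : v ≠ 0) (hn : n ≤ N + 1) (hkM : k ≤ M) (hM : M < n)
    (ha : ∀ l, k < l → l ≤ M → a k ≠ q ^ 2 * a l ∧ a k ≠ q⁻¹ ^ 2 * a l) :
    ∃ w : A, w ≠ 0 ∧ HasWeight r n (moveTo k M a) w := by
  obtain ⟨d, rfl⟩ := Nat.exists_eq_add_of_le hkM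
  induction d with
  | zero =>
    refine ⟨v, h0, fun j hj => ?_⟩
    rw [hv j hj]; congr 1
    unfold moveTo; split_ifs with h1 h2 h3
    · rfl
    · omega
    · rw [h3]; rfl
    · rfl
  | succ d ih =>
    obtain ⟨w, hw0, hw⟩ := ih (by omega) (by omega) fun l hl hl' => ha l hl (by omega)
    have e1 : moveTo k (k + d) a (k + d) = a k := by simp [moveTo]
    have e2 : moveTo k (k + d) a (k + d + 1) = a (k + d + 1) := by
      unfold moveTo; split_ifs with h1 h2 h3 <;> first | rfl | omega
    have hw' := h.hasWeight_bax hw hn (i := k + d) (by omega)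
    rw [e1, e2] at hw'
    refine ⟨w * bax q (r (k + d)) (a (k + d + 1)) (a k), fun hz => hw0 ?_, ?_⟩
    · exact (h.eq_zero_of_mul_bax hq (by omega) (ha (k + d + 1) (by omega) (by omega)).1
        (ha (k + d + 1) (by omega) (by omega)).2 hz)
    · intro j hj
      rw [hw' j hj]; congr 1
      simp only [Equiv.swap_apply_def]
      unfold moveTo; split_ifs <;> first | rfl | omega | (congr 1; omega)

theorem isLowerSet_erase {D : Finset (ℕ × ℕ)} (hD : IsLowerSet (D : Set (ℕ × ℕ))) {β : ℕ × ℕ}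
    (hβ : ∀ x ∈ D, β ≤ x → x = β) : IsLowerSet ((D.erase β : Finset (ℕ × ℕ)) : Set (ℕ × ℕ)) := by
  intro a b hba ha
  simp only [Finset.coe_erase, Set.mem_sdiff, Finset.mem_coe, Set.mem_singleton_iff] at ha ⊢
  exact ⟨hD hba ha.1, fun e => ha.2 (hβ a ha.1 (e ▸ hba))⟩

variable {ν : ℕ → ℕ × ℕ} {m : ℕ}

theorem nodes_moveTo_of_le {k M j : ℕ} (hj : j ≤ k) : nodes (moveTo k M ν) j = nodes ν j :=
  nodes_congr fun i hi => by simp [moveTo, show i < k by omega]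

theorem IsStandard.nodes_moveTo (hν : IsStandard ν m) {k j : ℕ} (hk : k < m) (hkj : k ≤ j)
    (hj : j < m) : nodes (moveTo k (m - 1) ν) j = (nodes ν (j + 1)).erase (ν k) := by
  ext x
  simp only [Finset.mem_erase, mem_nodes]
  constructor
  · rintro ⟨l, hl, rfl⟩
    unfold moveTo
    rw [if_pos (show l < m - 1 by omega)]
    split_ifs with h1
    · exact ⟨fun e => by have := hν.injective (by omega) (by omega) e; omega, l, by omega, rfl⟩
    · exact ⟨fun e => by have := hν.injective (by omega) (by omega) e; omega, l + 1, by omega, rfl⟩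
  · rintro ⟨hx, l, hl, rfl⟩
    have hlk : l ≠ k := fun e => hx (by rw [e])
    rcases Nat.lt_or_gt_of_ne hlk with h1 | h1
    · exact ⟨l, by omega, by simp [moveTo, h1]⟩
    · refine ⟨l - 1, by omega, ?_⟩
      unfold moveTo
      rw [if_neg (by omega), if_pos (by omega), Nat.sub_add_cancel (by omega)]

/-- A maximal node of the diagram may be added last: removing it from an intermediate diagram still
leaves a lower set. -/
theorem IsStandard.moveTo (hν : IsStandard ν m) {k : ℕ} (hk : k < m)
    (hβ : ∀ x ∈ nodes ν m, ν k ≤ x → x = ν k) : IsStandard (moveTo k (m - 1) ν) m := by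
  have hsub : ∀ j ≤ m, nodes ν j ⊆ nodes ν m := fun j hj x hx => by
    obtain ⟨l, hl, e⟩ := mem_nodes.mp hx
    exact mem_nodes.mpr ⟨l, by omega, e⟩
  intro j hj
  rcases lt_or_ge j k with h1 | h1
  · rw [nodes_moveTo_of_le h1.le]
    simpa [HeckeFusion.moveTo, h1] using hν j hj
  rw [hν.nodes_moveTo hk h1 hj]
  have hlow : ∀ i ≤ m, IsLowerSet (((nodes ν i).erase (ν k) : Finset (ℕ × ℕ)) : Set (ℕ × ℕ)) :=
    fun i hi => isLowerSet_erase (hν.isLowerSet hi) fun x hx => hβ x (hsub i hi hx)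
  rw [mem_addable]
  rcases lt_or_ge j (m - 1) with h2 | h2
  · have e : HeckeFusion.moveTo k (m - 1) ν j = ν (j + 1) := by
      unfold HeckeFusion.moveTo; rw [if_neg (by omega), if_pos h2]
    have hne : ν (j + 1) ≠ ν k := fun e => by
      have := hν.injective (by omega) hk e; omega
    rw [e]
    refine ⟨fun hx => (mem_addable.mp (hν (j + 1) (by omega))).1 (Finset.mem_of_mem_erase hx), ?_⟩
    rw [← Finset.erase_insert_of_ne hne, ← nodes_succ]
    exact hlow _ (by omega)
  · have hjm : j + 1 = m := by omega
    have e : HeckeFusion.moveTo k (m - 1) ν j = ν k := by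
      unfold HeckeFusion.moveTo; rw [if_neg (by omega), if_neg (by omega), if_pos (by omega)]
    rw [e]
    refine ⟨Finset.notMem_erase _ _, ?_⟩
    rw [Finset.insert_erase (mem_nodes.mpr ⟨k, by omega, rfl⟩)]
    exact hν.isLowerSet (by omega)

/-- A corner `ν k` of the first `m` nodes whose content is adjacent to that of the node `ν m`
does not give an admissible next weight. -/
theorem IsHecke.eq_zero_of_corner (h : IsHecke q N r) (hq : Generic q) (hm : m + 1 ≤ N)
    (hs : ∀ l ≤ m, Spectral q r l) (hν : IsStandard ν (m + 1)) {k : ℕ} (hk : k < m)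
    (hβ : ∀ x ∈ nodes ν m, ν k ≤ x → x = ν k)
    (hd : diag (ν k) = diag (ν m) + 1 ∨ diag (ν k) = diag (ν m) - 1) {a : ℕ → ℂ} {v : A}
    (hv : HasWeight r (m + 2) a v) (ha : ∀ l < m + 1, a l = qContent q (ν l))
    (ha' : a (m + 1) = qContent q (ν k)) : v = 0 := by
  by_contra h0
  have hν' := (hν.mono (Nat.le_succ m)).moveTo hk hβ
  -- The nodes between are incomparable with the corner: larger nodes are excluded by its
  -- maximality, and smaller ones were added before it. Incomparable nodes have contents at distance
  -- at least two.
  have hfar : ∀ l, k < l → l ≤ m - 1 → diag (ν l) + 2 ≤ diag (ν k) ∨ diag (ν k) + 2 ≤ diag (ν l) := by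
    intro l hl hl'
    have h1 : ¬ ν k ≤ ν l := fun hle => by
      have := hν.injective (by omega) (by omega) (hβ _ (mem_nodes.mpr ⟨l, by omega, rfl⟩) hle)
      omega
    have h2 : ¬ ν l ≤ ν k := fun hle => by
      by_cases he : ν l = ν k
      · have := hν.injective (by omega) (by omega) he; omega
      · obtain ⟨i, hi, e⟩ := mem_nodes.mp (mem_of_le_addable (hν k (by omega)) hle he)
        have := hν.injective (by omega) (by omega) e; omega
    rw [Prod.le_def] at h1 h2
    simp only [diag]
    omega
  obtain ⟨w, hw0, hw⟩ := h.exists_moveTo hq.ne_zero hv h0 (k := k) (M := m - 1) (by omega)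
    (by omega) (by omega) (by
      intro l hl hl'
      rw [ha k (by omega), ha l (by omega), sq_mul_qContent hq.ne_zero,
        inv_sq_mul_qContent hq.ne_zero, qContent_eq]
      have := hfar l hl hl'
      exact ⟨fun e => by have := hq.zpow_injective e; omega,
        fun e => by have := hq.zpow_injective e; omega⟩)
  have w0 : ∀ j < m, moveTo k (m - 1) a j = qContent q (moveTo k (m - 1) ν j) := by
    intro j hj
    unfold moveTo
    split_ifs
    · exact ha j (by omega)
    · exact ha (j + 1) (by omega)
    · exact ha k (by omega)
    · exact ha j (by omega)
  have e0 : moveTo k (m - 1) a (m - 1) = qContent q (ν k) := by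
    rw [w0 _ (by omega)]; congr 1
    unfold moveTo; rw [if_neg (by omega), if_neg (by omega), if_pos rfl]
  have e1 : moveTo k (m - 1) a m = qContent q (ν m) := by
    unfold moveTo; rw [if_neg (by omega), if_neg (by omega), if_neg (by omega), ha m (by omega)]
  have e2 : moveTo k (m - 1) a (m + 1) = qContent q (ν k) := by
    unfold moveTo; rw [if_neg (by omega), if_neg (by omega), if_neg (by omega), ha']
  have hm1 : m - 1 + 1 = m := by omega
  -- the first exchange gives an inadmissible weight
  have v1 := h.hasWeight_bax hw (by omega) (i := m - 1) (by omega)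
  rw [hm1, e0, e1] at v1
  have z1 : w * bax q (r (m - 1)) (qContent q (ν m)) (qContent q (ν k)) = 0 := by
    by_contra hne
    obtain ⟨γ, hγ, e⟩ := v1.exists_addable hq (hs (m - 1) (by omega)) (hν'.mono (by omega))
      (by omega) (fun j hj => by
        rw [Equiv.swap_apply_of_ne_of_ne (by omega) (by omega)]; exact w0 j (by omega)) hne
    rw [Equiv.swap_apply_left, e1] at e
    have hb := hν' (m - 1) (by omega)
    have e4 : moveTo k (m - 1) ν (m - 1) = ν k := by
      unfold moveTo; rw [if_neg (by omega), if_neg (by omega), if_pos rfl]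
    rw [e4] at hb
    have e5 := hq.qContent_inj e
    have := addable_diag hγ hb fun e => by rw [e] at e5; omega
    omega
  have hnodes : nodes (moveTo k (m - 1) ν) m = nodes ν m := by
    have := (hν.mono (Nat.le_succ m)).nodes_moveTo hk (j := m - 1) (by omega) (by omega)
    rw [hm1] at this
    have e5 := nodes_succ (moveTo k (m - 1) ν) (m - 1)
    rw [hm1, this] at e5
    rw [e5]
    unfold moveTo; rw [if_neg (by omega), if_neg (by omega), if_pos rfl]
    exact Finset.insert_erase (mem_nodes.mpr ⟨k, hk, rfl⟩)
  have v2 := h.hasWeight_bax hw (by omega) (i := m) (by omega)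
  rw [e1, e2] at v2
  -- The second exchange would put the content of `ν k` at the index `m`, where the node `ν m` of
  -- adjacent content is addable; two addable nodes never have adjacent contents.
  have z2 : w * bax q (r m) (qContent q (ν k)) (qContent q (ν m)) = 0 := by
    by_contra hne
    obtain ⟨γ, hγ, e⟩ := v2.exists_addable hq (hs m le_rfl) hν' (by omega) (fun j hj => by
        rw [Equiv.swap_apply_of_ne_of_ne (by omega) (by omega)]; exact w0 j (by omega)) hne
    rw [Equiv.swap_apply_left, e2] at e
    rw [hnodes] at hγ
    have e5 := hq.qContent_inj e
    have := addable_diag hγ (hν m (by omega)) fun e => by rw [e] at e5; omega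
    omega
  set b := qContent q (ν k) with hb
  set c := qContent q (ν m) with hc
  have hbc : b - c ≠ 0 := fun e => by
    have := hq.qContent_inj (sub_eq_zero.mp e); omega
  have hb0 : b ≠ 0 := hq.qContent_ne_zero _
  have hc0 : c ≠ 0 := hq.qContent_ne_zero _
  have hl0 := hq.lam_ne_zero
  have s1 : w * r (m - 1) = (-(lam q * c) / (b - c)) • w := by
    simp only [bax, mul_add, mul_smul_comm, mul_one, Algebra.algebraMap_self,
      RingHom.id_apply] at z1
    rw [div_eq_inv_mul, mul_smul, neg_smul, ← eq_neg_of_add_eq_zero_left z1, smul_smul,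
      inv_mul_cancel₀ hbc, one_smul]
  have s2 : w * r m = ((lam q * b) / (b - c)) • w := by
    simp only [bax, mul_add, mul_smul_comm, mul_one, Algebra.algebraMap_self,
      RingHom.id_apply] at z2
    rw [div_eq_inv_mul, mul_smul, eq_neg_of_add_eq_zero_right z2, ← neg_smul, neg_sub, smul_smul,
      inv_mul_cancel₀ hbc, one_smul]
  -- Both generators act on `w` by scalars s and t, so the braid relation becomes s t s = t s t.
  -- With the values found this leaves b + c = 0, hence b² = c², which is impossible for two
  -- different powers of a generic q.
  have hbr := congrArg (w * ·) (h.braid (m - 1) (by omega))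
  simp only [hm1, ← mul_assoc, s1, s2, smul_mul_assoc, smul_smul] at hbr
  rw [← sub_eq_zero, ← sub_smul, smul_eq_zero] at hbr
  have hz := hbr.resolve_right hw0
  have hz2 : lam q ^ 3 * (b * c) * (b + c) = 0 := by
    field_simp at hz
    have := hz
    linear_combination (lam q ^ 0) * this
  have hbc2 : b + c = 0 := by
    rcases mul_eq_zero.mp hz2 with e | e
    · exact absurd e (mul_ne_zero (pow_ne_zero _ hl0) (mul_ne_zero hb0 hc0))
    · exact e
  have hsq : b * b = c * c := by linear_combination (b - c) * hbc2
  rw [hb, hc, qContent_eq, qContent_eq, ← zpow_add₀ hq.ne_zero, ← zpow_add₀ hq.ne_zero] at hsq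
  have := hq.zpow_injective hsq
  omega

end Spectrum

/-! ### The induction step for the spectrum -/

section Spectrum

variable {A : Type*} [Ring A] [Algebra ℂ A] {q : ℂ} {N : ℕ} {r : ℕ → A}
variable {ν : ℕ → ℕ × ℕ} {m : ℕ}

/-- If the node to the right of `ν m`, or the node below it, is not addable, then this is due to
a corner of the preceding nodes. -/
theorem IsStandard.exists_corner (hν : IsStandard ν (m + 1)) {a : ℕ × ℕ}
    (ha : a = ((ν m).1, (ν m).2 + 1) ∨ a = ((ν m).1 + 1, (ν m).2))
    (hna : a ∉ addable (nodes ν (m + 1))) :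
    ∃ k < m, (∀ x ∈ nodes ν m, ν k ≤ x → x = ν k) ∧ diag (ν k) = diag a := by
  have hα := hν m (by omega)
  have hαU := (mem_addable.mp hα).1
  have hU := hν.isLowerSet (k := m) (by omega)
  have hD := hν.isLowerSet (k := m + 1) le_rfl
  have hle : ν m ≤ a := by rcases ha with rfl | rfl <;> simp [Prod.le_def]
  have haU : a ∉ nodes ν m := fun h => hαU (hU hle h)
  have haD : a ∉ nodes ν (m + 1) := by
    rw [nodes_succ, Finset.mem_insert, not_or]
    refine ⟨fun e => ?_, haU⟩
    rcases ha with rfl | rfl <;> simp [Prod.ext_iff] at e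
  obtain ⟨x, hxa, hne, hxD⟩ : ∃ x, x ≤ a ∧ x ≠ a ∧ x ∉ nodes ν (m + 1) := by
    by_contra! hc
    exact hna (mem_addable_of hD haD hc)
  have hxα : ¬ x ≤ ν m := fun h =>
    hxD (hD h (by rw [nodes_succ]; exact Finset.mem_coe.mpr (Finset.mem_insert_self _ _)))
  have hbelow : ∀ y : ℕ × ℕ, y ≤ ν m → y ≠ ν m → ∃ k < m, ν k = y := fun y hy hy' =>
    mem_nodes.mp (mem_of_le_addable hα hy hy')
  have hbad : ∀ y ∈ nodes ν m, ¬ ν m ≤ y ∧ ¬ x ≤ y := fun y hy =>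
    ⟨fun h => hαU (hU h hy), fun h => hxD (by
      rw [nodes_succ]; exact Finset.mem_insert_of_mem (hU h hy))⟩
  obtain ⟨c1, c2, hc⟩ : ∃ c1 c2, ν m = (c1, c2) := ⟨_, _, rfl⟩
  obtain ⟨x1, x2⟩ := x
  rw [hc] at ha hxα hbelow hbad
  simp only [Prod.le_def, ne_eq, Prod.ext_iff] at hxa hne hxα hbelow hbad
  rcases ha with rfl | rfl
  · simp only at hxa hne hxα
    -- The missing node `x` lies in the column of `a` and in an earlier row, so nothing extends the
    -- node directly above `ν m` to the right, and nothing below it is present: it is the corner.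
    obtain ⟨k, hk, hkβ⟩ := hbelow (c1 - 1, c2) (by simp) (by simp; omega)
    refine ⟨k, hk, fun y hy hle => ?_, ?_⟩
    · obtain ⟨y1, y2⟩ := y
      have hb := hbad _ hy
      rw [Prod.le_def] at hle
      rw [Prod.ext_iff]
      simp only at *
      omega
    · simp only [diag] at *
      omega
  · simp only at hxa hne hxα
    -- By transposition the corner is now the node directly to the left of `ν m`.
    obtain ⟨k, hk, hkβ⟩ := hbelow (c1, c2 - 1) (by simp) (by simp; omega)
    refine ⟨k, hk, fun y hy hle => ?_, ?_⟩
    · obtain ⟨y1, y2⟩ := y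
      have hb := hbad _ hy
      rw [Prod.le_def] at hle
      rw [Prod.ext_iff]
      simp only at *
      omega
    · simp only [diag] at *
      omega

/-- The exchange element `(c - J') r + λ J'`, where `J'` is the Jucys–Murphy element that
follows one with eigenvalue `c`. -/
def exchange (q : ℂ) (r : ℕ → A) (k : ℕ) (c : ℂ) : A :=
  (c • 1 - jm r (k + 1)) * r k + lam q • jm r (k + 1)

/-- This is the weight exchange of `IsHecke.hasWeight_bax` with the second eigenvalue replaced by
the element J' itself, because the spectrum of J' is not yet known. -/
theorem IsHecke.mul_exchange_jm (h : IsHecke q N r) {k : ℕ} (hk : k < N) {c : ℂ} {w : A}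
    (hw : w * jm r k = c • w) :
    w * exchange q r k c * jm r k = w * jm r (k + 1) * exchange q r k c := by
  have hx : exchange q r k c * jm r k = (c • 1 - jm r (k + 1)) * (jm r (k + 1) * r k -
      lam q • jm r (k + 1)) + lam q • (jm r k * jm r (k + 1)) := by
    rw [exchange, add_mul, mul_assoc, h.mul_jm hk, smul_mul_assoc,
      (h.commute_jm_jm (show k ≤ N by omega) (show k + 1 ≤ N by omega)).eq]
  rw [mul_assoc, hx, mul_add, mul_smul_comm, ← mul_assoc w (jm r k), hw, exchange]
  simp only [mul_add, mul_sub, sub_mul, smul_mul_assoc, mul_smul_comm, one_mul, mul_assoc]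
  module

/-- This is unitarity with an operator in place of the second eigenvalue: the exchange can kill a
vector only where J' takes a fusion value q^{±2} c. -/
theorem IsHecke.of_mul_exchange_eq_zero (h : IsHecke q N r) (hq : q ≠ 0) {k : ℕ} (hk : k < N)
    {c : ℂ} {w : A} (hw : w * jm r k = c • w) (hz : w * exchange q r k c = 0) :
    w * aeval (jm r (k + 1)) ((X - C (q ^ 2 * c)) * (X - C (q⁻¹ ^ 2 * c))) = 0 := by
  have h1 := h.mul_exchange_jm hk hw
  rw [hz, zero_mul] at h1
  have hr : exchange q r k c * r k = (c • 1 - jm r (k + 1)) + (lam q * c) • r k := by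
    rw [exchange, add_mul, mul_assoc, h.quad k hk]
    simp only [mul_add, mul_one, sub_mul, smul_mul_assoc, one_mul, mul_smul_comm]
    module
  have h2 : w * jm r (k + 1) * exchange q r k c * r k - c • (w * exchange q r k c * r k)
      + (lam q * c) • (w * exchange q r k c) = 0 := by rw [← h1, hz]; simp
  rw [mul_assoc (w * jm r (k + 1)), mul_assoc w (exchange q r k c), hr, exchange] at h2
  have hc : q ^ 2 + q⁻¹ ^ 2 = lam q ^ 2 + 2 := by
    have := mul_inv_cancel₀ hq
    rw [lam]; linear_combination 2 * this
  have hc1 : q ^ 2 * q⁻¹ ^ 2 = 1 := by rw [← mul_pow, mul_inv_cancel₀ hq, one_pow]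
  have hp : ((X - C (q ^ 2 * c)) * (X - C (q⁻¹ ^ 2 * c)) : ℂ[X]) =
      X * X - (C ((lam q ^ 2 + 2) * c)) * X + C (c * c) := by
    rw [← hc, show c * c = (q ^ 2 * q⁻¹ ^ 2) * (c * c) by rw [hc1, one_mul]]
    simp only [map_mul, map_add, map_pow]; ring
  rw [hp]
  simp only [map_add, map_sub, map_mul (aeval (jm r (k + 1))), aeval_X, aeval_C,
    Algebra.algebraMap_eq_smul_one]
  simp only [mul_add, mul_sub, sub_mul, smul_mul_assoc, mul_smul_comm, one_mul, mul_one,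
    mul_assoc] at h2 ⊢
  rw [← neg_eq_zero, ← h2]
  module

/-- Roots are discarded one at a time. At a root outside `t` the product of the other factors is an
eigenvector with that content, and the hypothesis makes it vanish. -/
theorem contentPoly_restrict {E J : A} {s t : Finset (ℕ × ℕ)}
    (hE : E * aeval J (contentPoly q s) = 0)
    (h : ∀ a ∈ s, a ∉ t → ∀ P : ℂ[X], E * aeval J P * J = qContent q a • (E * aeval J P) →
      E * aeval J P = 0) : E * aeval J (contentPoly q t) = 0 := by
  classical
  have key : ∀ Q : ℂ[X], E * aeval J (contentPoly q s * Q) = 0 →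
      E * aeval J (contentPoly q (s.filter (· ∈ t)) * Q) = 0 := by
    clear hE
    induction s using Finset.induction_on with
    | empty => intro Q hQ; simpa using hQ
    | insert a s ha ih =>
      intro Q hQ
      have ih' := ih fun b hb => h b (Finset.mem_insert_of_mem hb)
      have e : contentPoly q (insert a s) * Q =
          contentPoly q s * ((X - C (qContent q a)) * Q) := by
        rw [contentPoly, Finset.prod_insert ha, contentPoly]; ring
      rw [e] at hQ
      by_cases hat : a ∈ t
      · rw [Finset.filter_insert, if_pos hat, contentPoly,
          Finset.prod_insert fun hm => ha (Finset.mem_filter.mp hm).1]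
        have := ih' _ hQ
        rwa [contentPoly, ← mul_assoc, mul_comm _ (X - C (qContent q a))] at this
      · rw [Finset.filter_insert, if_neg hat]
        refine ih' Q (h a (Finset.mem_insert_self a s) hat _ ?_)
        rw [show contentPoly q s * ((X - C (qContent q a)) * Q) =
          contentPoly q s * Q * (X - C (qContent q a)) by ring, map_mul, ← mul_assoc, map_sub,
          aeval_X, aeval_C, mul_sub, sub_eq_zero, Algebra.algebraMap_eq_smul_one, mul_smul_comm,
          mul_one] at hQ
        exact hQ
  have h1 := key 1 (by rwa [mul_one])
  rw [mul_one] at h1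
  have h2 : contentPoly q t = contentPoly q (s.filter (· ∈ t)) *
      contentPoly q (t \ s.filter (· ∈ t)) := by
    rw [contentPoly, contentPoly, contentPoly, mul_comm]
    exact (Finset.prod_sdiff fun x hx => (Finset.mem_filter.mp hx).2).symm
  rw [h2, map_mul, ← mul_assoc, h1, zero_mul]

theorem mem_addable_insert {D : Finset (ℕ × ℕ)} {a b : ℕ × ℕ} (ha : a ∈ addable D)
    (hb : b ∈ addable D) (hab : a ≠ b) : a ∈ addable (insert b D) := by
  rw [mem_addable] at ha hb ⊢
  refine ⟨by simp [hab, ha.1], ?_⟩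
  have := ha.2.union hb.2
  convert this using 1
  ext x
  simp only [Finset.coe_insert, Set.mem_insert_iff, Finset.mem_coe, Set.mem_union]
  tauto

/-- The vector v r would satisfy (v r)(J - c) = -λ c v with v an eigenvector for c: a Jordan block.
The annihilating polynomial of J has simple roots, which excludes it. -/
theorem Spectral.eq_zero_of_equal (hs : Spectral q r m) (h : IsHecke q N r) (hq : Generic q)
    (hm : m < N) (hν : IsStandard ν (m + 1)) {v : A} (hv : v * idem q r ν m = v)
    (h1 : v * jm r m = qContent q (ν m) • v) (h2 : v * jm r (m + 1) = qContent q (ν m) • v) :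
    v = 0 := by
  set c := qContent q (ν m) with hc
  have hα := hν m (by omega)
  have e1 : v * r m * aeval (jm r m) (contentPoly q (addable (nodes ν m))) = 0 := by
    rw [← hv, mul_assoc v, ← (h.commute_gen_idem hm le_rfl).eq, mul_assoc, mul_assoc,
      hs ν (hν.mono (Nat.le_succ m)), mul_zero, mul_zero]
  have e2 : contentPoly q (addable (nodes ν m)) =
      (X - C c) * contentPoly q ((addable (nodes ν m)).erase (ν m)) := by
    rw [contentPoly, ← Finset.mul_prod_erase _ _ hα, contentPoly]
  have e3 : v * r m * (jm r m - c • 1) = (-(lam q * c)) • v := by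
    rw [mul_sub, mul_assoc, h.mul_jm hm, mul_sub, ← mul_assoc, mul_smul_comm, h2, mul_smul_comm,
      smul_mul_assoc, mul_one]
    module
  rw [e2, map_mul, map_sub, aeval_X, aeval_C, Algebra.algebraMap_eq_smul_one, ← mul_assoc, e3,
    smul_mul_assoc, mul_aeval_of_eigen h1, smul_smul, smul_eq_zero] at e1
  refine e1.resolve_left (mul_ne_zero (neg_ne_zero.mpr (mul_ne_zero hq.lam_ne_zero
    (hq.qContent_ne_zero _))) ?_)
  rw [contentPoly, eval_prod, Finset.prod_ne_zero_iff]
  intro a ha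
  rw [Finset.mem_erase] at ha
  rw [eval_sub, eval_X, eval_C]
  exact hq.sub_ne_zero hα ha.2 ha.1.symm

/-- The exchange element carries the annihilating polynomial of J to J', and its kernel contributes
the roots q^{±2} c. So the candidates for the next content are the old addable nodes, including `ν
m`, and the right and lower neighbours of `ν m`. A repeated content is excluded by
`Spectral.eq_zero_of_equal`, and a neighbour that is not addable by `IsHecke.eq_zero_of_corner`. -/
theorem IsHecke.spectral_step (h : IsHecke q N r) (hq : Generic q) (hm : m + 1 ≤ N)
    (hs : ∀ l ≤ m, Spectral q r l) : Spectral q r (m + 1) := by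
  intro ν hν
  have hα := hν m (by omega)
  have hE := h.hasWeight_idem (m := m + 1) (by omega) (fun k hk => hs k (by omega)) hν
  have hEe : idem q r ν (m + 1) * idem q r ν m = idem q r ν (m + 1) :=
    hE.mul_idem hq (hν.mono (Nat.le_succ m)) (by omega) fun _ _ => rfl
  set E := idem q r ν (m + 1) with hEdef
  have hEc : ∀ P : ℂ[X], ∀ k ≤ N, Commute (aeval (jm r (m + 1)) P) (jm r k) := fun P k hk =>
    (commute_aeval (h.commute_jm_jm hk hm) P).symm
  have hw : ∀ P : ℂ[X], HasWeight r (m + 1) (fun k => qContent q (ν k))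
      (E * aeval (jm r (m + 1)) P) := fun P k hk => by
    rw [mul_assoc, (hEc P k (by omega)).eq, ← mul_assoc, hE k hk, smul_mul_assoc]
  have hx : E * aeval (jm r (m + 1)) (contentPoly q (addable (nodes ν m))) *
      exchange q r m (qContent q (ν m)) = 0 := by
    have key : ∀ P : ℂ[X], E * exchange q r m (qContent q (ν m)) * aeval (jm r m) P =
        E * aeval (jm r (m + 1)) P * exchange q r m (qContent q (ν m)) := by
      intro P
      induction P using Polynomial.induction_on' with
      | add P Q hP hQ => rw [map_add, map_add, mul_add, mul_add, add_mul, hP, hQ]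
      | monomial n b =>
        have hn : E * exchange q r m (qContent q (ν m)) * jm r m ^ n =
            E * jm r (m + 1) ^ n * exchange q r m (qContent q (ν m)) := by
          induction n with
          | zero => simp
          | succ n ih =>
            have hwn := hw (X ^ n) m (by omega)
            rw [map_pow, aeval_X] at hwn
            rw [pow_succ, ← mul_assoc, ih, h.mul_exchange_jm (by omega) hwn, pow_succ,
              ← mul_assoc]
        rw [aeval_monomial, aeval_monomial, ← Algebra.smul_def, ← Algebra.smul_def,
          mul_smul_comm, hn, mul_smul_comm, smul_mul_assoc]
    have hc : Commute (idem q r ν m) (exchange q r m (qContent q (ν m))) := by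
      have hJ := h.commute_idem_jm (ν := ν) (m := m) (k := m + 1) (by omega) hm
      exact ((((Commute.one_right _).smul_right _).sub_right hJ).mul_right
        (h.commute_gen_idem (show m < N by omega) le_rfl).symm).add_right (hJ.smul_right _)
    rw [← key, ← hEe, mul_assoc E, hc.eq, mul_assoc, mul_assoc, hs m le_rfl ν
      (hν.mono (Nat.le_succ m)), mul_zero, mul_zero]
  have h1 := h.of_mul_exchange_eq_zero hq.ne_zero (by omega) (hw _ m (by omega)) hx
  rw [mul_assoc, ← map_mul] at h1
  beta_reduce at h1
  have hU : ∀ a ∈ addable (nodes ν m), diag a ≠ diag (ν m) + 1 ∧ diag a ≠ diag (ν m) - 1 := by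
    intro a ha
    by_cases hne : a = ν m
    · subst hne; omega
    · have := addable_diag ha hα hne; omega
  have d1 : diag ((ν m).1, (ν m).2 + 1) = diag (ν m) + 1 := by simp only [diag]; push_cast; ring
  have d2 : diag ((ν m).1 + 1, (ν m).2) = diag (ν m) - 1 := by simp only [diag]; push_cast; ring
  have hpoly : contentPoly q (addable (nodes ν m)) *
      ((X - C (q ^ 2 * qContent q (ν m))) * (X - C (q⁻¹ ^ 2 * qContent q (ν m)))) =
      contentPoly q (insert ((ν m).1, (ν m).2 + 1) (insert ((ν m).1 + 1, (ν m).2)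
        (addable (nodes ν m)))) := by
    rw [contentPoly, contentPoly, Finset.prod_insert, Finset.prod_insert,
      qContent_eq ((ν m).1, (ν m).2 + 1), qContent_eq ((ν m).1 + 1, (ν m).2), d1, d2, sq_mul_qContent hq.ne_zero, inv_sq_mul_qContent hq.ne_zero]
    · ring
    · exact fun ha => (hU _ ha).2 d2
    · rw [Finset.mem_insert, not_or]
      exact ⟨by simp, fun ha => (hU _ ha).1 d1⟩
  rw [hpoly] at h1
  refine contentPoly_restrict h1 fun a ha hat P hP => ?_
  have hcorner : (a = ((ν m).1, (ν m).2 + 1) ∨ a = ((ν m).1 + 1, (ν m).2)) →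
      E * aeval (jm r (m + 1)) P = 0 := by
    intro ha'
    obtain ⟨k, hk, hβ, hd⟩ := hν.exists_corner ha' hat
    refine h.eq_zero_of_corner hq hm hs hν hk hβ ?_
      -- The default branch matters only at the index `m + 1`: there the corner has the same content
      -- as the node `a`.
      (a := fun l => if l < m + 1 then qContent q (ν l) else qContent q (ν k)) ?_ ?_ ?_
    · rcases ha' with rfl | rfl
      · left; rw [hd, d1]
      · right; rw [hd, d2]
    · intro l hl
      simp only
      split_ifs with hlm
      · exact hw P l hlm
      · obtain rfl : l = m + 1 := by omega
        rw [hP, qContent_eq, qContent_eq, hd]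
    · intro l hl; simp only [if_pos hl]
    · simp
  rcases Finset.mem_insert.mp ha with ha | ha
  · exact hcorner (Or.inl ha)
  rcases Finset.mem_insert.mp ha with ha | ha
  · exact hcorner (Or.inr ha)
  by_cases hne : a = ν m
  · subst hne
    refine (hs m le_rfl).eq_zero_of_equal h hq (by omega) hν ?_ (hw P m (by omega)) hP
    exact (hw P).mul_idem hq (hν.mono (Nat.le_succ m)) (by omega) fun _ _ => rfl
  · exact absurd (by rw [nodes_succ]; exact mem_addable_insert ha hα hne) hat

theorem IsHecke.spectral (h : IsHecke q N r) (hq : Generic q) :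
    ∀ m ≤ N, Spectral q r m := by
  intro m
  induction m using Nat.strong_induction_on with
  | _ m ih =>
    intro hm
    cases m with
    | zero =>
      intro ν _
      have e : addable (nodes ν 0) = {(0, 0)} := by
        ext ⟨x, y⟩
        rw [nodes_zero, mem_addable]
        simp only [Finset.notMem_empty, not_false_eq_true, insert_empty_eq, Finset.coe_singleton,
          true_and, Finset.mem_singleton]
        constructor
        · intro hl
          have : ((0, 0) : ℕ × ℕ) ∈ ({(x, y)} : Set (ℕ × ℕ)) :=
            hl (a := (x, y)) (by simp [Prod.le_def]) rfl
          exact (Set.mem_singleton_iff.mp this).symm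
        · rintro h
          rw [h]
          intro a b hba ha
          rw [Set.mem_singleton_iff] at ha ⊢
          subst ha
          exact le_antisymm hba (by simp [Prod.le_def])
      rw [e, contentPoly, Finset.prod_singleton, map_sub, aeval_X, aeval_C]
      simp [jm, qContent]
    | succ m =>
      exact h.spectral_step hq hm fun l hl => ih l (by omega) (by omega)

end Spectrum

/-! ### Eigenvalues and nesting of the tableau idempotents -/

section Idempotent

variable {A : Type*} [Ring A] [Algebra ℂ A] {q : ℂ} {N : ℕ} {r : ℕ → A}
variable {ν : ℕ → ℕ × ℕ} {m : ℕ}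

theorem IsHecke.idem_weight (h : IsHecke q N r) (hq : Generic q) (hm : m ≤ N + 1)
    (hν : IsStandard ν m) : HasWeight r m (fun k => qContent q (ν k)) (idem q r ν m) :=
  h.hasWeight_idem hm (fun k hk => h.spectral hq k (by omega)) hν

theorem IsHecke.idem_mul_jm (h : IsHecke q N r) (hq : Generic q) (hm : m ≤ N + 1)
    (hν : IsStandard ν m) {k : ℕ} (hk : k < m) :
    idem q r ν m * jm r k = qContent q (ν k) • idem q r ν m :=
  h.idem_weight hq hm hν k hk

theorem IsHecke.jm_mul_idem (h : IsHecke q N r) (hq : Generic q) (hm : m ≤ N + 1)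
    (hν : IsStandard ν m) {k : ℕ} (hk : k < m) :
    jm r k * idem q r ν m = qContent q (ν k) • idem q r ν m := by
  rw [← (h.commute_idem_jm hm (by omega)).eq, h.idem_mul_jm hq hm hν hk]

theorem IsHecke.idem_mul_idem_of_le (h : IsHecke q N r) (hq : Generic q) (hm : m ≤ N + 1)
    (hν : IsStandard ν m) {k : ℕ} (hk : k ≤ m) :
    idem q r ν m * idem q r ν k = idem q r ν m :=
  (h.idem_weight hq hm hν).mul_idem hq (hν.mono hk) hk fun _ _ => rfl

theorem IsHecke.idem_mul_idem_of_ge (h : IsHecke q N r) (hq : Generic q) (hm : m ≤ N + 1)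
    (hν : IsStandard ν m) {k : ℕ} (hk : k ≤ m) :
    idem q r ν k * idem q r ν m = idem q r ν m := by
  have hc : Commute (idem q r ν k) (idem q r ν m) :=
    commute_idem fun l hl => h.commute_idem_jm (by omega) (by omega)
  rw [hc.eq, h.idem_mul_idem_of_le hq hm hν hk]

theorem IsHecke.idem_sq (h : IsHecke q N r) (hq : Generic q) (hm : m ≤ N + 1)
    (hν : IsStandard ν m) : idem q r ν m * idem q r ν m = idem q r ν m :=
  h.idem_mul_idem_of_le hq hm hν le_rfl

end Idempotent

/-! ### The idempotent of a standard tableau is primitive -/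

section Primitive

variable {A : Type*} [Ring A] [Algebra ℂ A] {q : ℂ} {N : ℕ} {r : ℕ → A}
variable {ν : ℕ → ℕ × ℕ} {m : ℕ}

/-- The subalgebra on `m` strands. -/
def strands (r : ℕ → A) (m : ℕ) : Subalgebra ℂ A := Algebra.adjoin ℂ {a | ∃ i, i + 1 < m ∧ a = r i}

theorem gen_mem_strands {i : ℕ} (hi : i + 1 < m) : r i ∈ strands r m :=
  Algebra.subset_adjoin ⟨i, hi, rfl⟩

theorem strands_mono {n : ℕ} (hmn : m ≤ n) : strands r m ≤ strands r n :=
  Algebra.adjoin_mono fun _ ⟨i, hi, e⟩ => ⟨i, by omega, e⟩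

theorem jm_mem_strands {k : ℕ} (hk : k < m) : jm r k ∈ strands r m := by
  induction k with
  | zero => exact one_mem _
  | succ k ih =>
    exact mul_mem (mul_mem (gen_mem_strands hk) (ih (by omega))) (gen_mem_strands hk)

theorem aeval_mem {S : Subalgebra ℂ A} {a : A} (ha : a ∈ S) (P : ℂ[X]) : aeval a P ∈ S := by
  have := Polynomial.aeval_algHom_apply S.val ⟨a, ha⟩ P
  rw [Subalgebra.val_apply] at this
  rw [this]
  exact Subtype.property _

theorem idem_mem_strands : idem q r ν m ∈ strands r m :=
  up_mem fun _ hk => aeval_mem (jm_mem_strands hk) _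

theorem commute_strands {x a : A} (hx : ∀ i, i + 1 < m → Commute x (r i))
    (ha : a ∈ strands r m) : Commute x a := by
  induction ha using Algebra.adjoin_induction with
  | mem a ha => obtain ⟨i, hi, rfl⟩ := ha; exact hx i hi
  | algebraMap c => exact (Algebra.commutes c x).symm
  | add a b _ _ ha hb => exact ha.add_right hb
  | mul a b _ _ ha hb => exact ha.mul_right hb

theorem strands_of_le_one (hm : m ≤ 1) : strands r m = ⊥ :=
  eq_bot_iff.mpr (Algebra.adjoin_le fun _ ⟨_, hi, _⟩ => by omega)

/-- The elements of degree at most one in the last generator. -/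
def lowDegree (r : ℕ → A) (m : ℕ) : Submodule ℂ A :=
  Submodule.span ℂ ({a | a ∈ strands r (m + 1)} ∪
    {x | ∃ a ∈ strands r (m + 1), ∃ b ∈ strands r (m + 1), x = a * r m * b})

/-- By induction the factor between the two copies of r_m contains r_{m-1} at most once. The copies
then merge by the quadratic relation, or by the braid relation, since everything else in between
commutes with r_m. -/
theorem IsHecke.mul_gen_mem_lowDegree (h : IsHecke q N r) (hm : m < N)
    (ih : ∀ l, l + 1 = m → ∀ x ∈ strands r (l + 2), x ∈ lowDegree r l) {a b : A}
    (ha : a ∈ strands r (m + 1)) (hb : b ∈ strands r (m + 1)) :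
    a * r m * b * r m ∈ lowDegree r m := by
  have hlow : ∀ c ∈ strands r m, ∀ d ∈ strands r (m + 1), a * r m * c * r m * d ∈ lowDegree r m := by
    intro c hc d hd
    have hcm : Commute (r m) c :=
      commute_strands (fun i hi => (h.far i m (by omega) hm).symm) hc
    have hc' := strands_mono (n := m + 1) (by omega) hc
    have e : a * r m * c * r m * d = a * c * d + lam q • (a * c * r m * d) := by
      rw [mul_assoc a, hcm.eq, mul_assoc a, mul_assoc c, h.quad m hm]
      simp only [mul_add, add_mul, mul_one, mul_smul_comm, smul_mul_assoc, mul_assoc]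
    rw [e]
    refine add_mem (Submodule.subset_span (Or.inl ?_))
      (Submodule.smul_mem _ _ (Submodule.subset_span (Or.inr ?_)))
    · exact mul_mem (mul_mem ha hc') hd
    · exact ⟨a * c, mul_mem ha hc', d, hd, rfl⟩
  cases m with
  | zero =>
    rw [strands_of_le_one le_rfl, Algebra.mem_bot] at hb
    have := hlow b (by rw [strands_of_le_one (by omega), Algebra.mem_bot]; exact hb) 1 (one_mem _)
    rwa [mul_one] at this
  | succ m =>
    have hb' := ih m rfl b hb
    rw [lowDegree] at hb'
    induction hb' using Submodule.span_induction with
    | mem b hb' =>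
      rcases hb' with hb' | ⟨c, hc, d, hd, rfl⟩
      · have := hlow b hb' 1 (one_mem _)
        rwa [mul_one] at this
      · have hcm : Commute (r (m + 1)) c :=
          commute_strands (fun i hi => (h.far i (m + 1) (by omega) hm).symm) hc
        have hdm : Commute (r (m + 1)) d :=
          commute_strands (fun i hi => (h.far i (m + 1) (by omega) hm).symm) hd
        refine Submodule.subset_span (Or.inr ⟨a * c * r m, ?_, r m * d, ?_, ?_⟩)
        · exact mul_mem (mul_mem ha (strands_mono (by omega) hc)) (gen_mem_strands (by omega))
        · exact mul_mem (gen_mem_strands (by omega)) (strands_mono (by omega) hd)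
        · calc a * r (m + 1) * (c * r m * d) * r (m + 1)
              = a * (r (m + 1) * c) * r m * (d * r (m + 1)) := by simp only [mul_assoc]
            _ = a * c * (r (m + 1) * r m * r (m + 1)) * d := by
              rw [hcm.eq, ← hdm.eq]; simp only [mul_assoc]
            _ = _ := by rw [← h.braid m hm]; simp only [mul_assoc]
    | zero => simp
    | add x y hx hy hx' hy' =>
      have mem_of : ∀ z ∈ lowDegree r m, z ∈ strands r (m + 1 + 1) := by
        intro z hz
        rw [← Subalgebra.mem_toSubmodule]
        refine (Submodule.span_le (p := Subalgebra.toSubmodule (strands r (m + 1 + 1)))).mpr ?_ hz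
        rintro z (hz | ⟨c, hc, d, hd, rfl⟩)
        · exact strands_mono (by omega) hz
        · exact (strands r (m + 1 + 1)).mul_mem ((strands r (m + 1 + 1)).mul_mem
            (strands_mono (by omega) hc) (gen_mem_strands (by omega)))
            (strands_mono (by omega) hd)
      rw [mul_add, add_mul]
      exact add_mem (hx' (mem_of x hx)) (hy' (mem_of y hy))
    | smul c x hx hx' =>
      -- The induction hypothesis asks for `x` itself to lie in the subalgebra, which is recovered
      -- from `c • x` by division.
      by_cases hc : c = 0
      · simp [hc]
      rw [mul_smul_comm, smul_mul_assoc]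
      refine Submodule.smul_mem _ _ (hx' ?_)
      have := (strands r (m + 1 + 1)).smul_mem hb c⁻¹
      rwa [smul_smul, inv_mul_cancel₀ hc, one_smul] at this

/-- The span of the elements of degree at most one contains the unit and is stable under right
multiplication by the generators. It serves the induction for primitivity, where a single last
generator has to be treated. -/
theorem IsHecke.strands_le_lowDegree (h : IsHecke q N r) (hm : m < N) {x : A}
    (hx : x ∈ strands r (m + 2)) : x ∈ lowDegree r m := by
  induction m using Nat.strong_induction_on generalizing x with
  | _ m ih =>
    have ih' : ∀ l, l + 1 = m → ∀ x ∈ strands r (l + 2), x ∈ lowDegree r l :=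
      fun l hl x hx => ih l (by omega) (by omega) hx
    have key : ∀ v ∈ lowDegree r m, v * x ∈ lowDegree r m := by
      induction hx using Algebra.adjoin_induction with
      | mem x hx =>
        obtain ⟨i, hi, rfl⟩ := hx
        intro v hv
        rw [lowDegree] at hv
        induction hv using Submodule.span_induction with
        | zero => simp
        | add x y _ _ hx hy => rw [add_mul]; exact add_mem hx hy
        | smul c x _ hx => rw [smul_mul_assoc]; exact Submodule.smul_mem _ _ hx
        | mem v hv =>
          rcases hv with hv | ⟨a, ha, b, hb, rfl⟩
          · by_cases him : i = m
            · subst him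
              exact Submodule.subset_span (Or.inr ⟨v, hv, 1, one_mem _, by rw [mul_one]⟩)
            · exact Submodule.subset_span (Or.inl (mul_mem hv (gen_mem_strands (by omega))))
          · by_cases him : i = m
            · subst him
              exact h.mul_gen_mem_lowDegree hm ih' ha hb
            · exact Submodule.subset_span (Or.inr ⟨a, ha, b * r i,
                mul_mem hb (gen_mem_strands (by omega)), by rw [mul_assoc]⟩)
      | algebraMap c =>
        intro v hv
        rw [Algebra.algebraMap_eq_smul_one, mul_smul_comm, mul_one]
        exact Submodule.smul_mem _ _ hv
      | add x y _ _ hx hy => intro v hv; rw [mul_add]; exact add_mem (hx v hv) (hy v hv)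
      | mul x y _ _ hx hy => intro v hv; rw [← mul_assoc]; exact hy _ (hx v hv)
    have := key 1 (Submodule.subset_span (Or.inl (one_mem (strands r (m + 1)))))
    rwa [one_mul] at this

/-- The first free place of the first row is addable. -/
theorem addable_nonempty {D : Finset (ℕ × ℕ)} (hD : IsLowerSet (D : Set (ℕ × ℕ))) :
    (addable D).Nonempty := by
  have hex : ∃ j : ℕ, (0, j) ∉ D := by
    by_contra! hc
    have : ((Finset.range (D.card + 1)).image fun j => (0, j)) ⊆ D := by
      intro x hx
      obtain ⟨j, -, rfl⟩ := Finset.mem_image.mp hx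
      exact hc j
    have h2 := Finset.card_le_card this
    rw [Finset.card_image_of_injective _ fun i j h => by simpa using h, Finset.card_range] at h2
    omega
  classical
  refine ⟨(0, Nat.find hex), mem_addable_of hD (Nat.find_spec hex) fun x hx hne => ?_⟩
  obtain ⟨x1, x2⟩ := x
  rw [Prod.le_def] at hx
  simp only [ne_eq, Prod.ext_iff, not_and] at hx hne
  obtain rfl : x1 = 0 := by omega
  have := Nat.find_min hex (m := x2) (by have := hne rfl; omega)
  simpa using this

/-- The idempotents of the standard tableaux with `m` nodes span the unit. -/
theorem one_mem_span_idem (hq : Generic q) (r : ℕ → A) (m : ℕ) :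
    (1 : A) ∈ Submodule.span ℂ {x | ∃ μ, IsStandard μ m ∧ x = idem q r μ m} := by
  induction m with
  | zero =>
    exact Submodule.subset_span ⟨fun _ => (0, 0), fun k hk => by omega, rfl⟩
  | succ m ih =>
    refine (Submodule.span_le (p := Submodule.span ℂ
      {x | ∃ μ, IsStandard μ (m + 1) ∧ x = idem q r μ (m + 1)})).mpr ?_ ih
    rintro x ⟨μ, hμ, rfl⟩
    -- The Lagrange polynomials are a partition of unity, which splits each idempotent into those of
    -- the one-node extensions of its tableau.
    have hs : ∑ α ∈ addable (nodes μ m), lagrange q (nodes μ m) α = 1 := by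
      refine Lagrange.sum_basis (v := qContent q) ?_
        (addable_nonempty (hμ.isLowerSet le_rfl))
      intro a ha b hb hab
      by_contra hne
      exact hq.sub_ne_zero ha hb hne (sub_eq_zero.mpr hab)
    rw [SetLike.mem_coe, ← mul_one (idem q r μ m), ← map_one (aeval (R := ℂ) (jm r m)), ← hs, map_sum,
      Finset.mul_sum]
    refine Submodule.sum_mem _ fun α hα => Submodule.subset_span
      ⟨Function.update μ m α, hμ.extend hα, ?_⟩
    have e : ∀ k ≤ m, nodes (Function.update μ m α) k = nodes μ k := fun k hk =>
      nodes_congr fun i hi => Function.update_of_ne (by omega) _ _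
    rw [idem_succ, e m le_rfl, Function.update_self]
    congr 1
    refine up_congr fun k hk => ?_
    rw [e k hk.le, Function.update_of_ne (by omega)]

/-- The content of the last node is not the content of an addable node. -/
theorem IsStandard.content_ne (hq : Generic q) (hν : IsStandard ν (m + 1)) {γ : ℕ × ℕ}
    (hγ : γ ∈ addable (nodes ν (m + 1))) : qContent q (ν m) ≠ qContent q γ := by
  intro he
  have hd := hq.qContent_inj he
  have hα := hν m (by omega)
  have hD := hν.isLowerSet (k := m + 1) le_rfl
  have hαD : ν m ∈ nodes ν (m + 1) := by rw [nodes_succ]; exact Finset.mem_insert_self _ _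
  -- Nodes on one diagonal are comparable: `γ` would precede or equal `ν m`, or else lie beyond its
  -- lower neighbour. The first puts `γ` into the diagram, the second puts the lower neighbour there
  -- before `ν m` itself.
  have h1 : ¬ γ ≤ ν m := fun hle => (mem_addable.mp hγ).1 (hD hle hαD)
  have h2 : ¬ ((ν m).1 + 1, (ν m).2) ≤ γ := by
    intro hle
    have hne : ((ν m).1 + 1, (ν m).2) ≠ γ := by
      rintro rfl
      simp only [diag] at hd
      omega
    have hm := mem_of_le_addable hγ hle hne
    rw [nodes_succ, Finset.mem_insert] at hm
    rcases hm with hm | hm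
    · simp [Prod.ext_iff] at hm
    · exact (mem_addable.mp hα).1 (hν.isLowerSet (k := m) (by omega)
        (show ν m ≤ ((ν m).1 + 1, (ν m).2) by simp [Prod.le_def]) hm)
  rw [Prod.le_def] at h1 h2
  simp only [diag] at hd h1 h2
  omega

/-- Between idempotents with the same last content, the next generator is a function of the next
Jucys–Murphy element. -/
theorem IsHecke.idem_mul_gen_mul_idem (h : IsHecke q N r) (hq : Generic q) (hm : m < N)
    {μ : ℕ → ℕ × ℕ} (hν : IsStandard ν (m + 1)) (hμ : IsStandard μ (m + 1))
    (he : qContent q (ν m) = qContent q (μ m)) :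
    ∃ P : ℂ[X], idem q r ν (m + 1) * r m * idem q r μ (m + 1) =
      aeval (jm r (m + 1)) P * (idem q r ν (m + 1) * idem q r μ (m + 1)) := by
  set c := qContent q (ν m) with hc
  set E := idem q r ν (m + 1) with hE
  set E' := idem q r μ (m + 1) with hE'
  set J := jm r (m + 1) with hJ
  have hEJ : Commute E J := h.commute_idem_jm (by omega) (by omega)
  have h1 : (J - algebraMap ℂ A c) * (E * r m * E') = lam q • (J * (E * E')) := by
    have e1 : E * r m * jm r m * E' = c • (E * r m * E') := by
      rw [mul_assoc (E * r m), h.jm_mul_idem hq (by omega) hμ (by omega), ← he, mul_smul_comm]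
    have e2 : E * r m * jm r m * E' = J * (E * r m * E') - lam q • (J * (E * E')) := by
      rw [mul_assoc E, h.mul_jm hm, mul_sub, sub_mul, mul_smul_comm, smul_mul_assoc, ← mul_assoc E,
        hEJ.eq]
      simp only [mul_assoc]
    rw [sub_mul, Algebra.algebraMap_eq_smul_one, smul_mul_assoc, one_mul, ← e1, e2,
      sub_sub_cancel]
  set χ := contentPoly q (addable (nodes ν (m + 1))) with hχ
  have h0 : χ.eval c ≠ 0 := by
    rw [hχ, contentPoly, eval_prod, Finset.prod_ne_zero_iff]
    intro γ hγ
    rw [eval_sub, eval_X, eval_C]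
    exact sub_ne_zero.mpr (hν.content_ne hq hγ)
  -- Since χ(J) kills E and χ(c) is not zero, -g(J) / χ(c) inverts J - c on E.
  obtain ⟨g, hg⟩ : (X - C c) ∣ χ - C (χ.eval c) := by
    rw [dvd_iff_isRoot, IsRoot, eval_sub, eval_C, sub_self]
  have h2 : aeval J χ * E = 0 := by
    rw [← (commute_aeval hEJ χ).eq]; exact h.spectral hq (m + 1) (by omega) ν hν
  have h3 : aeval J χ = algebraMap ℂ A (χ.eval c) + aeval J g * (J - algebraMap ℂ A c) := by
    have e := congrArg (aeval J) hg
    rw [mul_comm (X - C c), map_sub, map_mul, map_sub, aeval_X, aeval_C, aeval_C] at e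
    rw [← e, add_sub_cancel]
  have h4 : (χ.eval c) • (E * r m * E') = -(aeval J g * (lam q • (J * (E * E')))) := by
    rw [← h1, eq_neg_iff_add_eq_zero, ← mul_assoc (aeval J g), ← one_mul (E * r m * E'),
      ← smul_mul_assoc, ← Algebra.algebraMap_eq_smul_one, one_mul, ← add_mul, ← h3,
      mul_assoc E, ← mul_assoc, h2, zero_mul]
  refine ⟨-(C ((χ.eval c)⁻¹ * lam q) * (g * X)), ?_⟩
  have h5 : E * r m * E' = (χ.eval c)⁻¹ • -(aeval J g * (lam q • (J * (E * E')))) := by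
    rw [← h4, inv_smul_smul₀ h0]
  rw [h5]
  simp only [map_neg, map_mul, aeval_C, aeval_X, Algebra.algebraMap_eq_smul_one, smul_mul_assoc,
    mul_smul_comm, one_mul, neg_mul, mul_assoc, smul_smul, smul_neg,
    mul_comm (lam q)]

/-- The central element `∏ (t - J_k)`. -/
def centralProd (r : ℕ → A) (m : ℕ) (t : ℂ) : A := up m fun k => t • 1 - jm r k

/-- The generator r_i commutes with the sum and the product of J_i and J_{i+1}, hence with the
product of their two factors, and it commutes with every other factor. -/
theorem IsHecke.commute_centralProd (h : IsHecke q N r) (hm : m ≤ N + 1) (t : ℂ) {i : ℕ}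
    (hi : i + 1 < m) : Commute (r i) (centralProd r m t) := by
  have hlin : ∀ {a b : A}, Commute a b → Commute a (t • 1 - b) := fun h =>
    ((Commute.one_right _).smul_right _).sub_right h
  induction m with
  | zero => omega
  | succ m ih =>
    rw [centralProd, up_succ]
    rcases Nat.lt_or_ge (i + 1) m with h1 | h1
    · exact (ih (by omega) h1).mul_right (hlin (h.commute_jm_of_gt (by omega) h1))
    · obtain rfl : m = i + 1 := by omega
      rw [up_succ, mul_assoc]
      refine Commute.mul_right (commute_up fun k hk => hlin (h.commute_jm_of_lt (by omega) hk)) ?_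
      have e1 := h.mul_jm (k := i) (by omega)
      have e2 := h.mul_jm_succ (k := i) (by omega)
      have e3 : r i * (jm r i * jm r (i + 1)) = jm r i * jm r (i + 1) * r i := by
        rw [← mul_assoc, e1, sub_mul, mul_assoc, e2, smul_mul_assoc, mul_add, mul_smul_comm,
          (h.commute_jm_jm (k := i) (l := i + 1) (by omega) (by omega)).eq, mul_assoc]
        abel
      have e4 : (t • 1 - jm r i) * (t • 1 - jm r (i + 1)) =
          (t * t) • 1 - t • (jm r i + jm r (i + 1)) + jm r i * jm r (i + 1) := by
        simp only [mul_sub, sub_mul, smul_mul_assoc, mul_smul_comm, one_mul, mul_one]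
        module
      rw [e4]
      refine Commute.add_right (Commute.sub_right ((Commute.one_right _).smul_right _)
        (Commute.smul_right ?_ _)) e3
      show r i * (_ + _) = (_ + _) * r i
      rw [mul_add, e1, e2, add_mul]
      abel

theorem IsHecke.idem_mul_centralProd (h : IsHecke q N r) (hq : Generic q) (hm : m ≤ N + 1)
    (hν : IsStandard ν m) (t : ℂ) : idem q r ν m * centralProd r m t =
      (∏ k ∈ Finset.range m, (t - qContent q (ν k))) • idem q r ν m := by
  have key : ∀ n ≤ m, idem q r ν m * centralProd r n t =
      (∏ k ∈ Finset.range n, (t - qContent q (ν k))) • idem q r ν m := by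
    intro n hn
    induction n with
    | zero => simp [centralProd, up_zero]
    | succ n ih =>
      have := ih (by omega)
      rw [centralProd] at this ⊢
      rw [up_succ, ← mul_assoc, this, smul_mul_assoc, mul_sub, h.idem_mul_jm hq hm hν hn,
        mul_smul_comm, mul_one, ← sub_smul, smul_smul, Finset.prod_range_succ]
  exact key m le_rfl

/-- A central element acts by a scalar from either side of a nonzero element, so the scalars
coincide. Thus algebra elements connect only tableaux with the same contents up to order. -/
theorem IsHecke.prod_content_eq (h : IsHecke q N r) (hq : Generic q) (hm : m ≤ N + 1)
    {μ : ℕ → ℕ × ℕ} (hν : IsStandard ν m) (hμ : IsStandard μ m) {a : A} (ha : a ∈ strands r m)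
    (h0 : idem q r ν m * a * idem q r μ m ≠ 0) (t : ℂ) :
    ∏ k ∈ Finset.range m, (t - qContent q (ν k)) =
      ∏ k ∈ Finset.range m, (t - qContent q (μ k)) := by
  have hz : ∀ b ∈ strands r m, Commute (centralProd r m t) b := fun b hb =>
    commute_strands (fun i hi => (h.commute_centralProd hm t hi).symm) hb
  have e1 := h.idem_mul_centralProd hq hm hν t
  have e2 := h.idem_mul_centralProd hq hm hμ t
  have e3 : idem q r ν m * centralProd r m t * a * idem q r μ m =
      idem q r ν m * a * (idem q r μ m * centralProd r m t) := by
    rw [mul_assoc _ _ a, (hz a ha).eq, ← mul_assoc, mul_assoc _ _ (idem q r μ m),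
      (hz _ idem_mem_strands).eq]
  rw [e1, e2, mul_smul_comm, smul_mul_assoc, smul_mul_assoc, ← sub_eq_zero, ← sub_smul,
    smul_eq_zero] at e3
  exact sub_eq_zero.mp (e3.resolve_right h0)

theorem last_eq_of_prod_eq {a b : ℕ → ℂ} (hab : ∀ k < m, a k = b k)
    (h : ∀ t : ℂ, ∏ k ∈ Finset.range (m + 1), (t - a k) = ∏ k ∈ Finset.range (m + 1), (t - b k)) :
    a m = b m := by
  obtain ⟨t, ht⟩ := Infinite.exists_notMem_finset ((Finset.range m).image a)
  have := h t
  have hc : ∏ k ∈ Finset.range m, (t - a k) = ∏ k ∈ Finset.range m, (t - b k) :=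
    Finset.prod_congr rfl fun k hk => by rw [hab k (Finset.mem_range.mp hk)]
  rw [Finset.prod_range_succ, Finset.prod_range_succ, ← hc] at this
  have h0 : ∏ k ∈ Finset.range m, (t - a k) ≠ 0 := by
    rw [Finset.prod_ne_zero_iff]
    intro k hk
    rw [sub_ne_zero]
    rintro rfl
    exact ht (Finset.mem_image_of_mem a hk)
  have := mul_left_cancel₀ h0 this
  linear_combination -this

/-- If no factor vanishes, centrality gives `μ` and `μ'` the same contents up to order. Since r_m
commutes with the earlier Jucys–Murphy elements, all contents but the last agree place by place,
hence the last ones do too. Then r_m between the idempotents is a polynomial in J_{m+1}; this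
commutes with the smaller algebra and is a scalar on E, so the induction hypothesis applies. -/
theorem IsHecke.primitive_aux (h : IsHecke q N r) (hq : Generic q) (hm : m + 1 + 1 ≤ N + 1)
    (hν : IsStandard ν (m + 1 + 1))
    (ih : ∀ a ∈ strands r (m + 1),
      ∃ c : ℂ, idem q r ν (m + 1) * a * idem q r ν (m + 1) = c • idem q r ν (m + 1))
    {μ μ' : ℕ → ℕ × ℕ} (hμ : IsStandard μ (m + 1)) (hμ' : IsStandard μ' (m + 1)) {a b : A}
    (ha : a ∈ strands r (m + 1)) (hb : b ∈ strands r (m + 1)) :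
    ∃ c : ℂ, idem q r ν (m + 1 + 1) *
      (a * idem q r μ (m + 1) * r m * idem q r μ' (m + 1) * b) * idem q r ν (m + 1 + 1) =
      c • idem q r ν (m + 1 + 1) := by
  have hν' := hν.mono (Nat.le_succ (m + 1))
  have el := h.idem_mul_idem_of_le hq hm hν (Nat.le_succ (m + 1))
  have er := h.idem_mul_idem_of_ge hq hm hν (Nat.le_succ (m + 1))
  set E := idem q r ν (m + 1 + 1) with hE
  set e := idem q r ν (m + 1) with he
  set F := idem q r μ (m + 1) with hF
  set F' := idem q r μ' (m + 1) with hF'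
  have hexp : E * (a * F * r m * F' * b) * E = E * (e * a * F) * r m * (F' * b * e) * E := by
    calc E * (a * F * r m * F' * b) * E = E * e * (a * F * r m * F' * b) * (e * E) := by
          rw [el, er]
      _ = _ := by simp only [mul_assoc]
  by_cases z1 : e * a * F = 0
  · exact ⟨0, by rw [hexp, z1]; simp⟩
  by_cases z2 : F' * b * e = 0
  · exact ⟨0, by rw [hexp, z2]; simp⟩
  by_cases z3 : F * r m * F' = 0
  · refine ⟨0, ?_⟩
    rw [mul_assoc a, mul_assoc a, z3]; simp
  have p1 := h.prod_content_eq hq (by omega) hν' hμ ha z1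
  have p2 := h.prod_content_eq hq (by omega) hμ' hν' hb z2
  have hpre : ∀ k < m, qContent q (μ k) = qContent q (μ' k) := by
    intro k hk
    have e1 : F * r m * (jm r k * F') = F * jm r k * r m * F' := by
      rw [← mul_assoc, mul_assoc F, (h.commute_jm_of_lt (by omega) hk).eq]
      simp only [mul_assoc]
    rw [h.jm_mul_idem hq (by omega) hμ' (by omega), h.idem_mul_jm hq (by omega) hμ (by omega),
      mul_smul_comm, smul_mul_assoc, smul_mul_assoc, eq_comm, ← sub_eq_zero, ← sub_smul,
      smul_eq_zero] at e1
    exact sub_eq_zero.mp (e1.resolve_right z3)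
  have hlast := last_eq_of_prod_eq hpre fun t => ((p1 t).symm.trans (p2 t).symm)
  obtain ⟨P, hP⟩ := h.idem_mul_gen_mul_idem hq (by omega) hμ hμ' hlast
  rw [← hF, ← hF'] at hP
  have hJa : Commute (jm r (m + 1)) a :=
    commute_strands (fun i hi => (h.commute_jm_of_gt (by omega) hi).symm) ha
  have hPa := (commute_aeval hJa.symm P).symm
  have hEP := mul_aeval_of_eigen (h.idem_mul_jm hq hm hν (show m + 1 < m + 1 + 1 by omega)) P
  rw [← hE] at hEP
  obtain ⟨c, hc⟩ := ih (a * F * F' * b)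
    (mul_mem (mul_mem (mul_mem ha idem_mem_strands) idem_mem_strands) hb)
  refine ⟨P.eval (qContent q (ν (m + 1))) * c, ?_⟩
  calc E * (a * F * r m * F' * b) * E = E * (a * (F * r m * F') * b) * E := by
        simp only [mul_assoc]
    _ = E * ((aeval (jm r (m + 1)) P * a) * F * F' * b) * E := by
        rw [hP, hPa.eq]; simp only [mul_assoc]
    _ = (E * aeval (jm r (m + 1)) P) * (a * F * F' * b) * E := by simp only [mul_assoc]
    _ = P.eval (qContent q (ν (m + 1))) • (E * e * (a * F * F' * b) * (e * E)) := by
        rw [hEP, el, er]; simp only [smul_mul_assoc]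
    _ = P.eval (qContent q (ν (m + 1))) • (E * (e * (a * F * F' * b) * e) * E) := by
        simp only [mul_assoc]
    _ = _ := by
        rw [hc, mul_smul_comm, el, smul_mul_assoc, h.idem_sq hq hm hν, smul_smul]

/-- The idempotent of a standard tableau is primitive. -/
theorem IsHecke.primitive (h : IsHecke q N r) (hq : Generic q) (hm : m ≤ N + 1)
    (hν : IsStandard ν m) {a : A} (ha : a ∈ strands r m) :
    ∃ c : ℂ, idem q r ν m * a * idem q r ν m = c • idem q r ν m := by
  induction m generalizing a with
  | zero =>
    rw [strands_of_le_one (by omega), Algebra.mem_bot] at ha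
    obtain ⟨c, rfl⟩ := ha
    exact ⟨c, by rw [Algebra.algebraMap_eq_smul_one, mul_smul_comm, mul_one, smul_mul_assoc,
      h.idem_sq hq hm hν]⟩
  | succ m ih =>
    have hν' := hν.mono (Nat.le_succ m)
    have el := h.idem_mul_idem_of_le hq hm hν (Nat.le_succ m)
    have er := h.idem_mul_idem_of_ge hq hm hν (Nat.le_succ m)
    cases m with
    | zero =>
      rw [strands_of_le_one (by omega), Algebra.mem_bot] at ha
      obtain ⟨c, rfl⟩ := ha
      exact ⟨c, by rw [Algebra.algebraMap_eq_smul_one, mul_smul_comm, mul_one, smul_mul_assoc,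
        h.idem_sq hq hm hν]⟩
    | succ n =>
      set E := idem q r ν (n + 1 + 1) with hE
      set e := idem q r ν (n + 1) with he
      have ha' := h.strands_le_lowDegree (m := n) (by omega) ha
      rw [lowDegree] at ha'
      clear ha
      induction ha' using Submodule.span_induction with
      | zero => exact ⟨0, by simp⟩
      | add x y _ _ hx hy =>
        obtain ⟨c, hc⟩ := hx
        obtain ⟨d, hd⟩ := hy
        exact ⟨c + d, by rw [mul_add, add_mul, hc, hd, add_smul]⟩
      | smul c x _ hx =>
        obtain ⟨d, hd⟩ := hx
        exact ⟨c * d, by rw [mul_smul_comm, smul_mul_assoc, hd, smul_smul]⟩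
      | mem x hx =>
        rcases hx with hx | ⟨a, ha, b, hb, rfl⟩
        · obtain ⟨c, hc⟩ := ih (by omega) hν' hx
          refine ⟨c, ?_⟩
          calc E * x * E = E * e * x * (e * E) := by rw [el, er]
            _ = E * (e * x * e) * E := by simp only [mul_assoc]
            _ = c • E := by
              rw [hc, mul_smul_comm, el, smul_mul_assoc, h.idem_sq hq hm hν]
        -- The unit, written as a combination of smaller idempotents, is inserted on both sides of
        -- the last generator.
        · have hone := one_mem_span_idem hq r (n + 1)
          have key : ∀ y ∈ Submodule.span ℂ {x | ∃ μ, IsStandard μ (n + 1) ∧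
              x = idem q r μ (n + 1)}, ∀ y' ∈ Submodule.span ℂ {x | ∃ μ, IsStandard μ (n + 1) ∧
              x = idem q r μ (n + 1)}, ∃ c : ℂ, E * (a * y * r n * y' * b) * E = c • E := by
            intro y hy y' hy'
            induction hy using Submodule.span_induction with
            | zero => exact ⟨0, by simp⟩
            | add x y _ _ hx hy =>
              obtain ⟨c, hc⟩ := hx
              obtain ⟨d, hd⟩ := hy
              exact ⟨c + d, by simp only [mul_add, add_mul, hc, hd, add_smul]⟩
            | smul c x _ hx =>
              obtain ⟨d, hd⟩ := hx
              exact ⟨c * d, by simp only [mul_smul_comm, smul_mul_assoc, hd, smul_smul]⟩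
            | mem x hx =>
              obtain ⟨μ, hμ, rfl⟩ := hx
              induction hy' using Submodule.span_induction with
              | zero => exact ⟨0, by simp⟩
              | add x y _ _ hx hy =>
                obtain ⟨c, hc⟩ := hx
                obtain ⟨d, hd⟩ := hy
                exact ⟨c + d, by simp only [mul_add, add_mul, hc, hd, add_smul]⟩
              | smul c x _ hx =>
                obtain ⟨d, hd⟩ := hx
                exact ⟨c * d, by simp only [mul_smul_comm, smul_mul_assoc, hd, smul_smul]⟩
              | mem x hx =>
                obtain ⟨μ', hμ', rfl⟩ := hx
                exact h.primitive_aux hq hm hν (fun x hx => ih (by omega) hν' hx) hμ hμ' ha hb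
          have := key 1 hone 1 hone
          rwa [mul_one, mul_one] at this

end Primitive

/-! ### Rows of Baxterized generators -/

section Rows

theorem semiconjBy_jm {A : Type*} [Ring A] {w : A} {r t : ℕ → A} {k : ℕ}
    (h : ∀ i < k, SemiconjBy w (t i) (r i)) : SemiconjBy w (jm t k) (jm r k) := by
  induction k with
  | zero => exact SemiconjBy.one_right w
  | succ k ih =>
    exact ((h k (by omega)).mul_right (ih fun i hi => h i (by omega))).mul_right (h k (by omega))

theorem semiconjBy_up {A : Type*} [Monoid A] {w : A} {f g : ℕ → A} {n : ℕ}
    (h : ∀ i < n, SemiconjBy w (f i) (g i)) : SemiconjBy w (up n f) (up n g) := by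
  induction n with
  | zero => exact SemiconjBy.one_right w
  | succ n ih => exact (ih fun i hi => h i (by omega)).mul_right (h n (by omega))

theorem semiconjBy_aeval {A : Type*} [Ring A] [Algebra ℂ A] {w a b : A} (h : SemiconjBy w a b)
    (P : ℂ[X]) : SemiconjBy w (aeval a P) (aeval b P) := by
  induction P using Polynomial.induction_on' with
  | add P Q hP hQ =>
    rw [map_add, map_add]
    exact hP.add_right hQ
  | monomial n c =>
    rw [aeval_monomial, aeval_monomial]
    exact SemiconjBy.mul_right (Algebra.commutes c w).symm (h.pow_right n)

theorem semiconjBy_idem {A : Type*} [Ring A] [Algebra ℂ A] {q : ℂ} {w : A} {r t : ℕ → A}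
    {ν : ℕ → ℕ × ℕ} {m : ℕ} (h : ∀ i, i + 1 < m → SemiconjBy w (t i) (r i)) :
    SemiconjBy w (idem q t ν m) (idem q r ν m) :=
  semiconjBy_up fun _ hk => semiconjBy_aeval (semiconjBy_jm fun i hi => h i (by omega)) _

/-- `A` has no torsion over `S`. -/
def TorsionFree (S A : Type*) [CommRing S] [Ring A] [Algebra S A] : Prop :=
  ∀ (s : S) (a : A), s ≠ 0 → s • a = 0 → a = 0

/-- `a` is not a complex multiple of `b`. -/
def Indep {S : Type*} [CommRing S] [Algebra ℂ S] (a b : S) : Prop :=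
  ∀ c : ℂ, a ≠ b * algebraMap ℂ S c

theorem down_mul_up_eq_smul {S A : Type*} [CommRing S] [Ring A] [Algebra S A] {n : ℕ} {f g : ℕ → A} {t : ℕ → S} (h : ∀ j < n, f j * g j = t j • 1) :
    down n f * up n g = (∏ j ∈ Finset.range n, t j) • (1 : A) := by
  induction n with
  | zero => simp [down_zero, up_zero]
  | succ n ih =>
    rw [down_succ, up_succ, mul_assoc, ← mul_assoc (down n f), ih fun j hj => h j (by omega),
      smul_mul_assoc, one_mul, mul_smul_comm, h n (by omega), smul_smul, Finset.prod_range_succ]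

variable {S A : Type*} [CommRing S] [Algebra ℂ S] [Ring A] [Algebra S A] [Algebra ℂ A]
  [IsScalarTower ℂ S A] {q : ℂ} {N : ℕ} {r : ℕ → A} {ν : ℕ → ℕ × ℕ} {n : ℕ}

variable (S) in
/-- The content of the `k`-th node as a scalar. -/
abbrev content (q : ℂ) (ν : ℕ → ℕ × ℕ) (k : ℕ) : S := algebraMap ℂ S (qContent q (ν k))

theorem IsStandard.first (hν : IsStandard ν (n + 1)) : ν 0 = (0, 0) := by
  by_contra h
  have := mem_of_le_addable (hν 0 (by omega)) (x := (0, 0)) (by simp [Prod.le_def]) (Ne.symm h)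
  simp [nodes_zero] at this

theorem IsStandard.content_zero (hν : IsStandard ν (n + 1)) : content S q ν 0 = 1 := by
  simp [content, hν.first, qContent]

/-- The product of the inverses `r (n - 1)⁻¹ ⋯ r 0⁻¹`. -/
def cycle (q : ℂ) (r : ℕ → A) (n : ℕ) : A := down n fun j => hinv q (r j)

theorem IsHecke.hinv_braid (h : IsHecke q N r) {i : ℕ} (hi : i + 1 < N) :
    hinv q (r (i + 1)) * hinv q (r i) * r (i + 1) =
      r i * (hinv q (r (i + 1)) * hinv q (r i)) := by
  have b := h.braid i hi
  have a1 := h.hinv_mul (i := i) (by omega)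
  have a2 := h.mul_hinv (i := i) (by omega)
  have b1 := h.hinv_mul hi
  have b2 := h.mul_hinv hi
  set x := r i
  set y := r (i + 1)
  set x' := hinv q x
  set y' := hinv q y
  calc y' * x' * y = y' * x' * y * (x * y * (y' * x')) := by
        rw [show x * y * (y' * x') = x * (y * y') * x' by simp only [mul_assoc], b2, mul_one, a2,
          mul_one]
    _ = y' * x' * (y * x * y) * (y' * x') := by simp only [mul_assoc]
    _ = y' * (x' * x) * y * x * (y' * x') := by rw [← b]; simp only [mul_assoc]
    _ = _ := by rw [a1, mul_one, b1, one_mul]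

/-- The braid relation for inverses, `IsHecke.hinv_braid`, moves one generator past two adjacent
factors of the cycle and lowers its index by one; the other factors commute with it. -/
theorem IsHecke.semiconjBy_cycle (h : IsHecke q N r) (hn : n ≤ N) {i : ℕ} (hi : i + 1 < n) :
    SemiconjBy (cycle q r n) (r (i + 1)) (r i) := by
  induction n with
  | zero => omega
  | succ n ih =>
    show cycle q r (n + 1) * r (i + 1) = r i * cycle q r (n + 1)
    rcases Nat.lt_or_ge (i + 1) n with h1 | h1
    · have e : cycle q r n * r (i + 1) = r i * cycle q r n := ih (by omega) h1
      have c : Commute (r i) (hinv q (r n)) :=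
        commute_hinv (h.far i n (by omega) (by omega))
      rw [cycle, down_succ, ← cycle, mul_assoc, e, ← mul_assoc, ← c.eq, mul_assoc]
    · obtain rfl : n = i + 1 := by omega
      have c : Commute (r (i + 1)) (down i fun j => hinv q (r j)) :=
        commute_down fun j hj => commute_hinv (h.far j (i + 1) (by omega) (by omega)).symm
      rw [cycle, down_succ, down_succ, mul_assoc, mul_assoc, ← c.eq, ← mul_assoc (hinv q (r i)),
        ← mul_assoc (hinv q (r (i + 1))), ← mul_assoc (hinv q (r (i + 1))), h.hinv_braid (by omega)]
      simp only [mul_assoc]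

theorem IsHecke.cycle_mul_idem (h : IsHecke q N r) (hn : n ≤ N) :
    cycle q r n * idem q (fun i => r (i + 1)) ν n = idem q r ν n * cycle q r n :=
  semiconjBy_idem fun _ hi => h.semiconjBy_cycle hn hi

theorem IsHecke.up_mul_cycle (h : IsHecke q N r) (hn : n ≤ N) : up n r * cycle q r n = 1 := by
  induction n with
  | zero => exact one_mul 1
  | succ n ih =>
    rw [up_succ, cycle, down_succ, mul_assoc, ← mul_assoc (r n), h.mul_hinv (by omega), one_mul]
    exact ih (by omega)

theorem IsHecke.cycle_mul_up (h : IsHecke q N r) (hn : n ≤ N) : cycle q r n * up n r = 1 := by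
  have := down_mul_up_eq_smul (S := ℂ) (f := fun j => hinv q (r j)) (g := r) (t := fun _ => 1)
    (n := n) fun j hj => by rw [one_smul]; exact h.hinv_mul (by omega)
  rwa [Finset.prod_const_one, one_smul] at this

/-- A row with parameters in geometric progression along the contents. -/
theorem IsHecke.idem_mul_row (h : IsHecke q N r) (hq : Generic q) (hn : n + 1 ≤ N)
    (hν : IsStandard ν (n + 1)) (a b : S) :
    idem q r ν (n + 1) * down (n + 1) (fun j => bax q (r j) a (b * content S q ν j)) =
      (∏ k ∈ Finset.range n, (b * content S q ν (k + 1) - a)) •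
        (idem q r ν (n + 1) * (b • jm r (n + 1) - a • 1) * cycle q r (n + 1)) := by
  induction n with
  | zero =>
    rw [down_one, cycle, down_one, hν.content_zero, Finset.range_zero, Finset.prod_empty, one_smul,
      mul_assoc]
    congr 1
    have := h.quad' (S := S) (i := 0) (by omega)
    have e : jm r 1 = r 0 * r 0 := by rw [jm_succ]; simp [jm]
    rw [mul_one, sub_mul, e, smul_mul_assoc, mul_assoc, h.mul_hinv (by omega), mul_one,
      smul_mul_assoc, one_mul, hinv, ← algebraMap_smul S (lam q) (1 : A), bax]
    module
  | succ n ih =>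
    have hν' := hν.mono (Nat.le_succ (n + 1))
    have ih := ih (by omega) hν'
    set E := idem q r ν (n + 1 + 1) with hE
    set e := idem q r ν (n + 1) with he
    set c := content S q ν (n + 1) with hc
    have hEe : E * e = E := h.idem_mul_idem_of_le hq (by omega) hν (by omega)
    have hre : Commute e (bax q (r (n + 1)) a (b * c)) :=
      commute_bax (h.commute_gen_idem (by omega) (by omega)).symm _ _
    have hJ : E * jm r (n + 1) = c • E := by
      rw [h.idem_mul_jm hq (by omega) hν (by omega), hc, algebraMap_smul]
    have hr : r (n + 1) * jm r (n + 1) = jm r (n + 1 + 1) * hinv q (r (n + 1)) := by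
      rw [h.mul_jm (by omega), hinv, mul_sub, mul_smul_comm, mul_one]
    -- The relation r J = J' r⁻¹ replaces the Jucys–Murphy element by its successor; the remaining
    -- occurrence of J is evaluated at `c` by E.
    have key : E * bax q (r (n + 1)) a (b * c) * (b • jm r (n + 1) - a • 1) =
        (b * c - a) • (E * (b • jm r (n + 1 + 1) - a • 1) * hinv q (r (n + 1))) := by
      have e1 : r (n + 1) = hinv q (r (n + 1)) + algebraMap ℂ S (lam q) • 1 := by
        rw [hinv, algebraMap_smul, sub_add_cancel]
      have e2 : E * bax q (r (n + 1)) a (b * c) * (b • jm r (n + 1) - a • 1) =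
          ((b * c - a) * b) • (E * (r (n + 1) * jm r (n + 1))) - ((b * c - a) * a) • (E * r (n + 1))
          + (algebraMap ℂ S (lam q) * a * b) • (E * jm r (n + 1))
          - (algebraMap ℂ S (lam q) * a * a) • E := by
        simp only [bax, mul_add, add_mul, mul_sub, smul_mul_assoc, mul_smul_comm, mul_one,
          mul_assoc E]
        module
      rw [e2, hr, hJ]
      conv_lhs => rw [e1]
      have e3 : hinv q (hinv q (r (n + 1)) + algebraMap ℂ S (lam q) • 1) = hinv q (r (n + 1)) := by
        rw [← e1]
      rw [e3]
      simp only [mul_add, mul_sub, sub_mul, smul_mul_assoc, mul_smul_comm, mul_one, mul_assoc E]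
      module
    calc E * down (n + 1 + 1) (fun j => bax q (r j) a (b * content S q ν j))
        = E * bax q (r (n + 1)) a (b * c) *
            (e * down (n + 1) fun j => bax q (r j) a (b * content S q ν j)) := by
          rw [down_succ, ← mul_assoc, ← mul_assoc, mul_assoc E _ e, ← hre.eq, ← mul_assoc E e, hEe]
      _ = (∏ k ∈ Finset.range n, (b * content S q ν (k + 1) - a)) •
          (E * bax q (r (n + 1)) a (b * c) * (b • jm r (n + 1) - a • 1) * cycle q r (n + 1)) := by
          rw [ih, mul_smul_comm, ← mul_assoc, ← mul_assoc, mul_assoc E _ e, ← hre.eq,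
            ← mul_assoc E e, hEe]
      _ = _ := by
          rw [key, smul_mul_assoc, smul_smul, Finset.prod_range_succ, mul_assoc (E * _)]
          rfl

/-- A row from the left moves the idempotent by one strand. -/
theorem IsHecke.idem_mul_down (h : IsHecke q N r) (hq : Generic q) (hn : n ≤ N)
    (hν : IsStandard ν n) (a b : S) :
    idem q r ν n * down n (fun j => bax q (r j) a (b * content S q ν j)) =
      idem q r ν n * down n (fun j => bax q (r j) a (b * content S q ν j)) *
        idem q (fun i => r (i + 1)) ν n := by
  cases n with
  | zero => simp [idem, up_zero]
  | succ n =>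
    -- By the row formula the row is, on the idempotent, a function of the next Jucys–Murphy element
    -- times the cycle, and the cycle carries the shifted idempotent to the original one.
    have hc : Commute (idem q r ν (n + 1)) (b • jm r (n + 1) - a • (1 : A)) :=
      ((h.commute_idem_jm (by omega) (by omega)).smul_right _).sub_right
        ((Commute.one_right _).smul_right _)
    rw [h.idem_mul_row hq hn hν, smul_mul_assoc, mul_assoc _ (cycle q r _), h.cycle_mul_idem hn,
      ← mul_assoc, mul_assoc (idem q r ν (n + 1)) _ (idem q r ν (n + 1)), ← hc.eq,
      ← mul_assoc (idem q r ν (n + 1)) (idem q r ν (n + 1)), h.idem_sq hq (by omega) hν]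

/-- The hypothesis says that `J` acts on `y` by a / b. The fraction need not exist in `S`, so the
value of the polynomial is written with denominators cleared. -/
theorem smul_aeval_contentPoly {J y : A} {a b : S} (hJ : b • (J * y) = a • y)
    (s : Finset (ℕ × ℕ)) :
    b ^ s.card • (aeval J (contentPoly q s) * y) =
      (∏ α ∈ s, (a - b * algebraMap ℂ S (qContent q α))) • y := by
  classical
  induction s using Finset.induction_on with
  | empty => simp [contentPoly]
  | insert α s hα ih =>
    have e : contentPoly q (insert α s) = contentPoly q s * (X - C (qContent q α)) := by
      rw [contentPoly, Finset.prod_insert hα, mul_comm, contentPoly]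
    have e2 : b • ((J - algebraMap ℂ A (qContent q α)) * y) =
        (a - b * algebraMap ℂ S (qContent q α)) • y := by
      rw [sub_mul, smul_sub, hJ, Algebra.algebraMap_eq_smul_one, smul_mul_assoc, one_mul,
        ← algebraMap_smul S (qContent q α) y]
      module
    rw [e, map_mul, map_sub, aeval_X, aeval_C, Finset.card_insert_of_notMem hα, pow_succ, mul_smul,
      mul_assoc, ← mul_smul_comm, e2, mul_smul_comm, smul_comm, ih, Finset.prod_insert hα, mul_smul]

/-- A row from the right moves the idempotent by one strand. -/
theorem IsHecke.idem_mul_up [IsDomain S] (h : IsHecke q N r) (hq : Generic q) (hn : n ≤ N)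
    (hν : IsStandard ν n) (htf : TorsionFree S A) {a b : S} (hab : Indep a b) :
    idem q (fun i => r (i + 1)) ν n * up n (fun j => bax q (r j) (b * content S q ν j) a) =
      idem q (fun i => r (i + 1)) ν n * up n (fun j => bax q (r j) (b * content S q ν j) a) *
        idem q r ν n := by
  cases n with
  | zero => simp [idem, up_zero]
  | succ n =>
    have hr1 := h.idem_mul_down hq hn hν a b
    have hrow := h.idem_mul_row hq hn hν a b
    have hcyc := h.cycle_mul_idem (ν := ν) hn
    have hcc := h.up_mul_cycle hn
    have hsq := h.idem_sq hq (by omega) hν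
    have hsp := h.spectral hq (n + 1) (by omega) ν hν
    have hEJ : Commute (idem q r ν (n + 1)) (jm r (n + 1)) :=
      h.commute_idem_jm (by omega) (by omega)
    have hFD := down_mul_up_eq_smul (S := S)
      (f := fun j => bax q (r j) a (b * content S q ν j))
      (g := fun j => bax q (r j) (b * content S q ν j) a) (n := n + 1)
      fun j hj => bax_mul_bax h (by omega) _ _
    set E := idem q r ν (n + 1)
    set E1 := idem q (fun i => r (i + 1)) ν (n + 1)
    set F := down (n + 1) (fun j => bax q (r j) a (b * content S q ν j))
    set D := up (n + 1) (fun j => bax q (r j) (b * content S q ν j) a)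
    set w := cycle q r (n + 1)
    set J := jm r (n + 1)
    -- The defect `z` must vanish. The opposite row F times D is a scalar, so E F z = 0; the row
    -- formula turns this into an eigenvector w z of J with eigenvalue a / b. By `hab` this is not a
    -- content, so w z = 0, and the cycle w is invertible.
    set z := E1 * D * (1 - E) with hz
    have h0 : E * F * z = 0 := by
      rw [hz, ← mul_assoc, ← mul_assoc, ← hr1, mul_assoc E, hFD, mul_smul_comm, mul_one,
        smul_mul_assoc, mul_sub, mul_one, hsq, sub_self, smul_zero]
    have hP : (∏ k ∈ Finset.range n, (b * content S q ν (k + 1) - a)) ≠ 0 := by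
      rw [Finset.prod_ne_zero_iff]
      intro k _ hk
      exact hab _ (sub_eq_zero.mp hk).symm
    have hc : Commute E (b • J - a • (1 : A)) :=
      (hEJ.smul_right _).sub_right ((Commute.one_right _).smul_right _)
    have hE1 : E1 * E1 = E1 := by
      have := (h.shift (M := N - 1) (k := 1) (by omega))
      have e : (fun i => r (1 + i)) = fun i => r (i + 1) := by funext i; rw [add_comm]
      rw [e] at this
      exact this.idem_sq hq (by omega) hν
    have h3 : E * (w * z) = w * z := by
      rw [← mul_assoc, ← hcyc, hz]; simp only [← mul_assoc]
      rw [mul_assoc w E1 E1, hE1]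
    have h1 : (b • J - a • 1) * (w * z) = 0 := by
      rw [hrow, smul_mul_assoc] at h0
      have h2 := htf _ _ hP h0
      rw [hc.eq, mul_assoc, mul_assoc] at h2
      rw [h3] at h2
      exact h2
    have h4 : b • (J * (w * z)) = a • (w * z) := by
      rw [sub_mul, smul_mul_assoc, smul_mul_assoc, one_mul] at h1
      exact sub_eq_zero.mp h1
    have h5 := smul_aeval_contentPoly (q := q) h4 (addable (nodes ν (n + 1)))
    have h6 : aeval J (contentPoly q (addable (nodes ν (n + 1)))) * (w * z) = 0 := by
      rw [← h3, ← mul_assoc, ← (commute_aeval hEJ _).eq, hsp, zero_mul]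
    rw [h6, smul_zero] at h5
    have h7 : w * z = 0 := by
      refine htf _ _ ?_ h5.symm
      rw [Finset.prod_ne_zero_iff]
      intro k _ hk
      exact hab _ (sub_eq_zero.mp hk)
    have h8 : z = 0 := by rw [← one_mul z, ← hcc, mul_assoc, h7, mul_zero]
    rw [hz, mul_sub, mul_one, sub_eq_zero] at h8
    exact h8

end Rows

/-! ### Products of solutions of the reflection equation -/

/-- Two families of bulk elements `R i a b`, `T i a b` and boundary elements `K a` that satisfy the
Yang–Baxter equations and the reflection equation. -/
structure Reflection (M P : Type*) [Monoid M] where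
  R : ℕ → P → P → M
  T : ℕ → P → P → M
  K : P → M
  comm_R_T : ∀ i j a b c d, i + 1 < j ∨ j + 1 < i → Commute (R i a b) (T j c d)
  comm_T_T : ∀ i j a b c d, i + 1 < j → Commute (T i a b) (T j c d)
  comm_K_R : ∀ i a b c, 0 < i → Commute (K a) (R i b c)
  comm_K_T : ∀ i a b c, 0 < i → Commute (K a) (T i b c)
  braid : ∀ i a b c, R i a b * T (i + 1) c a * T i c b = T (i + 1) c b * T i c a * R (i + 1) a b
  braid' : ∀ i a b c, R (i + 1) a b * T i a c * T (i + 1) b c = T i b c * T (i + 1) a c * R i a b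
  refl : ∀ a b, R 0 a b * K a * T 0 b a * K b = K b * T 0 a b * K a * R 0 a b

namespace Reflection

variable {M P : Type*} [Monoid M] (X : Reflection M P)

/-- The fused boundary operator. -/
def prod : ℕ → (ℕ → P) → M
  | 0, _ => 1
  | m + 1, w => prod m w * (up m fun j => X.T (m - 1 - j) (w m) (w j)) * X.K (w m)

theorem prod_succ (m : ℕ) (w : ℕ → P) : X.prod (m + 1) w =
    X.prod m w * (up m fun j => X.T (m - 1 - j) (w m) (w j)) * X.K (w m) := rfl

theorem prod_congr {m : ℕ} {w w' : ℕ → P} (h : ∀ i < m, w i = w' i) :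
    X.prod m w = X.prod m w' := by
  induction m with
  | zero => rfl
  | succ m ih =>
    rw [prod_succ, prod_succ, ih fun i hi => h i (by omega), h m (by omega)]
    congr 2
    exact up_congr fun j hj => by rw [h j (by omega)]

theorem commute_prod {a : M} {m : ℕ} {w : ℕ → P} (hT : ∀ i b c, i + 1 < m → Commute a (X.T i b c))
    (hK : ∀ b, Commute a (X.K b)) : Commute a (X.prod m w) := by
  induction m with
  | zero => exact Commute.one_right a
  | succ m ih =>
    exact ((ih fun i b c hi => hT i b c (by omega)).mul_right
      (commute_up fun j hj => hT _ _ _ (by omega))).mul_right (hK _)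

/-- The two rows are interleaved into adjacent pairs. Each application of `braid'` takes R through
one pair and lowers its position by one. -/
theorem R_mul_up (l : ℕ) (a b : P) (w : ℕ → P) :
    X.R l a b * ((up l fun j => X.T (l - 1 - j) a (w j)) * up l fun j => X.T (l - j) b (w j)) =
      ((up l fun j => X.T (l - 1 - j) b (w j)) * up l fun j => X.T (l - j) a (w j)) *
        X.R 0 a b := by
  have hc : ∀ c d : P, ∀ i j, j < i → i < l →
      Commute (X.T (l - 1 - i) c (w i)) (X.T (l - j) d (w j)) :=
    fun c d i j hij hi => X.comm_T_T _ _ _ _ _ _ (by omega)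
  rw [up_mul_up (hc a b), up_mul_up (hc b a)]
  have key : ∀ k ≤ l, X.R l a b * up k (fun j => X.T (l - 1 - j) a (w j) * X.T (l - j) b (w j)) =
      up k (fun j => X.T (l - 1 - j) b (w j) * X.T (l - j) a (w j)) * X.R (l - k) a b := by
    intro k hk
    induction k with
    | zero => rw [up_zero, up_zero, one_mul, mul_one, Nat.sub_zero]
    | succ k ih =>
      have hb := X.braid' (l - 1 - k) a b (w k)
      rw [show l - 1 - k + 1 = l - k by omega] at hb
      rw [up_succ, ← mul_assoc, ih (by omega), up_succ, mul_assoc, ← mul_assoc (X.R _ _ _), hb,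
        show l - (k + 1) = l - 1 - k by omega]
      simp only [mul_assoc]
  have := key l le_rfl
  rwa [Nat.sub_self] at this

/-- R crosses the rows of later parameters by `braid`, one position lower each time. At the last two
rows it runs down to the boundary, where the reflection equation applies; hence position i becomes m
- 2 - i on the other side. -/
theorem R_mul_prod {m i : ℕ} (hi : i + 1 < m) (w : ℕ → P) :
    X.R i (w i) (w (i + 1)) * X.prod m w =
      X.prod m (fun k => w (Equiv.swap i (i + 1) k)) * X.R (m - 2 - i) (w i) (w (i + 1)) := by
  induction m with
  | zero => omega
  | succ m ih =>
    set w' : ℕ → P := fun k => w (Equiv.swap i (i + 1) k) with hw'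
    have hw : ∀ k, k ≠ i → k ≠ i + 1 → w' k = w k := fun k h1 h2 => by
      simp only [hw', Equiv.swap_apply_of_ne_of_ne h1 h2]
    have hwi : w' i = w (i + 1) := by simp only [hw', Equiv.swap_apply_left]
    have hwi' : w' (i + 1) = w i := by simp only [hw', Equiv.swap_apply_right]
    rcases Nat.lt_or_ge (i + 1) m with h1 | h1
    · obtain ⟨d, rfl⟩ : ∃ d, m = i + (2 + d) := ⟨m - 2 - i, by omega⟩
      rw [prod_succ, prod_succ, hw _ (by omega) (by omega), ← mul_assoc, ← mul_assoc, ih h1]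
      have hd : i + (2 + d) - 2 - i = d := by omega
      rw [hd, show i + (2 + d) + 1 - 2 - i = d + 1 by omega]
      simp only [mul_assoc]
      congr 1
      rw [up_add i (2 + d), up_add i (2 + d), up_add 2 d, up_add 2 d]
      simp only [up_succ, up_zero, one_mul, add_zero]
      have e1 : (up i fun j => X.T (i + (2 + d) - 1 - j) (w (i + (2 + d))) (w' j)) =
          up i fun j => X.T (i + (2 + d) - 1 - j) (w (i + (2 + d))) (w j) :=
        up_congr fun j hj => by rw [hw j (by omega) (by omega)]
      have e2 : (up d fun j => X.T (i + (2 + d) - 1 - (i + (2 + j))) (w (i + (2 + d)))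
            (w' (i + (2 + j)))) =
          up d fun j => X.T (i + (2 + d) - 1 - (i + (2 + j))) (w (i + (2 + d))) (w (i + (2 + j))) :=
        up_congr fun j hj => by rw [hw _ (by omega) (by omega)]
      rw [e1, e2, hwi, hwi', show i + (2 + d) - 1 - i = d + 1 by omega,
        show i + (2 + d) - 1 - (i + 1) = d by omega]
      have c1 : Commute (X.R d (w i) (w (i + 1)))
          (up i fun j => X.T (i + (2 + d) - 1 - j) (w (i + (2 + d))) (w j)) :=
        commute_up fun j hj => X.comm_R_T _ _ _ _ _ _ (by omega)
      have c2 : Commute (X.R (d + 1) (w i) (w (i + 1))) (up d fun j =>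
          X.T (i + (2 + d) - 1 - (i + (2 + j))) (w (i + (2 + d))) (w (i + (2 + j)))) :=
        commute_up fun j hj => X.comm_R_T _ _ _ _ _ _ (by omega)
      have c3 := X.comm_K_R (d + 1) (w (i + (2 + d))) (w i) (w (i + 1)) (by omega)
      have hb := X.braid d (w i) (w (i + 1)) (w (i + (2 + d)))
      have hb' := fun z => congrArg (· * z) hb
      simp only [mul_assoc] at hb' ⊢
      rw [c3.eq, ← mul_assoc, c1.eq, mul_assoc, hb', ← mul_assoc (X.R (d + 1) _ _) _ (X.K _), c2.eq,
        mul_assoc]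
    · obtain ⟨l, rfl⟩ : ∃ l, m = l + 1 := ⟨m - 1, by omega⟩
      obtain rfl : i = l := by omega
      rw [prod_succ, prod_succ, prod_succ, prod_succ, hwi, hwi', up_succ, up_succ, hwi,
        show i + 1 + 1 - 2 - i = 0 by omega,
        X.prod_congr (w := w') (w' := w) fun k hk => hw k (by omega) (by omega)]
      simp only [show i + 1 - 1 - i = 0 by omega, show ∀ j, i + 1 - 1 - j = i - j from
        fun j => by omega]
      have e : ∀ (g : ℕ → ℕ) c, (up i fun j => X.T (g j) c (w' j)) =
          up i fun j => X.T (g j) c (w j) :=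
        fun g c => up_congr fun j hj => by rw [hw j (by omega) (by omega)]
      rw [e, e]
      set a := w i
      set b := w (i + 1)
      have c1 : Commute (X.R i a b) (X.prod i w) := by
        rcases Nat.eq_zero_or_pos i with h0 | h0
        · subst h0; exact Commute.one_right _
        · exact X.commute_prod (fun k b c hk => X.comm_R_T _ _ _ _ _ _ (by omega))
            fun c => (X.comm_K_R _ _ _ _ h0).symm
      have c2 : ∀ c d, Commute (X.K c) (up i fun j => X.T (i - j) d (w j)) := fun c d =>
        commute_up fun j hj => X.comm_K_T _ _ _ _ (by omega)
      have h2 := X.R_mul_up i a b w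
      calc X.R i a b * (X.prod i w * (up i fun j => X.T (i - 1 - j) a (w j)) * X.K a *
            ((up i fun j => X.T (i - j) b (w j)) * X.T 0 b a) * X.K b)
          = (X.R i a b * X.prod i w) * (up i fun j => X.T (i - 1 - j) a (w j)) *
            (X.K a * (up i fun j => X.T (i - j) b (w j))) * X.T 0 b a * X.K b := by
            simp only [mul_assoc]
        _ = X.prod i w * (X.R i a b * ((up i fun j => X.T (i - 1 - j) a (w j)) *
            (up i fun j => X.T (i - j) b (w j)))) * X.K a * X.T 0 b a * X.K b := by
            rw [c1.eq, (c2 a b).eq]; simp only [mul_assoc]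
        _ = X.prod i w * ((up i fun j => X.T (i - 1 - j) b (w j)) *
            (up i fun j => X.T (i - j) a (w j))) *
            (X.R 0 a b * X.K a * X.T 0 b a * X.K b) := by
            rw [h2]; simp only [mul_assoc]
        _ = X.prod i w * (up i fun j => X.T (i - 1 - j) b (w j)) *
            ((up i fun j => X.T (i - j) a (w j)) * X.K b) * X.T 0 a b * X.K a * X.R 0 a b := by
            rw [X.refl]; simp only [mul_assoc]
        _ = _ := by rw [← (c2 b a).eq]; simp only [mul_assoc]

/-- The parameters `u 0, …, u (m - 1)` with the first `k` of the parameters `v` before them and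
the others after them, and the parameter `v k` at the position `k + j`. -/
def between (u v : ℕ → P) (m k j i : ℕ) : P :=
  if i < k then v i else if i < k + j then u (i - k) else if i = k + j then v k
  else if i ≤ k + m then u (i - k - 1) else v (i - m)

/-- Concatenation of sequences. -/
def cat (m : ℕ) (u v : ℕ → P) (i : ℕ) : P := if i < m then u i else v (i - m)

theorem between_swap (u v : ℕ → P) {m k j : ℕ} (hj : j < m) :
    (fun i => between u v m k (j + 1) (Equiv.swap (k + j) (k + j + 1) i)) =
      between u v m k j := by
  funext i
  by_cases h1 : i = k + j
  · subst h1
    rw [Equiv.swap_apply_left]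
    simp [between, add_assoc]
  by_cases h2 : i = k + j + 1
  · subst h2
    rw [Equiv.swap_apply_right]
    simp only [between]
    rw [if_neg (by omega), if_pos (by omega), if_neg (by omega), if_neg (by omega),
      if_neg (by omega), if_pos (by omega)]
    congr 1; omega
  rw [Equiv.swap_apply_of_ne_of_ne h1 h2]
  simp only [between]
  split_ifs <;> first | rfl | omega

theorem between_zero (u v : ℕ → P) (m : ℕ) : between u v m 0 m = cat m u v := by
  funext i
  simp only [between, cat]
  split_ifs <;> first | rfl | omega | (congr 1; omega)

theorem between_succ (u v : ℕ → P) (m k : ℕ) : between u v m k 0 = between u v m (k + 1) m := by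
  funext i
  simp only [between]
  split_ifs <;> first | rfl | omega | (congr 1; omega)

theorem between_last (u v : ℕ → P) {m n i : ℕ} (hi : i < n + m) :
    between u v m n m i = cat n v u i := by
  simp only [between, cat]
  split_ifs <;> rfl

theorem row_mul_prod (u v : ℕ → P) {m n k : ℕ} (hk : k < n) :
    (up m fun j => X.R (k + j) (u j) (v k)) * X.prod (m + n) (between u v m k m) =
      X.prod (m + n) (between u v m k 0) *
        up m fun j => X.R (m + n - 2 - (k + j)) (u j) (v k) := by
  have key : ∀ j ≤ m, (up j fun j => X.R (k + j) (u j) (v k)) *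
      X.prod (m + n) (between u v m k j) = X.prod (m + n) (between u v m k 0) *
        up j fun j => X.R (m + n - 2 - (k + j)) (u j) (v k) := by
    intro j hj
    induction j with
    | zero => rw [up_zero, up_zero, one_mul, mul_one]
    | succ j ih =>
      have := X.R_mul_prod (m := m + n) (i := k + j) (by omega) (between u v m k (j + 1))
      rw [between_swap u v (by omega)] at this
      have e1 : between u v m k (j + 1) (k + j) = u j := by
        simp [between]
      have e2 : between u v m k (j + 1) (k + j + 1) = v k := by
        simp [between, add_assoc]
      rw [e1, e2] at this
      rw [up_succ, up_succ, mul_assoc, this, ← mul_assoc, ih (by omega), mul_assoc]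
  exact key m le_rfl

/-- The operator that exchanges two blocks of parameters; `g` renumbers the strands. -/
def exchange (g : ℕ → ℕ) (m n : ℕ) (u v : ℕ → P) : M :=
  down n fun k => up m fun j => X.R (g (k + j)) (u j) (v k)

/-- Parameters of the second block are carried, one after another, through the whole first block;
`between` records the intermediate arrangements. -/
theorem exchange_mul_prod (u v : ℕ → P) (m n : ℕ) :
    X.exchange id m n u v * X.prod (m + n) (cat m u v) =
      X.prod (m + n) (cat n v u) * X.exchange (fun i => m + n - 2 - i) m n u v := by
  have key : ∀ k ≤ n, X.exchange id m k u v * X.prod (m + n) (cat m u v) =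
      X.prod (m + n) (between u v m k m) * X.exchange (fun i => m + n - 2 - i) m k u v := by
    intro k hk
    induction k with
    | zero => rw [exchange, exchange, down_zero, down_zero, one_mul, mul_one, between_zero]
    | succ k ih =>
      have := X.row_mul_prod u v (m := m) (n := n) (k := k) (by omega)
      rw [exchange, down_succ, ← exchange, mul_assoc, ih (by omega), exchange.eq_1 _ _ _ (k + 1),
        down_succ, ← exchange, ← mul_assoc, ← mul_assoc, ← between_succ]
      exact congrArg (· * _) this
  rw [key n le_rfl]
  congr 1
  exact X.prod_congr fun i hi => between_last u v (by omega)

/-- The crossing of two blocks. -/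
def crossing (m n : ℕ) (u v : ℕ → P) : M :=
  up n fun k => up m fun j => X.T (k + (m - 1 - j)) (v k) (u j)

/-- In each row of the second block the factors that involve the first block act on higher
positions, so they commute with the rows of the second block that are already collected. -/
theorem prod_cat (u v : ℕ → P) (m n : ℕ) :
    X.prod (m + n) (cat m u v) = X.prod m u * X.crossing m n u v * X.prod n v := by
  have h1 : ∀ i < m, cat m u v i = u i := fun i hi => if_pos hi
  have h2 : ∀ i, cat m u v (m + i) = v i := fun i => by
    rw [cat, if_neg (by omega)]; congr 1; omega
  induction n with
  | zero =>
    rw [crossing, up_zero, mul_one]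
    show _ = _ * 1
    rw [mul_one]
    exact X.prod_congr h1
  | succ n ih =>
    have e1 : (up m fun j => X.T (m + n - 1 - j) (v n) (cat m u v j)) =
        up m fun j => X.T (n + (m - 1 - j)) (v n) (u j) :=
      up_congr fun j hj => by rw [h1 j hj]; congr 1; omega
    have e2 : (up n fun j => X.T (m + n - 1 - (m + j)) (v n) (cat m u v (m + j))) =
        up n fun j => X.T (n - 1 - j) (v n) (v j) :=
      up_congr fun j hj => by rw [h2 j]; congr 1; omega
    have c : Commute (up m fun j => X.T (n + (m - 1 - j)) (v n) (u j)) (X.prod n v) := by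
      rcases Nat.eq_zero_or_pos n with h0 | h0
      · subst h0; exact Commute.one_right _
      · exact X.commute_prod
          (fun i b c hi => (commute_up fun j hj => X.comm_T_T _ _ _ _ _ _ (by omega)).symm)
          fun b => (commute_up fun j hj => X.comm_K_T _ _ _ _ (by omega)).symm
    rw [← add_assoc, prod_succ, h2, up_add, e1, e2, ih, crossing, crossing, up_succ, prod_succ]
    simp only [mul_assoc]
    rw [← mul_assoc (X.prod n v), ← c.eq]
    simp only [mul_assoc]

end Reflection

/-! ### The boundary element -/

section Boundary

/-- `σ 0, σ 1, …` and `τ` satisfy the relations of the affine Hecke algebra. -/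
structure IsAffine {A : Type*} [Ring A] [Algebra ℂ A] (q : ℂ) (σ : ℕ → A) (τ : A) : Prop where
  hecke : ∀ N, IsHecke q N σ
  refl : τ * σ 0 * τ * σ 0 = σ 0 * τ * σ 0 * τ
  comm : ∀ i, 0 < i → Commute τ (σ i)

theorem commute_ringInverse {A : Type*} [Ring A] {a b : A} (h : Commute a b) :
    Commute a (Ring.inverse b) := by
  by_cases hb : IsUnit b
  · obtain ⟨u, rfl⟩ := hb
    rw [Ring.inverse_unit]
    exact h.units_inv_right
  · rw [Ring.inverse_non_unit _ hb]
    exact Commute.zero_right a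

variable {S A : Type*} [CommRing S] [Algebra ℂ S] [Ring A] [Algebra S A]

variable (S) in
/-- The denominator `y τ - ξ`. -/
def den (τ : A) (ξ y : S) : A := y • τ - ξ • 1

/-- The boundary element `(y τ - ξ y ^ 2) (y τ - ξ)⁻¹`. -/
def bdry (τ : A) (ξ y : S) : A := (y • τ - (ξ * y ^ 2) • 1) * Ring.inverse (den S τ ξ y)

/-- The boundary element dressed by `p` Baxterized generators on each side. -/
def dressed (q : ℂ) (σ : ℕ → A) (τ : A) (ξ : S) : ℕ → S → A
  | 0, y => bdry τ ξ y
  | p + 1, y => bax q (σ p) y 1 * dressed q σ τ ξ p y * bax q (σ p) y 1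

variable {q : ℂ} {σ : ℕ → A} {τ : A}

theorem commute_den {a : A} (h : Commute a τ) (ξ y : S) : Commute a (den S τ ξ y) :=
  (h.smul_right _).sub_right ((Commute.one_right _).smul_right _)

theorem commute_bdry {a : A} (h : Commute a τ) (ξ y : S) : Commute a (bdry τ ξ y) :=
  ((h.smul_right _).sub_right ((Commute.one_right _).smul_right _)).mul_right
    (commute_ringInverse (commute_den h ξ y))

theorem bdry_eq {ξ y : S} (h : IsUnit (den S τ ξ y)) :
    bdry τ ξ y = 1 + (ξ * (1 - y ^ 2)) • Ring.inverse (den S τ ξ y) := by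
  have e : y • τ - (ξ * y ^ 2) • (1 : A) = den S τ ξ y + (ξ * (1 - y ^ 2)) • 1 := by
    rw [den]; module
  rw [bdry, e, add_mul, Ring.mul_inverse_cancel _ h, smul_mul_assoc, one_mul]

variable [Algebra ℂ A] [IsScalarTower ℂ S A]

/-- Each boundary element is one plus a scalar multiple of a resolvent of τ. Multiplying by the
denominator `D` on both sides removes one resolvent; the other is controlled by the fact that σ τ σ
commutes with τ. -/
theorem IsAffine.bdry_refl (h : IsAffine q σ τ) (ξ y z : S) :
    bax q (σ 0) y z * bdry τ ξ y * bax q (σ 0) (y * z) 1 * bdry τ ξ z =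
      bdry τ ξ z * bax q (σ 0) (y * z) 1 * bdry τ ξ y * bax q (σ 0) y z := by
  by_cases hy : IsUnit (den S τ ξ y)
  -- Without an inverse, `Ring.inverse` is zero, so the boundary element and both sides vanish.
  swap
  · simp [bdry, Ring.inverse_non_unit _ hy]
  by_cases hz : IsUnit (den S τ ξ z)
  swap
  · simp [bdry, Ring.inverse_non_unit _ hz]
  rw [bdry_eq hy, bdry_eq hz]
  have hst : Commute (σ 0 * τ * σ 0) τ := by
    have := h.refl
    show σ 0 * τ * σ 0 * τ = τ * (σ 0 * τ * σ 0)
    rw [← this]; simp only [mul_assoc]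
  have hG := (commute_ringInverse (commute_den hst ξ y)).eq
  have g1 := Ring.mul_inverse_cancel _ hy
  have g2 := Ring.inverse_mul_cancel _ hy
  have d1 := Ring.mul_inverse_cancel _ hz
  have d2 := Ring.inverse_mul_cancel _ hz
  have hsq := (h.hecke 1).quad' (S := S) (i := 0) one_pos
  have hs1 := (h.hecke 1).mul_hinv (i := 0) one_pos
  have hs2 := (h.hecke 1).hinv_mul (i := 0) one_pos
  have hi : hinv q (σ 0) = σ 0 - algebraMap ℂ S (lam q) • 1 := by rw [hinv, algebraMap_smul]
  rw [hi] at hs1 hs2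
  simp only [bax]
  set s := σ 0
  set G := Ring.inverse (den S τ ξ y)
  set G' := Ring.inverse (den S τ ξ z)
  set l := algebraMap ℂ S (lam q)
  -- σ τ σ commutes with τ, hence with the resolvent `G`. Multiplying that commutation relation by
  -- σ⁻¹ on both sides gives the identity.
  have core : τ * s * G * s - s * G * s * τ = l • (τ * s * G - G * s * τ) := by
    have : τ * s * G * (s - l • 1) = (s - l • 1) * G * s * τ := by
      calc τ * s * G * (s - l • 1) = (s - l • 1) * (s * τ * s * G) * (s - l • 1) := by
            simp only [← mul_assoc]; rw [hs2, one_mul]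
        _ = (s - l • 1) * G * s * τ * (s * (s - l • 1)) := by rw [hG]; simp only [mul_assoc]
        _ = _ := by rw [hs1, mul_one]
    simp only [mul_sub, sub_mul, mul_smul_comm, smul_mul_assoc, mul_one, one_mul] at this
    rw [smul_sub]
    linear_combination (norm := module) this
  have k1 : y • (τ * G) = 1 + ξ • G := by
    rw [den, sub_mul, smul_mul_assoc, smul_mul_assoc, one_mul] at g1
    exact sub_eq_iff_eq_add.mp g1
  have k2 : y • (G * τ) = 1 + ξ • G := by
    rw [den, mul_sub, mul_smul_comm, mul_smul_comm, mul_one] at g2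
    exact sub_eq_iff_eq_add.mp g2
  set D := den S τ ξ z with hD
  have h1 : y • (D * G) = z • 1 + ((z - y) * ξ) • G := by
    rw [hD, den, sub_mul, smul_mul_assoc, smul_mul_assoc, one_mul, smul_sub, smul_comm, k1]
    module
  have h2 : y • (G * D) = z • 1 + ((z - y) * ξ) • G := by
    rw [hD, den, mul_sub, mul_smul_comm, mul_smul_comm, mul_one, smul_sub, smul_comm, k2]
    module
  have core' : D * s * G * s - s * G * s * D =
      l • (D * s * G - G * s * D) - (l * ξ) • (G * s - s * G) := by
    rw [hD, den]
    simp only [mul_sub, sub_mul, mul_smul_comm, smul_mul_assoc, mul_one, one_mul]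
    linear_combination (norm := module) z • core
  have hDG : D * G = G * D := (commute_ringInverse
    (commute_den (commute_den (Commute.refl τ) ξ z).symm ξ y)).eq
  have e1 : y • (D * s * G * D) = z • (D * s) + ((z - y) * ξ) • (D * s * G) := by
    rw [mul_assoc, ← mul_smul_comm, h2, mul_add, mul_smul_comm, mul_one, mul_smul_comm]
  have e2 : y • (D * G * s * D) = z • (s * D) + ((z - y) * ξ) • (G * s * D) := by
    rw [mul_assoc, ← smul_mul_assoc, h1, add_mul, smul_mul_assoc, one_mul, smul_mul_assoc, mul_assoc]
  have e3 : y • (D * G * s) = z • s + ((z - y) * ξ) • (G * s) := by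
    rw [← smul_mul_assoc, h1, add_mul, smul_mul_assoc, one_mul, smul_mul_assoc]
  have e4 : y • (s * G * D) = z • s + ((z - y) * ξ) • (s * G) := by
    rw [mul_assoc, ← mul_smul_comm, h2, mul_add, mul_smul_comm, mul_one, mul_smul_comm]
  -- `D` cancels `G'` on whichever side it stands; what remains involves only the resolvent `G`.
  have expand : ∀ R T : A, ∀ a b : S,
      D * (R * (1 + a • G) * T * (1 + b • G') - (1 + b • G') * T * (1 + a • G) * R) * D =
        (D * (R * T) * D - D * (T * R) * D) + b • (D * (R * T) - T * R * D)
        + a • (D * (R * G * T) * D - D * (T * G * R) * D)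
        + (a * b) • (D * (R * G * T) - T * G * R * D) := by
    intro R T a b
    have x1 : D * (R * (1 + a • G) * T * (1 + b • G')) * D =
        D * R * (1 + a • G) * T * (D + b • 1) := by
      rw [mul_assoc, mul_assoc _ (1 + b • G') D, add_mul, one_mul, smul_mul_assoc, d2]
      simp only [mul_assoc]
    have x2 : D * ((1 + b • G') * T * (1 + a • G) * R) * D =
        (D + b • 1) * T * (1 + a • G) * R * D := by
      have x3 : D * (1 + b • G') = D + b • 1 := by rw [mul_add, mul_one, mul_smul_comm, d1]
      rw [← x3]
      simp only [mul_assoc]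
    rw [mul_sub, sub_mul, x1, x2]
    simp only [mul_add, add_mul, mul_smul_comm, smul_mul_assoc, mul_one, one_mul, ← mul_assoc]
    module
  have key := expand ((z - y) • s + (l * y) • 1) ((1 - y * z) • s + (l * (y * z)) • 1)
    (ξ * (1 - y ^ 2)) (ξ * (1 - z ^ 2))
  have comm : ((z - y) • s + (l * y) • 1) * ((1 - y * z) • s + (l * (y * z)) • 1) =
      (l * z * (1 - y ^ 2)) • s + ((z - y) * (1 - y * z) + l * y * (l * (y * z))) • (1 : A) := by
    simp only [mul_add, add_mul, mul_smul_comm, smul_mul_assoc, mul_one, one_mul, hsq]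
    module
  have comm' : ((1 - y * z) • s + (l * (y * z)) • 1) * ((z - y) • s + (l * y) • 1) =
      (l * z * (1 - y ^ 2)) • s + ((z - y) * (1 - y * z) + l * y * (l * (y * z))) • (1 : A) := by
    simp only [mul_add, add_mul, mul_smul_comm, smul_mul_assoc, mul_one, one_mul, hsq]
    module
  rw [comm, comm'] at key
  have zero : D * (((z - y) • s + (l * y) • 1) * (1 + (ξ * (1 - y ^ 2)) • G) *
      ((1 - y * z) • s + (l * (y * z)) • 1) * (1 + (ξ * (1 - z ^ 2)) • G') -
      (1 + (ξ * (1 - z ^ 2)) • G') * ((1 - y * z) • s + (l * (y * z)) • 1) *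
      (1 + (ξ * (1 - y ^ 2)) • G) * ((z - y) • s + (l * y) • 1)) * D = 0 := by
    rw [key]
    simp only [mul_add, add_mul, mul_smul_comm, smul_mul_assoc, mul_one, one_mul, ← mul_assoc]
    linear_combination (norm := module)
      (ξ * (1 - y ^ 2) * (l * (z ^ 2 - 1))) • e1 - (ξ * (1 - y ^ 2) * (l * (z ^ 2 - 1))) • e2
      + (ξ * (1 - y ^ 2) * (ξ * (1 - z ^ 2)) * ((z - y) * (1 - y * z))) • core'
      + (ξ * (1 - y ^ 2) * (ξ * (1 - z ^ 2)) * (l * (1 - y * z))) • e3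
      - (ξ * (1 - y ^ 2) * (ξ * (1 - z ^ 2)) * (l * (1 - y * z))) • e4
      + (ξ * (1 - y ^ 2) * (ξ * (1 - z ^ 2)) * (l * y * (l * (y * z)))) • hDG
  have e5 := congrArg (fun x => G' * x * G') zero
  simp only [mul_zero, zero_mul] at e5
  rw [← mul_assoc G', ← mul_assoc G', d2, one_mul, mul_assoc _ D, d1, mul_one] at e5
  exact sub_eq_zero.mp e5

theorem IsAffine.commute_dressed (h : IsAffine q σ τ) (ξ : S) {p i : ℕ} (hi : p < i) (y : S) :
    Commute (dressed q σ τ ξ p y) (σ i) := by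
  induction p with
  | zero => exact (commute_bdry (h.comm i hi).symm ξ y).symm
  | succ p ih =>
    have hc : Commute (bax q (σ p) y 1) (σ i) :=
      (commute_bax ((h.hecke (i + 1)).far p i (by omega) (by omega)).symm _ _).symm
    exact (hc.mul_left (ih (by omega))).mul_left hc

/-- Sklyanin's dressing: the Yang–Baxter equation brings the factors at position p + 1 outside the
four that form the reflection equation one level lower, and then takes them back in the opposite
order. -/
theorem IsAffine.dressed_refl (h : IsAffine q σ τ) (ξ : S) (p : ℕ) (y z : S) :
    bax q (σ p) y z * dressed q σ τ ξ p y * bax q (σ p) (y * z) 1 * dressed q σ τ ξ p z =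
      dressed q σ τ ξ p z * bax q (σ p) (y * z) 1 * dressed q σ τ ξ p y * bax q (σ p) y z := by
  induction p with
  | zero => exact h.bdry_refl ξ y z
  | succ p ih =>
    have hH := h.hecke (p + 2)
    have hK : ∀ a b c : S, Commute (dressed q σ τ ξ p a) (bax q (σ (p + 1)) b c) := fun a b c =>
      commute_bax (h.commute_dressed ξ (by omega) a) _ _
    have y1 : bax q (σ p) y 1 * bax q (σ (p + 1)) (y * z) 1 * bax q (σ p) z 1 =
        bax q (σ (p + 1)) z 1 * bax q (σ p) (y * z) 1 * bax q (σ (p + 1)) y 1 :=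
      hH.bax_braid (by omega) (by ring)
    have y2 : bax q (σ p) z 1 * bax q (σ (p + 1)) y 1 * bax q (σ p) y z =
        bax q (σ (p + 1)) y z * bax q (σ p) y 1 * bax q (σ (p + 1)) z 1 :=
      hH.bax_braid (by omega) (by ring)
    have y3 : bax q (σ p) y z * bax q (σ (p + 1)) y 1 * bax q (σ p) z 1 =
        bax q (σ (p + 1)) z 1 * bax q (σ p) y 1 * bax q (σ (p + 1)) y z :=
      hH.bax_braid (by omega) (by ring)
    have y4 : bax q (σ p) z 1 * bax q (σ (p + 1)) (y * z) 1 * bax q (σ p) y 1 =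
        bax q (σ (p + 1)) y 1 * bax q (σ p) (y * z) 1 * bax q (σ (p + 1)) z 1 :=
      hH.bax_braid (by omega) (by ring)
    simp only [dressed]
    have ky := (hK y z 1).eq
    have kz := (hK z y 1).eq
    set Ky := dressed q σ τ ξ p y
    set Kz := dressed q σ τ ξ p z
    set ty := bax q (σ (p + 1)) y 1
    set tz := bax q (σ (p + 1)) z 1
    set sy := bax q (σ p) y 1
    set sz := bax q (σ p) z 1
    set t := bax q (σ (p + 1)) y z
    set t' := bax q (σ (p + 1)) (y * z) 1
    set s := bax q (σ p) y z
    set s' := bax q (σ p) (y * z) 1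
    calc t * (sy * Ky * sy) * t' * (sz * Kz * sz)
        = t * sy * Ky * (sy * t' * sz) * Kz * sz := by simp only [mul_assoc]
      _ = t * sy * (Ky * tz) * s' * (ty * Kz) * sz := by rw [y1]; simp only [mul_assoc]
      _ = (t * sy * tz) * Ky * s' * Kz * ty * sz := by
        rw [ky, ← kz]; simp only [mul_assoc]
      _ = sz * ty * (s * Ky * s' * Kz) * ty * sz := by rw [← y2]; simp only [mul_assoc]
      _ = sz * (ty * Kz) * s' * Ky * (s * ty * sz) := by rw [ih]; simp only [mul_assoc]
      _ = sz * Kz * ty * s' * (Ky * tz) * sy * t := by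
        rw [y3, ← kz]; simp only [mul_assoc]
      _ = sz * Kz * (ty * s' * tz) * Ky * sy * t := by rw [ky]; simp only [mul_assoc]
      _ = _ := by rw [← y4]; simp only [mul_assoc]

/-- The reflection data of the Baxterized generators `σ (p + i)` and the dressed boundary
element. -/
def IsAffine.reflection (h : IsAffine q σ τ) (ξ : S) (p : ℕ) : Reflection A S where
  R i a b := bax q (σ (p + i)) a b
  T i a b := bax q (σ (p + i)) (a * b) 1
  K a := dressed q σ τ ξ p a
  comm_R_T i j a b c d hij :=
    bax_commute_bax ((h.hecke (p + i + j + 1)).far' (by omega) (by omega) (by omega)) _ _ _ _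
  comm_T_T i j a b c d hij :=
    bax_commute_bax ((h.hecke (p + i + j + 1)).far' (by omega) (by omega) (by omega)) _ _ _ _
  comm_K_R i a b c hi := commute_bax (h.commute_dressed ξ (by omega) a) _ _
  comm_K_T i a b c hi := commute_bax (h.commute_dressed ξ (by omega) a) _ _
  braid i a b c := (h.hecke (p + i + 2)).bax_braid (i := p + i) (by omega) (by ring)
  braid' i a b c := ((h.hecke (p + i + 2)).bax_braid (i := p + i) (by omega) (by ring)).symm
  refl a b := by
    rw [mul_comm b a]
    exact h.dressed_refl ξ p a b

/-- The reflection data, in the opposite algebra, of the dual boundary operator, which has a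
trivial boundary element. -/
def dualReflection {s : ℕ → A} (h : ∀ N, IsHecke q N s) (P P' : S) : Reflection Aᵐᵒᵖ S where
  R i a b := MulOpposite.op (bax q (s i) b a)
  T i a b := MulOpposite.op (bax q (s i) P (P' * (a * b)))
  K _ := 1
  comm_R_T i j a b c d hij :=
    (bax_commute_bax ((h (i + j + 1)).far' (by omega) (by omega) (by omega)) _ _ _ _).op
  comm_T_T i j a b c d hij :=
    (bax_commute_bax ((h (i + j + 1)).far' (by omega) (by omega) (by omega)) _ _ _ _).op
  comm_K_R _ _ _ _ _ := Commute.one_left _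
  comm_K_T _ _ _ _ _ := Commute.one_left _
  braid i a b c := by
    simp only [← MulOpposite.op_mul, ← mul_assoc]
    exact congrArg _ ((h (i + 2)).bax_braid (i := i) (by omega) (by ring))
  braid' i a b c := by
    simp only [← MulOpposite.op_mul, ← mul_assoc]
    exact congrArg _ ((h (i + 2)).bax_braid (i := i) (by omega) (by ring)).symm
  refl a b := by
    simp only [mul_one, one_mul, mul_comm b a]
    exact (bax_commute_bax (Commute.refl _) _ _ _ _).op.eq

end Boundary

/-! ### Change of scalars -/

section Maps

variable {S A S' A' : Type*} [CommRing S] [Algebra ℂ S] [Ring A] [Algebra S A] [Algebra ℂ A]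
  [CommRing S'] [Algebra ℂ S'] [Ring A'] [Algebra S' A'] [Algebra ℂ A']
  {φ : A →ₐ[ℂ] A'} {ψ : S →ₐ[ℂ] S'} {q : ℂ} {σ : ℕ → A} {τ : A}

theorem map_bax (hφ : ∀ s a, φ (s • a) = ψ s • φ a) (r : A) (a b : S) :
    φ (bax q r a b) = bax q (φ r) (ψ a) (ψ b) := by
  simp only [bax, map_add, hφ, map_sub, map_mul, map_one, AlgHom.commutes]

theorem map_den (hφ : ∀ s a, φ (s • a) = ψ s • φ a) (ξ y : S) :
    φ (den S τ ξ y) = den S' (φ τ) (ψ ξ) (ψ y) := by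
  simp only [den, map_sub, hφ, map_one]

theorem map_ringInverse {x : A} (h : IsUnit x) : φ (Ring.inverse x) = Ring.inverse (φ x) := by
  obtain ⟨u, rfl⟩ := h
  rw [Ring.inverse_unit, show φ (u : A) = (Units.map (φ : A →* A') u : A'ˣ) from rfl,
    Ring.inverse_unit]
  rfl

theorem map_dressed (hφ : ∀ s a, φ (s • a) = ψ s • φ a) {ξ y : S} (h : IsUnit (den S τ ξ y))
    (p : ℕ) : φ (dressed q σ τ ξ p y) =
      dressed q (fun i => φ (σ i)) (φ τ) (ψ ξ) p (ψ y) := by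
  induction p with
  | zero =>
    simp only [dressed, bdry, map_mul, map_ringInverse h, map_den hφ, map_sub, hφ, map_pow, map_one]
  | succ p ih => simp only [dressed, map_mul, ih, map_bax hφ, map_one]

theorem IsAffine.map (h : IsAffine q σ τ) (φ : A →ₐ[ℂ] A') :
    IsAffine q (fun i => φ (σ i)) (φ τ) where
  hecke N := (h.hecke N).map φ
  refl := by simp only [← map_mul, h.refl]
  comm i hi := (h.comm i hi).map φ

variable [IsScalarTower ℂ S A] [IsScalarTower ℂ S' A']

/-- An algebra map respects `Ring.inverse` only at units, whence the hypothesis on the denominators.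
The lemma is applied to the embedding of constants into power series and to evaluation at zero. -/
theorem IsAffine.map_prod (h : IsAffine q σ τ) {σ' : ℕ → A'} {τ' : A'} (h' : IsAffine q σ' τ')
    (hφ : ∀ s a, φ (s • a) = ψ s • φ a) (hσ : ∀ i, φ (σ i) = σ' i) (hτ : φ τ = τ') {ξ : S} {ξ' : S'}
    (hξ : ψ ξ = ξ') (p : ℕ) {m : ℕ} {u : ℕ → S} {u' : ℕ → S'} (hu' : ∀ i < m, ψ (u i) = u' i)
    (hu : ∀ i < m, IsUnit (den S τ ξ (u i))) :
    φ ((h.reflection ξ p).prod m u) = (h'.reflection ξ' p).prod m u' := by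
  obtain rfl : (fun i => φ (σ i)) = σ' := funext hσ
  subst hτ hξ
  induction m with
  | zero => exact map_one φ
  | succ m ih =>
    rw [Reflection.prod_succ, Reflection.prod_succ, map_mul, map_mul,
      ih (fun i hi => hu' i (by omega)) fun i hi => hu i (by omega), map_up,
      ← hu' m (by omega)]
    have e : φ ((h.reflection ξ p).K (u m)) = (h'.reflection (ψ ξ) p).K (ψ (u m)) :=
      map_dressed hφ (hu m (by omega)) p
    rw [e]
    congr 2
    refine up_congr fun j hj => ?_
    rw [← hu' j (by omega)]
    show φ (bax q _ (u m * u j) 1) = bax q _ (ψ (u m) * ψ (u j)) 1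
    rw [map_bax hφ, map_mul, map_one]

end Maps

/-! ### Power series over an algebra -/

section Series

open scoped PowerSeries

variable {S A : Type*} [CommRing S] [Ring A] [Algebra S A]

/-- Power series over an `S`-algebra form an algebra over the power series over `S`. -/
abbrev seriesAlgebra (S A : Type*) [CommRing S] [Ring A] [Algebra S A] : Algebra S⟦X⟧ A⟦X⟧ :=
  (PowerSeries.map (algebraMap S A)).toAlgebra' fun c x => by
    ext n
    rw [PowerSeries.coeff_mul, PowerSeries.coeff_mul, ← Finset.Nat.sum_antidiagonal_swap]
    refine Finset.sum_congr rfl fun i _ => ?_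
    rw [PowerSeries.coeff_map, PowerSeries.coeff_map]
    exact Algebra.commutes _ _

attribute [local instance] seriesAlgebra

theorem series_smul_def (c : S⟦X⟧) (x : A⟦X⟧) :
    c • x = PowerSeries.map (algebraMap S A) c * x := rfl

theorem coeff_series_smul (n : ℕ) (c : S⟦X⟧) (x : A⟦X⟧) :
    PowerSeries.coeff n (c • x) = ∑ i ∈ Finset.HasAntidiagonal.antidiagonal n, PowerSeries.coeff i.1 c • PowerSeries.coeff i.2 x := by
  rw [series_smul_def, PowerSeries.coeff_mul]
  refine Finset.sum_congr rfl fun i _ => ?_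
  rw [PowerSeries.coeff_map, Algebra.smul_def]

theorem constantCoeff_series_smul (c : S⟦X⟧) (x : A⟦X⟧) :
    PowerSeries.constantCoeff (c • x) = PowerSeries.constantCoeff c • PowerSeries.constantCoeff x := by
  rw [series_smul_def, map_mul, ← PowerSeries.coeff_zero_eq_constantCoeff_apply,
    PowerSeries.coeff_map, PowerSeries.coeff_zero_eq_constantCoeff_apply, Algebra.smul_def]

theorem C_series_smul (c : S) (x : A) :
    (PowerSeries.C (c • x) : A⟦X⟧) = (PowerSeries.C c : S⟦X⟧) • PowerSeries.C x := by
  rw [series_smul_def, PowerSeries.map_C, ← map_mul, Algebra.smul_def]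

/-- The lowest nonzero coefficients of scalar and vector multiply to a nonzero coefficient of the
product. -/
theorem TorsionFree.series (h : TorsionFree S A) : TorsionFree S⟦X⟧ A⟦X⟧ := by
  intro c x hc hcx
  by_contra hx
  classical
  have ec : ∃ n, PowerSeries.coeff n c ≠ 0 := by
    by_contra! h0
    exact hc (PowerSeries.ext fun n => by rw [h0, map_zero])
  have ex : ∃ n, PowerSeries.coeff n x ≠ 0 := by
    by_contra! h0
    exact hx (PowerSeries.ext fun n => by rw [h0, map_zero])
  have e := congrArg (PowerSeries.coeff (Nat.find ec + Nat.find ex)) hcx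
  rw [coeff_series_smul, map_zero, Finset.sum_eq_single (Nat.find ec, Nat.find ex)] at e
  · exact Nat.find_spec ex (h _ _ (Nat.find_spec ec) e)
  · rintro ⟨i, j⟩ hij hne
    rw [Finset.HasAntidiagonal.mem_antidiagonal] at hij
    rcases Nat.lt_trichotomy i (Nat.find ec) with hi | hi | hi
    · rw [not_not.mp (Nat.find_min ec hi), zero_smul]
    · refine absurd (Prod.ext hi ?_) hne
      simp only at hij ⊢
      omega
    · have hj : j < Nat.find ex := by simp only at hij; omega
      rw [not_not.mp (Nat.find_min ex hj), smul_zero]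
  · intro h0
    exact absurd (by rw [Finset.HasAntidiagonal.mem_antidiagonal]) h0

variable [Algebra ℂ S] [Algebra ℂ A] [IsScalarTower ℂ S A]

instance series_isScalarTower : IsScalarTower ℂ S⟦X⟧ A⟦X⟧ :=
  IsScalarTower.of_algebraMap_eq fun c => by
    rw [PowerSeries.algebraMap_apply, PowerSeries.algebraMap_apply, RingHom.algebraMap_toAlgebra', PowerSeries.map_C,
      ← IsScalarTower.algebraMap_apply]

variable (A) in
/-- Evaluation at zero. -/
def evalZero : A⟦X⟧ →ₐ[ℂ] A :=
  { (PowerSeries.constantCoeff : A⟦X⟧ →+* A) with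
    commutes' := fun c => by
      rw [PowerSeries.algebraMap_apply]
      exact PowerSeries.constantCoeff_C _ }

variable (A) in
/-- Constant power series. -/
def constSeries : A →ₐ[ℂ] A⟦X⟧ :=
  { (PowerSeries.C : A →+* A⟦X⟧) with commutes' := fun _ => PowerSeries.algebraMap_apply.symm }

theorem evalZero_apply (x : A⟦X⟧) : evalZero A x = PowerSeries.constantCoeff x := rfl

theorem constSeries_apply (x : A) : constSeries A x = PowerSeries.C x := rfl

theorem evalZero_constSeries (x : A) : evalZero A (constSeries A x) = x :=
  PowerSeries.constantCoeff_C x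

theorem evalZero_X : evalZero A PowerSeries.X = 0 := PowerSeries.constantCoeff_X

theorem evalZero_smul (c : S⟦X⟧) (x : A⟦X⟧) :
    evalZero A (c • x) = evalZero S c • evalZero A x := constantCoeff_series_smul c x

theorem constSeries_smul (c : S) (x : A) :
    constSeries A (c • x) = constSeries S c • constSeries A x := C_series_smul c x

theorem isUnit_of_evalZero {x : A⟦X⟧} (h : IsUnit (evalZero A x)) : IsUnit x :=
  PowerSeries.isUnit_iff_constantCoeff.mpr h

end Series

/-! ### Idempotents move through the products of Baxterized generators -/

section Absorption

variable {A : Type*} [Ring A] [Algebra ℂ A]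

/-- The idempotent on the strands `k, …, k + m - 1`. -/
def idemAt (q : ℂ) (s : ℕ → A) (k : ℕ) (ν : ℕ → ℕ × ℕ) (m : ℕ) : A := idem q (fun i => s (k + i)) ν m

/-- The idempotent on the strands `k, …, k + m - 1` in the reverse order. -/
def flipAt (q : ℂ) (s : ℕ → A) (k : ℕ) (ν : ℕ → ℕ × ℕ) (m : ℕ) : A :=
  idem q (fun i => s (k + (m - 2 - i))) ν m

variable {q : ℂ} {s : ℕ → A} {ν : ℕ → ℕ × ℕ} {m : ℕ}

theorem isHecke_at (hs : ∀ N, IsHecke q N s) (k N : ℕ) : IsHecke q N fun i => s (k + i) :=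
  (hs (N + k)).shift le_rfl

theorem isHecke_flip (hs : ∀ N, IsHecke q N s) (k m : ℕ) :
    IsHecke q (m - 1) fun i => s (k + (m - 2 - i)) := by
  have := (hs (m - 1 + k)).flip (M := m - 1) (k := k) le_rfl
  have e : (fun i => s (k + (m - 1 - 1 - i))) = fun i => s (k + (m - 2 - i)) := by
    funext i; rw [Nat.sub_sub m]
  rwa [e] at this

theorem idemAt_sq (hs : ∀ N, IsHecke q N s) (hq : Generic q) (k : ℕ) (hν : IsStandard ν m) :
    idemAt q s k ν m * idemAt q s k ν m = idemAt q s k ν m :=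
  (isHecke_at hs k m).idem_sq hq (by omega) hν

theorem flipAt_sq (hs : ∀ N, IsHecke q N s) (hq : Generic q) (k : ℕ) (hν : IsStandard ν m) :
    flipAt q s k ν m * flipAt q s k ν m = flipAt q s k ν m :=
  (isHecke_flip hs k m).idem_sq hq (by omega) hν

theorem commute_idemAt {a : A} {k : ℕ} (h : ∀ i, k ≤ i → i + 1 < k + m → Commute a (s i)) :
    Commute a (idemAt q s k ν m) :=
  commute_idem_of_gens fun i hi => h _ (by omega) (by omega)

theorem commute_flipAt {a : A} {k : ℕ} (h : ∀ i, k ≤ i → i + 1 < k + m → Commute a (s i)) :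
    Commute a (flipAt q s k ν m) :=
  commute_idem_of_gens fun i hi => h _ (by omega) (by omega)

variable {S : Type*} [CommRing S] [Algebra ℂ S] [Algebra S A] [IsScalarTower ℂ S A]

theorem idemAt_mul_down (hs : ∀ N, IsHecke q N s) (hq : Generic q) (k : ℕ)
    (hν : IsStandard ν m) (a b : S) :
    idemAt q s k ν m * down m (fun j => bax q (s (k + j)) a (b * content S q ν j)) =
      idemAt q s k ν m * down m (fun j => bax q (s (k + j)) a (b * content S q ν j)) *
        idemAt q s (k + 1) ν m := by
  have := (isHecke_at hs k m).idem_mul_down hq le_rfl hν a b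
  rw [← idemAt] at this
  rw [this]
  simp only [idemAt, add_right_comm k 1, add_assoc]
  simp only [mul_assoc]
  have h2 := (isHecke_at hs (k + 1) m).idem_sq hq (by omega) hν
  simp only [add_assoc, add_comm 1] at h2
  rw [h2]

theorem flipAt_mul_down (hs : ∀ N, IsHecke q N s) (hq : Generic q) (k : ℕ)
    (hν : IsStandard ν m) (a b : S) :
    flipAt q s (k + 1) ν m * down m (fun j => bax q (s (k + (m - 1 - j))) a (b * content S q ν j)) =
      flipAt q s (k + 1) ν m * down m (fun j => bax q (s (k + (m - 1 - j))) a
        (b * content S q ν j)) * flipAt q s k ν m := by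
  have := (isHecke_flip hs k (m + 1)).idem_mul_down hq (by omega) hν a b
  have e1 : idem q (fun i => s (k + (m + 1 - 2 - i))) ν m = flipAt q s (k + 1) ν m :=
    idem_congr fun i hi => by congr 1; omega
  have e2 : idem q (fun i => s (k + (m + 1 - 2 - (i + 1)))) ν m = flipAt q s k ν m :=
    idem_congr fun i hi => by congr 1; omega
  rw [e1, e2] at this
  have e3 : ∀ j, m + 1 - 2 - j = m - 1 - j := fun j => by omega
  simpa only [e3] using this

/-! #### Blocks -/

variable {n : ℕ}

/-- The operator that exchanges two blocks. -/
def swapBlock (q : ℂ) (s : ℕ → A) (m n : ℕ) (u v : ℕ → S) : A :=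
  down n fun k => up m fun j => bax q (s (k + j)) (u j) (v k)

/-- The crossing of two blocks. -/
def crossBlock (q : ℂ) (s : ℕ → A) (m n : ℕ) (u v : ℕ → S) : A :=
  up n fun k => up m fun j => bax q (s (k + (m - 1 - j))) (v k * u j) 1

/-- The dual crossing of two blocks. -/
def dualBlock (q : ℂ) (s : ℕ → A) (P P' : S) (m n : ℕ) (u v : ℕ → S) : A :=
  down n fun k => down m fun j => bax q (s (k + (m - 1 - j))) P (P' * (v k * u j))

theorem commute_bax_bax (hs : ∀ N, IsHecke q N s) {i j : ℕ} (hij : i + 1 < j ∨ j + 1 < i)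
    (a b c d : S) : Commute (bax q (s i) a b) (bax q (s j) c d) :=
  bax_commute_bax ((hs (i + j + 1)).far' (by omega) (by omega) hij) _ _ _ _

/-- Factors at distant positions commute, so the array can be read in the other direction. Each line
is then a row with parameters proportional to the contents, and it moves the idempotent by one
strand. -/
theorem idemAt_mul_swapBlock_columns (hs : ∀ N, IsHecke q N s) (hq : Generic q)
    (hν : IsStandard ν n) (u : ℕ → S) (y : S) :
    idemAt q s 0 ν n * swapBlock q s m n u (fun k => y * content S q ν k) =
      idemAt q s 0 ν n * swapBlock q s m n u (fun k => y * content S q ν k) *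
        idemAt q s m ν n := by
  have e : swapBlock q s m n u (fun k => y * content S q ν k) =
      up m fun j => down n fun k => bax q (s (j + k)) (u j) (y * content S q ν k) := by
    rw [swapBlock, down_up_comm]
    · simp only [add_comm]
    · exact fun k i k' i' _ _ _ _ => commute_bax_bax hs (by omega) _ _ _ _
  rw [e]
  exact up_absorb (e := fun k => idemAt q s k ν n) (fun k => idemAt_sq hs hq k hν)
    fun j _ => idemAt_mul_down hs hq j hν (u j) y

theorem idemAt_mul_dualBlock (hs : ∀ N, IsHecke q N s) (hq : Generic q)
    (hν : IsStandard ν n) (P P' : S) (u : ℕ → S) (y : S) :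
    idemAt q s 0 ν n * dualBlock q s P P' m n u (fun k => y * content S q ν k) =
      idemAt q s 0 ν n * dualBlock q s P P' m n u (fun k => y * content S q ν k) *
        idemAt q s m ν n := by
  have e : dualBlock q s P P' m n u (fun k => y * content S q ν k) =
      down m fun j => down n fun k =>
        bax q (s (m - 1 - j + k)) P (P' * (y * u j) * content S q ν k) := by
    rw [dualBlock, down_down_comm]
    · refine down_congr fun j _ => down_congr fun k _ => ?_
      rw [add_comm, mul_right_comm y, mul_assoc P']
    · exact fun k i k' i' _ _ _ _ => commute_bax_bax hs (by omega) _ _ _ _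
  have := down_absorb (n := m) (e := fun j => idemAt q s (m - j) ν n)
    (f := fun j => down n fun k =>
      bax q (s (m - 1 - j + k)) P (P' * (y * u j) * content S q ν k))
    (fun k => idemAt_sq hs hq _ hν) fun j hj => by
      have := idemAt_mul_down hs hq (m - 1 - j) hν P (P' * (y * u j))
      rw [show m - 1 - j + 1 = m - j by omega] at this
      rwa [show m - (j + 1) = m - 1 - j by omega]
  rw [e]
  simpa only [Nat.sub_self, Nat.sub_zero] using this

theorem flipAt_mul_dualBlock (hs : ∀ N, IsHecke q N s) (hq : Generic q)
    (hν : IsStandard ν m) (P P' : S) (v : ℕ → S) (x : S) :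
    flipAt q s n ν m * dualBlock q s P P' m n (fun j => x * content S q ν j) v =
      flipAt q s n ν m * dualBlock q s P P' m n (fun j => x * content S q ν j) v *
        flipAt q s 0 ν m := by
  refine down_absorb (e := fun k => flipAt q s k ν m) (fun k => flipAt_sq hs hq k hν) fun k _ => ?_
  have := flipAt_mul_down hs hq k hν P (P' * (v k * x))
  simpa only [← mul_assoc] using this

variable [IsDomain S]

theorem idemAt_mul_up (hs : ∀ N, IsHecke q N s) (hq : Generic q) (k : ℕ)
    (hν : IsStandard ν m) (htf : TorsionFree S A) {a b : S} (hab : Indep a b) :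
    idemAt q s (k + 1) ν m * up m (fun j => bax q (s (k + j)) (b * content S q ν j) a) =
      idemAt q s (k + 1) ν m * up m (fun j => bax q (s (k + j)) (b * content S q ν j) a) *
        idemAt q s k ν m := by
  have := (isHecke_at hs k m).idem_mul_up hq le_rfl hν htf hab
  have e1 : idem q (fun i => s (k + (i + 1))) ν m = idemAt q s (k + 1) ν m :=
    idem_congr fun i hi => by congr 1; omega
  rw [e1] at this
  exact this

theorem flipAt_mul_up (hs : ∀ N, IsHecke q N s) (hq : Generic q) (k : ℕ)
    (hν : IsStandard ν m) (htf : TorsionFree S A) {a b : S} (hab : Indep a b) :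
    flipAt q s k ν m * up m (fun j => bax q (s (k + (m - 1 - j))) (b * content S q ν j) a) =
      flipAt q s k ν m * up m (fun j => bax q (s (k + (m - 1 - j))) (b * content S q ν j) a) *
        flipAt q s (k + 1) ν m := by
  have := (isHecke_flip hs k (m + 1)).idem_mul_up hq (by omega) hν htf hab
  have e1 : idem q (fun i => s (k + (m + 1 - 2 - i))) ν m = flipAt q s (k + 1) ν m :=
    idem_congr fun i hi => by congr 1; omega
  have e2 : idem q (fun i => s (k + (m + 1 - 2 - (i + 1)))) ν m = flipAt q s k ν m :=
    idem_congr fun i hi => by congr 1; omega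
  rw [e1, e2] at this
  have e3 : ∀ j, m + 1 - 2 - j = m - 1 - j := fun j => by omega
  simpa only [e3] using this

theorem idemAt_mul_swapBlock_rows (hs : ∀ N, IsHecke q N s) (hq : Generic q)
    (hν : IsStandard ν m) (htf : TorsionFree S A) {x : S} {v : ℕ → S}
    (hv : ∀ k, Indep (v k) x) :
    idemAt q s n ν m * swapBlock q s m n (fun j => x * content S q ν j) v =
      idemAt q s n ν m * swapBlock q s m n (fun j => x * content S q ν j) v * idemAt q s 0 ν m :=
  down_absorb (e := fun k => idemAt q s k ν m) (fun k => idemAt_sq hs hq k hν)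
    fun k _ => idemAt_mul_up hs hq k hν htf (hv k)

theorem idemAt_mul_crossBlock (hs : ∀ N, IsHecke q N s) (hq : Generic q)
    (hν : IsStandard ν n) (htf : TorsionFree S A) {u : ℕ → S} {y : S}
    (hu : ∀ j, Indep 1 (y * u j)) :
    idemAt q s m ν n * crossBlock q s m n u (fun k => y * content S q ν k) =
      idemAt q s m ν n * crossBlock q s m n u (fun k => y * content S q ν k) *
        idemAt q s 0 ν n := by
  have e : crossBlock q s m n u (fun k => y * content S q ν k) =
      up m fun j => up n fun k => bax q (s (m - 1 - j + k)) (y * u j * content S q ν k) 1 := by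
    rw [crossBlock, up_up_comm]
    · refine up_congr fun j _ => up_congr fun k _ => ?_
      rw [add_comm, mul_right_comm]
    · exact fun k i k' i' _ _ _ _ => commute_bax_bax hs (by omega) _ _ _ _
  have := up_absorb (n := m) (e := fun j => idemAt q s (m - j) ν n)
    (f := fun j => up n fun k => bax q (s (m - 1 - j + k)) (y * u j * content S q ν k) (1 : S))
    (fun k => idemAt_sq hs hq _ hν) fun j hj => by
      have := idemAt_mul_up hs hq (m - 1 - j) hν htf (hu j)
      rw [show m - 1 - j + 1 = m - j by omega] at this
      rwa [show m - (j + 1) = m - 1 - j by omega]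
  rw [e]
  simpa only [Nat.sub_self, Nat.sub_zero] using this

theorem flipAt_mul_crossBlock (hs : ∀ N, IsHecke q N s) (hq : Generic q)
    (hν : IsStandard ν m) (htf : TorsionFree S A) {v : ℕ → S} {x : S}
    (hv : ∀ k, Indep 1 (x * v k)) :
    flipAt q s 0 ν m * crossBlock q s m n (fun j => x * content S q ν j) v =
      flipAt q s 0 ν m * crossBlock q s m n (fun j => x * content S q ν j) v *
        flipAt q s n ν m := by
  refine up_absorb (e := fun k => flipAt q s k ν m) (fun k => flipAt_sq hs hq k hν) fun k _ => ?_
  have := flipAt_mul_up hs hq k hν htf (hv k)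
  simpa only [← mul_assoc, mul_comm (v k) x] using this

end Absorption

/-! ### Fusion of the boundary operator -/

section Fusion

variable {S A : Type*} [CommRing S] [Algebra ℂ S] [Ring A] [Algebra S A] [Algebra ℂ A]
  [IsScalarTower ℂ S A] {q : ℂ} {σ : ℕ → A} {τ : A} {ν : ℕ → ℕ × ℕ} {m : ℕ}

theorem idemAt_zero (s : ℕ → A) : idemAt q s 0 ν m = idem q s ν m := by
  simp only [idemAt, Nat.zero_add]

theorem idem_flip_succ (s : ℕ → A) :
    idem q (fun i => s (0 + (m + 1 - 2 - i))) ν m = flipAt q s 1 ν m :=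
  idem_congr fun i hi => by congr 1; omega

theorem Indep.mul_content {a b : S} (h : Indep a b) (k : ℕ) : Indep a (b * content S q ν k) :=
  fun c hc => h (qContent q (ν k) * c) (by rw [map_mul, ← mul_assoc]; exact hc)

variable [IsDomain S]

/-- The fused operator of the first m parameters produces the reversed idempotent, the last row
moves it by one strand, and away from the first strand it commutes with the boundary element. -/
theorem idem_mul_prod_last (h : IsAffine q σ τ) (hq : Generic q) (htf : TorsionFree S A) (ξ : S)
    (p : ℕ) (hν : IsStandard ν m) {x : S} {w : ℕ → S} (hw : ∀ i < m, w i = x * content S q ν i)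
    (hQ : idem q (fun i => σ (p + i)) ν m * (h.reflection ξ p).prod m w =
      idem q (fun i => σ (p + i)) ν m * (h.reflection ξ p).prod m w *
        flipAt q (fun i => σ (p + i)) 0 ν m) (hi : Indep 1 (x * w m)) :
    idem q (fun i => σ (p + i)) ν m * (h.reflection ξ p).prod (m + 1) w =
      idem q (fun i => σ (p + i)) ν m * (h.reflection ξ p).prod (m + 1) w *
        flipAt q (fun i => σ (p + i)) 1 ν m := by
  have hs := isHecke_at h.hecke p
  have hup := flipAt_mul_up hs hq 0 hν htf hi
  have e : (up m fun j => (h.reflection ξ p).T (m - 1 - j) (w m) (w j)) =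
      up m fun j => bax q (σ (p + (0 + (m - 1 - j)))) (x * w m * content S q ν j) 1 := by
    refine up_congr fun j hj => ?_
    show bax q (σ (p + (m - 1 - j))) (w m * w j) 1 = _
    rw [hw j hj, Nat.zero_add, ← mul_assoc, mul_comm (w m)]
  have hc : Commute ((h.reflection ξ p).K (w m)) (flipAt q (fun i => σ (p + i)) 1 ν m) :=
    commute_flipAt fun i hi _ => h.commute_dressed ξ (by omega) _
  rw [Nat.zero_add] at hup
  rw [Reflection.prod_succ, e, ← mul_assoc, ← mul_assoc, hQ, mul_assoc _ (flipAt _ _ _ _ _) (up _ _), hup]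
  simp only [mul_assoc]
  rw [hc.eq, ← mul_assoc (flipAt _ _ 1 _ _) (flipAt _ _ 1 _ _), flipAt_sq hs hq 1 hν]

/-- The single parameter `v` is exchanged with the whole block. The exchange operators on the two
sides are rows, which the row formula evaluates on the idempotent and on its reversal. Both have the
same scalar in front, which is cancelled. -/
theorem front_to_back (h : IsAffine q σ τ) (hq : Generic q) (htf : TorsionFree S A) (ξ : S)
    (p : ℕ) (hν : IsStandard ν (m + 1)) {x v : S} {w : ℕ → S}
    (hw : ∀ i < m + 1, w i = x * content S q ν i) (hwm : w (m + 1) = v)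
    (hQ : idem q (fun i => σ (p + i)) ν (m + 1) * (h.reflection ξ p).prod (m + 1) w =
      idem q (fun i => σ (p + i)) ν (m + 1) * (h.reflection ξ p).prod (m + 1) w *
        flipAt q (fun i => σ (p + i)) 0 ν (m + 1)) (hi : Indep 1 (x * v))
    (hv : ∀ k < m, x * content S q ν (k + 1) ≠ v) :
    idem q (fun i => σ (p + i)) ν (m + 1) * (x • jm (fun i => σ (p + i)) (m + 1) - v • 1) *
        cycle q (fun i => σ (p + i)) (m + 1) *
        (h.reflection ξ p).prod (m + 1 + 1) (Reflection.cat 1 (fun _ => v) w) =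
      idem q (fun i => σ (p + i)) ν (m + 1) * (h.reflection ξ p).prod (m + 1 + 1) w *
        ((x • jm (fun i => σ (p + (0 + (m + 1 + 1 - 2 - i)))) (m + 1) - v • 1) *
          cycle q (fun i => σ (p + (0 + (m + 1 + 1 - 2 - i)))) (m + 1)) := by
  have hs := isHecke_at h.hecke p
  have hr := isHecke_flip hs 0 (m + 1 + 1)
  have hrow := (hs (m + 1)).idem_mul_row hq le_rfl hν v x
  have hrow' := hr.idem_mul_row hq (by omega) hν v x
  have hB := idem_mul_prod_last h hq htf ξ p hν hw hQ (by rwa [hwm])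
  rw [idem_flip_succ fun i => σ (p + i)] at hrow'
  have ex := (h.reflection ξ p).exchange_mul_prod (fun _ => v) w 1 (m + 1)
  rw [add_comm 1 (m + 1)] at ex
  have e1 : (h.reflection ξ p).exchange id 1 (m + 1) (fun _ => v) w =
      down (m + 1) fun j => bax q (σ (p + j)) v (x * content S q ν j) :=
    down_congr fun k hk => by rw [up_one, hw k hk]; rfl
  have e2 : (h.reflection ξ p).exchange (fun i => m + 1 + 1 - 2 - i) 1 (m + 1) (fun _ => v) w =
      down (m + 1) fun j => bax q (σ (p + (0 + (m + 1 + 1 - 2 - j)))) v (x * content S q ν j) :=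
    down_congr fun k hk => by rw [up_one, hw k hk, Nat.zero_add]; rfl
  have e3 : (h.reflection ξ p).prod (m + 1 + 1) (Reflection.cat (m + 1) w fun _ => v) =
      (h.reflection ξ p).prod (m + 1 + 1) w :=
    Reflection.prod_congr _ fun i hi => by
      unfold Reflection.cat
      split_ifs with h1
      · rfl
      · show v = w i
        rw [← hwm, show i = m + 1 by omega]
  rw [e1, e2, e3] at ex
  have key := congrArg (idem q (fun i => σ (p + i)) ν (m + 1) * ·) ex
  simp only [← mul_assoc] at key
  rw [hrow, hB, mul_assoc _ (flipAt _ _ _ _ _) (down _ _), hrow', mul_smul_comm, smul_mul_assoc] at key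
  have hP : (∏ k ∈ Finset.range m, (x * content S q ν (k + 1) - v)) ≠ 0 := by
    rw [Finset.prod_ne_zero_iff]
    exact fun k hk => sub_ne_zero.mpr (hv k (Finset.mem_range.mp hk))
  rw [← sub_eq_zero, ← smul_sub] at key
  have key := sub_eq_zero.mp (htf _ _ hP key)
  rw [key, ← mul_assoc, ← mul_assoc, ← hB, mul_assoc]

attribute [local instance] seriesAlgebra

-- The scalar cancelled in `front_to_back` vanishes at the parameter of the new node when an earlier
-- node has the same content. So that parameter is shifted by a formal variable t, the scalar is
-- cancelled, and t is set to zero. The left side then contains J minus the content of the new node,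
-- which the larger idempotent annihilates; the right side gives the eigenvalue equation for the
-- reversed strands.
open scoped PowerSeries in
theorem idem_mul_prod_weight (h : IsAffine q σ τ) (hq : Generic q) (htf : TorsionFree S A) (ξ : S)
    (p : ℕ) (hν : IsStandard ν (m + 1 + 1)) {x : S} (hx : x ≠ 0)
    (hu : ∀ i < m + 1 + 1, IsUnit (den S τ ξ (x * content S q ν i)))
    (hQ : idem q (fun i => σ (p + i)) ν (m + 1) *
        (h.reflection ξ p).prod (m + 1) (fun i => x * content S q ν i) =
      idem q (fun i => σ (p + i)) ν (m + 1) *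
        (h.reflection ξ p).prod (m + 1) (fun i => x * content S q ν i) *
        flipAt q (fun i => σ (p + i)) 0 ν (m + 1)) :
    idem q (fun i => σ (p + i)) ν (m + 1 + 1) *
        (h.reflection ξ p).prod (m + 1 + 1) (fun i => x * content S q ν i) *
        jm (fun i => σ (p + (0 + (m + 1 + 1 - 2 - i)))) (m + 1) =
      qContent q (ν (m + 1)) • (idem q (fun i => σ (p + i)) ν (m + 1 + 1) *
        (h.reflection ξ p).prod (m + 1 + 1) (fun i => x * content S q ν i)) := by
  have hs := isHecke_at h.hecke p
  have hν' := hν.mono (Nat.le_succ (m + 1))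
  have hr := isHecke_flip hs 0 (m + 1 + 1)
  set v : S⟦X⟧ := constSeries S (x * content S q ν (m + 1)) + PowerSeries.X with hvdef
  set w : ℕ → S⟦X⟧ := fun i => if i < m + 1 then constSeries S (x * content S q ν i) else v with hw
  have hcont : ∀ k, constSeries S (content S q ν k) = content S⟦X⟧ q ν k := fun k =>
    (constSeries S).commutes _
  have hwi : ∀ i < m + 1, w i = constSeries S x * content S⟦X⟧ q ν i := fun i hi => by
    rw [hw]
    simp only [if_pos hi]
    rw [map_mul, hcont]
  have hwm : w (m + 1) = v := by rw [hw]; simp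
  have h' := h.map (constSeries A)
  have hB : ∀ u : ℕ → S⟦X⟧, (∀ i < m + 1, u i = constSeries S (x * content S q ν i)) →
      constSeries A ((h.reflection ξ p).prod (m + 1) fun i => x * content S q ν i) =
        (h'.reflection (constSeries S ξ) p).prod (m + 1) u := fun u hu' =>
    h.map_prod h' (ψ := constSeries S) constSeries_smul (fun _ => rfl) rfl rfl p
      (fun i hi => (hu' i hi).symm) fun i hi => hu i (by omega)
  have hQ' := congrArg (constSeries A) hQ
  simp only [map_mul] at hQ'
  rw [hB w fun i hi => by rw [hwi i hi, map_mul, hcont], flipAt, map_idem, map_idem] at hQ'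
  have hindep : Indep 1 (constSeries S x * v) := by
    intro c hc
    have h1 := congrArg (PowerSeries.coeff 1) hc
    rw [PowerSeries.algebraMap_apply, PowerSeries.coeff_mul_C, constSeries_apply,
      PowerSeries.coeff_C_mul, hvdef, map_add, constSeries_apply, PowerSeries.coeff_C,
      PowerSeries.coeff_one_X, PowerSeries.coeff_one, if_neg one_ne_zero, if_neg one_ne_zero,
      zero_add, mul_one, eq_comm, mul_eq_zero] at h1
    rw [PowerSeries.algebraMap_apply, h1.resolve_left hx, map_zero, mul_zero] at hc
    exact one_ne_zero hc
  have hne : ∀ k < m, constSeries S x * content S⟦X⟧ q ν (k + 1) ≠ v := by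
    intro k _ hk
    have h1 := congrArg (PowerSeries.coeff 1) hk
    rw [← hcont, ← map_mul, hvdef, map_add, constSeries_apply, constSeries_apply,
      PowerSeries.coeff_C, PowerSeries.coeff_C, PowerSeries.coeff_one_X, if_neg one_ne_zero,
      if_neg one_ne_zero, zero_add] at h1
    exact zero_ne_one h1
  have key := front_to_back h' hq htf.series (constSeries S ξ) p hν' hwi hwm hQ' hindep hne
  have hev : ∀ y : S⟦X⟧, evalZero A (den S⟦X⟧ (constSeries A τ) (constSeries S ξ) y) =
      den S τ ξ (evalZero S y) := fun y => by
    rw [map_den (ψ := evalZero S) evalZero_smul, evalZero_constSeries, evalZero_constSeries]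
  have hevv : evalZero S v = x * content S q ν (m + 1) := by
    rw [hvdef, map_add, evalZero_constSeries, evalZero_X, add_zero]
  have hunit : ∀ y : S⟦X⟧, (∃ k < m + 1 + 1, evalZero S y = x * content S q ν k) →
      IsUnit (den S⟦X⟧ (constSeries A τ) (constSeries S ξ) y) := fun y ⟨k, hk, e⟩ =>
    isUnit_of_evalZero (by rw [hev, e]; exact hu k hk)
  have hE : ∀ u : ℕ → S⟦X⟧, (∀ i < m + 1 + 1, ∃ k < m + 1 + 1,
      evalZero S (u i) = x * content S q ν k) →
      evalZero A ((h'.reflection (constSeries S ξ) p).prod (m + 1 + 1) u) =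
        (h.reflection ξ p).prod (m + 1 + 1) fun i => evalZero S (u i) := fun u hu' =>
    h'.map_prod h (ψ := evalZero S) evalZero_smul (fun _ => evalZero_constSeries _)
      (evalZero_constSeries _) (evalZero_constSeries _) p (fun _ _ => rfl)
      fun i hi => hunit _ (hu' i hi)
  have hwev : ∀ i < m + 1 + 1, evalZero S (w i) = x * content S q ν i := by
    intro i hi
    rcases Nat.lt_or_ge i (m + 1) with h1 | h1
    · rw [hwi i h1, map_mul, ← hcont, evalZero_constSeries, evalZero_constSeries]
    · obtain rfl : i = m + 1 := by omega
      rw [hwm, hevv]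
  have key0 := congrArg (evalZero A) key
  simp only [map_mul] at key0
  rw [hE w fun i hi => ⟨i, hi, hwev i hi⟩, (h.reflection ξ p).prod_congr hwev] at key0
  simp only [map_idem, map_sub, evalZero_smul, evalZero_constSeries, hevv, map_one] at key0
  have hjm : ∀ r : ℕ → A, evalZero A (jm (fun i => constSeries A (r i)) (m + 1)) = jm r (m + 1) :=
    fun r => (map_jm (evalZero A : A⟦X⟧ →+* A) _ _).trans (by congr 1)
  have hcy : ∀ r : ℕ → A, evalZero A (cycle q (fun i => constSeries A (r i)) (m + 1)) =
      cycle q r (m + 1) := fun r => by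
    rw [cycle, map_down, cycle]
    congr 1
  rw [hjm fun i => σ (p + i), hjm fun i => σ (p + (0 + (m + 1 + 1 - 2 - i))),
    hcy fun i => σ (p + (0 + (m + 1 + 1 - 2 - i)))] at key0
  set B := (h.reflection ξ p).prod (m + 1 + 1) (fun i => x * content S q ν i)
  set E := idem q (fun i => σ (p + i)) ν (m + 1 + 1) with hEdef
  set e := idem q (fun i => σ (p + i)) ν (m + 1) with hedef
  have hEe : E * e = E := (hs (m + 1 + 1)).idem_mul_idem_of_le hq (by omega) hν (by omega)
  have hEJ : E * (x • jm (fun i => σ (p + i)) (m + 1) - (x * content S q ν (m + 1)) • 1) = 0 := by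
    rw [mul_sub, mul_smul_comm, (hs (m + 1 + 1)).idem_mul_jm hq (by omega) hν (by omega),
      ← algebraMap_smul S (qContent q _), mul_smul_comm, mul_one, smul_smul, sub_self]
  have key1 := congrArg (E * ·) key0
  simp only [← mul_assoc] at key1
  rw [hEe, hEJ, zero_mul, zero_mul] at key1
  have key2 := congrArg (· * up (m + 1) fun i => σ (p + (0 + (m + 1 + 1 - 2 - i)))) key1
  simp only [zero_mul] at key2
  rw [mul_assoc _ (cycle _ _ _), hr.cycle_mul_up (by omega), mul_one, mul_sub, mul_smul_comm,
    mul_smul_comm, mul_one, mul_smul, ← smul_sub, eq_comm] at key2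
  have key3 := sub_eq_zero.mp (htf _ _ hx key2)
  rw [key3, algebraMap_smul]

/-- The idempotent of a tableau can be moved through the fused boundary operator. -/
theorem idem_mul_prod (h : IsAffine q σ τ) (hq : Generic q) (htf : TorsionFree S A) (ξ : S)
    (p : ℕ) (hν : IsStandard ν m) {x : S} (hx : x ≠ 0) (hi : Indep 1 (x * x))
    (hu : ∀ i < m, IsUnit (den S τ ξ (x * content S q ν i))) :
    idem q (fun i => σ (p + i)) ν m *
        (h.reflection ξ p).prod m (fun i => x * content S q ν i) =
      idem q (fun i => σ (p + i)) ν m *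
        (h.reflection ξ p).prod m (fun i => x * content S q ν i) *
        flipAt q (fun i => σ (p + i)) 0 ν m := by
  have hs := isHecke_at h.hecke p
  induction m with
  | zero => simp [flipAt, idem, up_zero]
  | succ m ih =>
    have hν' := hν.mono (Nat.le_succ m)
    have hr := isHecke_flip hs 0 (m + 1)
    have hQ := ih hν' fun i hi => hu i (by omega)
    have hlast := idem_mul_prod_last h hq htf ξ p hν' (fun i _ => rfl) hQ
      (by rw [← mul_assoc]; exact hi.mul_content m)
    have hEe := (hs (m + 1)).idem_mul_idem_of_le hq (by omega) hν (Nat.le_succ m)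
    -- It suffices that the product is an eigenvector of the reversed Jucys–Murphy elements with the
    -- contents of `ν`. All weights but the last come from the smaller tableau, the last from
    -- `idem_mul_prod_weight`.
    refine (HasWeight.mul_idem (n := m + 1) (a := fun k => qContent q (ν k)) hq hν ?_ le_rfl
      fun _ _ => rfl).symm
    intro k hk
    rcases Nat.lt_or_ge k m with h1 | h1
    · have e : idem q (fun i => σ (p + i)) ν (m + 1) *
          (h.reflection ξ p).prod (m + 1) (fun i => x * content S q ν i) =
          idem q (fun i => σ (p + i)) ν (m + 1) *
          (h.reflection ξ p).prod (m + 1) (fun i => x * content S q ν i) *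
          flipAt q (fun i => σ (p + i)) 1 ν m := by
        rw [← hEe, mul_assoc (idem _ _ _ (m + 1)), mul_assoc (idem _ _ _ (m + 1)), ← hlast]
      have hw := hr.idem_mul_jm hq (by omega) hν' h1
      rw [idem_flip_succ fun i => σ (p + i)] at hw
      rw [e, mul_assoc, hw, mul_smul_comm]
    · obtain rfl : k = m := by omega
      cases k with
      | zero =>
        simp [jm, qContent, hν.first]
      | succ k => exact idem_mul_prod_weight h hq htf ξ p hν hx hu hQ

end Fusion

/-! ### The dual boundary operator -/

section Dual

theorem unop_up {M : Type*} [Monoid M] (n : ℕ) (f : ℕ → Mᵐᵒᵖ) :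
    MulOpposite.unop (up n f) = down n fun i => MulOpposite.unop (f i) := by
  induction n with
  | zero => rfl
  | succ n ih => rw [up_succ, MulOpposite.unop_mul, ih, down_succ]

theorem unop_down {M : Type*} [Monoid M] (n : ℕ) (f : ℕ → Mᵐᵒᵖ) :
    MulOpposite.unop (down n f) = up n fun i => MulOpposite.unop (f i) := by
  induction n with
  | zero => rfl
  | succ n ih => rw [down_succ, MulOpposite.unop_mul, ih, up_succ]

variable {A : Type*} [Ring A] [Algebra ℂ A] {q : ℂ} {s : ℕ → A} {ν : ℕ → ℕ × ℕ} {m n : ℕ}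
variable {S : Type*} [CommRing S] [Algebra ℂ S] [Algebra S A] [IsScalarTower ℂ S A]

/-- The dual boundary operator. -/
def dualProd (hs : ∀ N, IsHecke q N s) (P P' : S) (m : ℕ) (u : ℕ → S) : A :=
  MulOpposite.unop ((dualReflection hs P P').prod m u)

theorem dualProd_zero (hs : ∀ N, IsHecke q N s) (P P' : S) (u : ℕ → S) :
    dualProd hs P P' 0 u = 1 := rfl

theorem dualProd_succ (hs : ∀ N, IsHecke q N s) (P P' : S) (m : ℕ) (u : ℕ → S) :
    dualProd hs P P' (m + 1) u =
      (down m fun j => bax q (s (m - 1 - j)) P (P' * (u m * u j))) * dualProd hs P P' m u := by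
  rw [dualProd, Reflection.prod_succ]
  show MulOpposite.unop (_ * 1) = _
  rw [mul_one, MulOpposite.unop_mul, unop_up]
  rfl

theorem dualProd_cat (hs : ∀ N, IsHecke q N s) (P P' : S) (m n : ℕ) (u v : ℕ → S) :
    dualProd hs P P' (m + n) (Reflection.cat m u v) =
      dualProd hs P P' n v * dualBlock q s P P' m n u v * dualProd hs P P' m u := by
  rw [dualProd, Reflection.prod_cat, MulOpposite.unop_mul, MulOpposite.unop_mul, mul_assoc,
    Reflection.crossing, unop_up]
  simp only [unop_up]
  rfl

/-- The operator that exchanges two blocks, with the strands in reverse order. -/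
def swapBlockRev (q : ℂ) (s : ℕ → A) (m n : ℕ) (u v : ℕ → S) : A :=
  down n fun k => up m fun j => bax q (s (m + n - 2 - (k + j))) (u j) (v k)

theorem dualProd_mul_swapBlock (hs : ∀ N, IsHecke q N s) (P P' : S) (m n : ℕ) (u v : ℕ → S) :
    dualProd hs P P' (m + n) (Reflection.cat n v u) * swapBlock q s m n u v =
      swapBlockRev q s m n u v * dualProd hs P P' (m + n) (Reflection.cat m u v) := by
  have key := congrArg MulOpposite.unop ((dualReflection hs P P').exchange_mul_prod v u n m)
  rw [MulOpposite.unop_mul, MulOpposite.unop_mul, Reflection.exchange, Reflection.exchange,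
    unop_down, unop_down] at key
  simp only [unop_up] at key
  rw [add_comm n m] at key
  have e1 : swapBlock q s m n u v =
      up m fun k => down n fun j => bax q (s (k + j)) (u k) (v j) := by
    rw [swapBlock, down_up_comm]
    · simp only [add_comm]
    · exact fun k i k' i' _ _ _ _ => commute_bax_bax hs (by omega) _ _ _ _
  have e2 : swapBlockRev q s m n u v =
      up m fun k => down n fun j => bax q (s (m + n - 2 - (k + j))) (u k) (v j) := by
    rw [swapBlockRev, down_up_comm]
    · simp only [add_comm]
    · exact fun k i k' i' _ _ _ _ => commute_bax_bax hs (by omega) _ _ _ _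
  rw [e1, e2]
  exact key

theorem up_mul_down_eq_smul {n : ℕ} {f g : ℕ → A} {t : ℕ → S} (h : ∀ j < n, f j * g j = t j • 1) :
    up n f * down n g = (∏ j ∈ Finset.range n, t j) • (1 : A) := by
  induction n with
  | zero => simp [down_zero, up_zero]
  | succ n ih =>
    rw [down_succ, up_succ, mul_assoc, ← mul_assoc (f n), h n (by omega), smul_mul_assoc, one_mul,
      mul_smul_comm, ih fun j hj => h j (by omega), smul_smul, Finset.prod_range_succ, mul_comm]

theorem swapBlock_mul_swapBlock (hs : ∀ N, IsHecke q N s) (m n : ℕ) (u v : ℕ → S) :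
    swapBlock q s n m v u * swapBlock q s m n u v =
      (∏ j ∈ Finset.range n, ∏ k ∈ Finset.range m,
        ((algebraMap ℂ S (lam q)) ^ 2 * v j * u k - (u k - v j) ^ 2)) • (1 : A) := by
  have e : swapBlock q s n m v u =
      up n fun j => down m fun k => bax q (s (j + k)) (v j) (u k) := by
    rw [swapBlock, down_up_comm]
    · simp only [add_comm]
    · exact fun k i k' i' _ _ _ _ => commute_bax_bax hs (by omega) _ _ _ _
  rw [e, swapBlock]
  exact up_mul_down_eq_smul fun j _ => down_mul_up_eq_smul fun k _ =>
    bax_mul_bax (hs (j + k + 1)) (by omega) _ _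

/-! #### The element that reverses the strands -/

/-- The inverse of the standard lift of the longest permutation. -/
def reversal (hs : ∀ N, IsHecke q N s) (m : ℕ) : A := dualProd hs (-1 : ℂ) 0 m 0

/-- At P = -1 and P' = 0 every Baxterized generator is the inverse generator s - λ, whatever the
spectral parameters, so each row is a cycle. -/
theorem reversal_succ (hs : ∀ N, IsHecke q N s) (m : ℕ) : reversal hs (m + 1) =
    cycle q (fun i => s (0 + (m + 1 - 2 - i))) m * reversal hs m := by
  rw [reversal, dualProd_succ, cycle, reversal]
  congr 1
  refine down_congr fun j _ => ?_
  rw [bax, hinv, show 0 + (m + 1 - 2 - j) = m - 1 - j by omega, Algebra.algebraMap_self,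
    RingHom.id_apply]
  simp only [zero_mul, sub_neg_eq_add, zero_add, one_smul, mul_neg, mul_one, neg_smul]
  rw [sub_eq_add_neg]

theorem reversal_inv (hs : ∀ N, IsHecke q N s) (m : ℕ) :
    ∃ x ∈ strands s m, reversal hs m * x = 1 ∧ x * reversal hs m = 1 := by
  induction m with
  | zero => exact ⟨1, one_mem _, one_mul 1, one_mul 1⟩
  | succ m ih =>
    obtain ⟨x, hx, h1, h2⟩ := ih
    have hr := isHecke_flip hs 0 (m + 1)
    have hc := hr.cycle_mul_up (n := m) (by omega)
    have hc' := hr.up_mul_cycle (n := m) (by omega)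
    refine ⟨x * up m fun i => s (0 + (m + 1 - 2 - i)), mul_mem (strands_mono (Nat.le_succ m) hx)
      (up_mem fun i hi => gen_mem_strands (by omega)), ?_, ?_⟩
    · rw [reversal_succ, mul_assoc, ← mul_assoc (reversal hs m), h1, one_mul, hc]
    · rw [reversal_succ, mul_assoc, ← mul_assoc (up _ _), hc', one_mul, h2]

/-- For P' = 0 the dual operator does not depend on its parameters. Its exchange relation, read at
parameters 1 and 0 where R is the bare generator, becomes conjugation by the reversal. -/
theorem reversal_semiconjBy (hs : ∀ N, IsHecke q N s) {i : ℕ} (hi : i + 1 < m) :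
    SemiconjBy (reversal hs m) (s i) (s (m - 2 - i)) := by
  have hconst : ∀ (w : ℕ → ℂ), (dualReflection hs (-1 : ℂ) 0).prod m w =
      (dualReflection hs (-1 : ℂ) 0).prod m 0 := fun w => by
    clear hi
    induction m with
    | zero => rfl
    | succ m ih =>
      rw [Reflection.prod_succ, Reflection.prod_succ, ih]
      refine congrArg₂ _ (congrArg₂ _ rfl (up_congr fun j _ => ?_)) rfl
      show MulOpposite.op (bax q _ _ (0 * _)) = MulOpposite.op (bax q _ _ (0 * _))
      rw [zero_mul, zero_mul]
  have key := (dualReflection hs (-1 : ℂ) 0).R_mul_prod hi fun k => if k = i then 1 else 0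
  rw [hconst, hconst fun k => if Equiv.swap i (i + 1) k = i then 1 else 0, if_pos rfl, if_neg (by omega)] at key
  have e : ∀ j, (dualReflection hs (-1 : ℂ) 0).R j 1 0 = MulOpposite.op (s j) := fun j => by
    show MulOpposite.op (bax q (s j) 0 1) = _
    rw [bax]; simp
  rw [e, e] at key
  exact congrArg MulOpposite.unop key

theorem flipAt_mul_reversal (hs : ∀ N, IsHecke q N s) :
    flipAt q s 0 ν m * reversal hs m = reversal hs m * idem q s ν m := by
  have := semiconjBy_idem (q := q) (ν := ν) (m := m) fun i hi => reversal_semiconjBy hs hi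
  simp only [flipAt, Nat.zero_add]
  exact this.eq.symm

/-- The scalar by which the dual boundary operator acts. -/
def dualScalar (q : ℂ) (ν : ℕ → ℕ × ℕ) (P P' x : S) (m : ℕ) : S :=
  ∏ i ∈ Finset.range m, ∏ k ∈ Finset.range i,
    (P' * (x * content S q ν i * x) * content S q ν (k + 1) - P)

/-- By the row formula each row is a scalar times a linear function of a Jucys–Murphy element times
a cycle. The idempotent evaluates the linear function, and the cycles multiply to the reversal. -/
theorem flipAt_mul_dualProd (hs : ∀ N, IsHecke q N s) (hq : Generic q) (hν : IsStandard ν m)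
    (P P' x : S) : flipAt q s 0 ν m * dualProd hs P P' m (fun i => x * content S q ν i) =
      dualScalar q ν P P' x m • (flipAt q s 0 ν m * reversal hs m) := by
  induction m with
  | zero => simp [dualScalar, dualProd_zero, reversal]
  | succ m ih =>
    have hν' := hν.mono (Nat.le_succ m)
    have hr := isHecke_flip hs 0 (m + 1)
    have ih := ih hν'
    have hEe : flipAt q s 0 ν (m + 1) * flipAt q s 1 ν m = flipAt q s 0 ν (m + 1) := by
      rw [← idem_flip_succ]
      exact hr.idem_mul_idem_of_le hq (by omega) hν (Nat.le_succ m)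
    have hcyc : flipAt q s 1 ν m * cycle q (fun i => s (0 + (m + 1 - 2 - i))) m =
        cycle q (fun i => s (0 + (m + 1 - 2 - i))) m * flipAt q s 0 ν m := by
      have := hr.cycle_mul_idem (ν := ν) (n := m) (by omega)
      rw [idem_flip_succ] at this
      rw [← this, flipAt]
      congr 1
      exact idem_congr fun i hi => by congr 1; omega
    rw [dualProd_succ, reversal_succ, dualScalar, Finset.prod_range_succ, ← dualScalar]
    set E := flipAt q s 0 ν (m + 1) with hE
    set w := cycle q (fun i => s (0 + (m + 1 - 2 - i))) m with hw
    have hrow : E * (down m fun j => bax q (s (m - 1 - j)) P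
        (P' * (x * content S q ν m * (x * content S q ν j)))) =
        (∏ k ∈ Finset.range m, (P' * (x * content S q ν m * x) * content S q ν (k + 1) - P)) •
          (E * w) := by
      have e : (down m fun j => bax q (s (m - 1 - j)) P
          (P' * (x * content S q ν m * (x * content S q ν j)))) =
          down m fun j => bax q (s (0 + (m + 1 - 2 - j))) P
            (P' * (x * content S q ν m * x) * content S q ν j) := by
        refine down_congr fun j _ => ?_
        rw [show 0 + (m + 1 - 2 - j) = m - 1 - j by omega]
        congr 1
        ring
      rw [e]
      cases m with
      | zero => simp [hw, cycle, down_zero]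
      | succ m =>
        have h1 := hr.idem_mul_row hq (by omega) hν' P (P' * (x * content S q ν (m + 1) * x))
        rw [idem_flip_succ, ← hw] at h1
        have h2 : E * jm (fun i => s (0 + (m + 1 + 1 - 2 - i))) (m + 1) =
            content S q ν (m + 1) • E := by
          rw [hE, flipAt, hr.idem_mul_jm hq (by omega) hν (by omega), algebraMap_smul]
        have h3 : ∀ b : S, E * (b • jm (fun i => s (0 + (m + 1 + 1 - 2 - i))) (m + 1) - P • 1) =
            (b * content S q ν (m + 1) - P) • E := fun b => by
          rw [mul_sub, mul_smul_comm, h2, smul_smul, mul_smul_comm, mul_one, ← sub_smul]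
        rw [← hEe, mul_assoc E, h1, mul_smul_comm, ← mul_assoc E (_ * _) w,
          ← mul_assoc E (flipAt q s 1 ν (m + 1)), hEe, h3, smul_mul_assoc, smul_smul,
          Finset.prod_range_succ]
    rw [← mul_assoc, hrow, smul_mul_assoc]
    have e2 : E * w * dualProd hs P P' m (fun i => x * content S q ν i) =
        dualScalar q ν P P' x m • (E * (w * reversal hs m)) := by
      calc E * w * dualProd hs P P' m (fun i => x * content S q ν i)
          = E * (flipAt q s 1 ν m * w) * dualProd hs P P' m (fun i => x * content S q ν i) := by
            rw [← mul_assoc, hEe]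
        _ = E * w * (flipAt q s 0 ν m * dualProd hs P P' m fun i => x * content S q ν i) := by
            rw [hcyc]; simp only [mul_assoc]
        _ = dualScalar q ν P P' x m • (E * (w * flipAt q s 0 ν m) * reversal hs m) := by
            rw [ih, mul_smul_comm]; simp only [mul_assoc]
        _ = _ := by rw [← hcyc, ← mul_assoc, hEe, mul_assoc]
    rw [e2, smul_smul, mul_comm]

/-- The idempotent of a tableau can be moved through the dual boundary operator. -/
theorem flipAt_mul_dualProd_idem (hs : ∀ N, IsHecke q N s) (hq : Generic q) (hν : IsStandard ν m)
    (P P' x : S) : flipAt q s 0 ν m * dualProd hs P P' m (fun i => x * content S q ν i) =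
      flipAt q s 0 ν m * dualProd hs P P' m (fun i => x * content S q ν i) * idem q s ν m := by
  rw [flipAt_mul_dualProd hs hq hν, smul_mul_assoc, flipAt_mul_reversal, mul_assoc,
    (hs m).idem_sq hq (by omega) hν]

end Dual

/-! ### Markov traces -/

/-- A Markov trace on a tower of subalgebras; `tr n` is the trace over the strand `n`. -/
structure TraceFrame (S : Type*) {A : Type*} [CommRing S] [Ring A] [Algebra S A] [Algebra ℂ A]
    (q : ℂ) (s : ℕ → A) where
  L : ℕ → Subalgebra S A
  tr : ℕ → A →ₗ[S] A
  Q0 : ℂ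
  Qp : ℂ
  mono : ∀ n, L n ≤ L (n + 1)
  s_mem : ∀ n, s n ∈ L (n + 2)
  comm : ∀ n i, n ≤ i → ∀ x ∈ L n, Commute x (s i)
  tr_mem : ∀ n, ∀ Y ∈ L (n + 1), tr n Y ∈ L n
  tr_left : ∀ n, ∀ X ∈ L n, ∀ Y ∈ L (n + 1), tr n (X * Y) = X * tr n Y
  tr_right : ∀ n, ∀ X ∈ L n, ∀ Y ∈ L (n + 1), tr n (Y * X) = tr n Y * X
  tr_one : ∀ n, tr n 1 = Q0 • (1 : A)
  tr_conj : ∀ n, ∀ X ∈ L (n + 1), tr (n + 1) (s n * X * hinv q (s n)) = tr n X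
  tr_s : ∀ n, tr (n + 1) (s n) = Qp • (1 : A)
  cyclic : ∀ n, ∀ Y ∈ L (n + 2), tr n (tr (n + 1) (s n * Y)) = tr n (tr (n + 1) (Y * s n))

namespace TraceFrame

variable {S A : Type*} [CommRing S] [Ring A] [Algebra S A] [Algebra ℂ A] {q : ℂ} {s : ℕ → A}
  (F : TraceFrame S q s)

theorem mono' {k l : ℕ} (h : k ≤ l) : F.L k ≤ F.L l := monotone_nat_of_le_succ F.mono h

theorem s_mem' {i k : ℕ} (h : i + 2 ≤ k) : s i ∈ F.L k := F.mono' h (F.s_mem i)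

/-- The trace over the strands `a, …, a + k - 1`. -/
def traces {S A : Type*} [CommRing S] [Ring A] [Algebra S A] [Algebra ℂ A] {q : ℂ} {s : ℕ → A}
    (F : TraceFrame S q s) (a : ℕ) : ℕ → (A →ₗ[S] A)
  | 0 => LinearMap.id
  | k + 1 => (traces F a k).comp (F.tr (a + k))

theorem traces_succ (a k : ℕ) (Y : A) : F.traces a (k + 1) Y = F.traces a k (F.tr (a + k) Y) := rfl

theorem traces_add (a k l : ℕ) (Y : A) :
    F.traces a (k + l) Y = F.traces a k (F.traces (a + k) l Y) := by
  induction l generalizing Y with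
  | zero => rfl
  | succ l ih => rw [← add_assoc, traces_succ, ih, traces_succ, add_assoc]

theorem traces_mem {a k : ℕ} {Y : A} (hY : Y ∈ F.L (a + k)) : F.traces a k Y ∈ F.L a := by
  induction k generalizing Y with
  | zero => exact hY
  | succ k ih => exact ih (F.tr_mem _ _ hY)

theorem traces_left {a k : ℕ} {X Y : A} (hX : X ∈ F.L a) (hY : Y ∈ F.L (a + k)) :
    F.traces a k (X * Y) = X * F.traces a k Y := by
  induction k generalizing Y with
  | zero => rfl
  | succ k ih =>
    rw [traces_succ, F.tr_left (a + k) _ (F.mono' (by omega) hX) _ hY, ih (F.tr_mem _ _ hY), traces_succ]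

theorem traces_right {a k : ℕ} {X Y : A} (hX : X ∈ F.L a) (hY : Y ∈ F.L (a + k)) :
    F.traces a k (Y * X) = F.traces a k Y * X := by
  induction k generalizing Y with
  | zero => rfl
  | succ k ih =>
    rw [traces_succ, F.tr_right (a + k) _ (F.mono' (by omega) hX) _ hY, ih (F.tr_mem _ _ hY),
      traces_succ]

theorem traces_cyclic {k i : ℕ} (hi : i + 1 < k) {Y : A} (hY : Y ∈ F.L k) :
    F.traces 0 k (s i * Y) = F.traces 0 k (Y * s i) := by
  induction k generalizing Y with
  | zero => omega
  | succ k ih =>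
    rw [traces_succ, traces_succ, Nat.zero_add]
    rcases Nat.lt_or_ge (i + 1) k with h1 | h1
    · rw [F.tr_left _ _ (F.s_mem' h1) _ hY, F.tr_right _ _ (F.s_mem' h1) _ hY,
        ih h1 (F.tr_mem _ _ hY)]
    · obtain rfl : k = i + 1 := by omega
      rw [traces_succ, traces_succ, Nat.zero_add, F.cyclic _ _ hY]

/-- The elements that can be moved cyclically under the trace over all strands. -/
def cyc (k : ℕ) : Subalgebra S A where
  carrier := {a | a ∈ F.L k ∧ ∀ Y ∈ F.L k, F.traces 0 k (a * Y) = F.traces 0 k (Y * a)}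
  mul_mem' {a b} ha hb := by
    refine ⟨mul_mem ha.1 hb.1, fun Y hY => ?_⟩
    rw [mul_assoc, ha.2 _ (mul_mem hb.1 hY), mul_assoc, hb.2 _ (mul_mem hY ha.1), mul_assoc]
  add_mem' {a b} ha hb := by
    refine ⟨add_mem ha.1 hb.1, fun Y hY => ?_⟩
    rw [add_mul, mul_add, map_add, map_add, ha.2 Y hY, hb.2 Y hY]
  algebraMap_mem' c := ⟨Subalgebra.algebraMap_mem _ c, fun Y _ => by rw [Algebra.commutes]⟩

theorem s_mem_cyc {i k : ℕ} (h : i + 1 < k) : s i ∈ F.cyc k :=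
  ⟨F.s_mem' h, fun _ hY => F.traces_cyclic h hY⟩

theorem traces_cyc {k : ℕ} {a Y : A} (ha : a ∈ F.cyc k) (hY : Y ∈ F.L k) :
    F.traces 0 k (a * Y) = F.traces 0 k (Y * a) := ha.2 Y hY

variable [Algebra ℂ S] [IsScalarTower ℂ S A]

theorem strands_at_le {T : Subalgebra S A} {k m : ℕ} (h : ∀ i, k ≤ i → i + 1 < k + m → s i ∈ T)
    {a : A} (ha : a ∈ strands (fun i => s (k + i)) m) : a ∈ T := by
  have : strands (fun i => s (k + i)) m ≤ T.restrictScalars ℂ :=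
    Algebra.adjoin_le fun x ⟨i, hi, e⟩ => e ▸ h _ (by omega) (by omega)
  exact this ha

theorem bax_mem {T : Subalgebra S A} {r : A} (h : r ∈ T) (a b : S) : bax q r a b ∈ T :=
  add_mem (T.smul_mem h _) (T.smul_mem (one_mem T) _)

theorem tr_of_mem {n : ℕ} {Y : A} (hY : Y ∈ F.L n) : F.tr n Y = F.Q0 • Y := by
  rw [← mul_one Y, F.tr_left _ _ hY _ (one_mem _), F.tr_one, mul_smul_comm, mul_one]

/-- Two Baxterized generators cancel under the trace. -/
theorem tr_bax {P P' : S}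
    (hP : algebraMap ℂ S F.Qp * P' = P * algebraMap ℂ S (F.Qp - lam q * F.Q0)) (n : ℕ) (y : S)
    {Y : A} (hY : Y ∈ F.L (n + 1)) :
    F.tr (n + 1) (bax q (s n) P (P' * y) * Y * bax q (s n) y 1) =
      ((P' * y - P) * (1 - y)) • F.tr n Y := by
  have h0 : F.tr (n + 1) Y = algebraMap ℂ S F.Q0 • Y := by rw [F.tr_of_mem hY, algebraMap_smul]
  have h1 : F.tr (n + 1) (s n * Y) = algebraMap ℂ S F.Qp • Y := by
    rw [F.tr_right _ _ hY _ (F.s_mem n), F.tr_s, smul_mul_assoc, one_mul, algebraMap_smul]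
  have h2 : F.tr (n + 1) (Y * s n) = algebraMap ℂ S F.Qp • Y := by
    rw [F.tr_left _ _ hY _ (F.s_mem n), F.tr_s, mul_smul_comm, mul_one, algebraMap_smul]
  have h3 : F.tr (n + 1) (s n * Y * s n) =
      F.tr n Y + (algebraMap ℂ S (lam q) * algebraMap ℂ S F.Qp) • Y := by
    have e : s n = hinv q (s n) + algebraMap ℂ S (lam q) • 1 := by
      rw [hinv, algebraMap_smul, sub_add_cancel]
    have e2 : s n * Y * s n = s n * Y * hinv q (s n) + algebraMap ℂ S (lam q) • (s n * Y) := by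
      calc s n * Y * s n = s n * Y * (hinv q (s n) + algebraMap ℂ S (lam q) • 1) := by rw [← e]
        _ = _ := by rw [mul_add, mul_smul_comm, mul_one]
    rw [e2, map_add, F.tr_conj _ _ hY, map_smul, h1, smul_smul]
  have e : bax q (s n) P (P' * y) * Y * bax q (s n) y 1 =
      ((P' * y - P) * (1 - y)) • (s n * Y * s n)
      + ((P' * y - P) * (algebraMap ℂ S (lam q) * y)) • (s n * Y)
      + ((algebraMap ℂ S (lam q) * P) * (1 - y)) • (Y * s n)
      + ((algebraMap ℂ S (lam q) * P) * (algebraMap ℂ S (lam q) * y)) • Y := by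
    simp only [bax, mul_add, add_mul, smul_mul_assoc, mul_smul_comm, mul_one, one_mul]
    module
  rw [e]
  simp only [map_add, map_smul, h0, h1, h2, h3]
  rw [map_sub, map_mul] at hP
  -- The terms proportional to `Y` add up to λ y (Q₊ P' - P (Q₊ - λ Q₀)) `Y`, which vanishes by the
  -- choice of P and P'.
  have hP' := congrArg (fun z => (algebraMap ℂ S (lam q) * y * z) • Y) hP
  linear_combination (norm := module) hP'

/-- The innermost pair is the only one that involves the last strand. The trace over that strand
cancels the pair, and the other factors are pulled out by the bimodule property. -/
theorem traces_row {P P' : S}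
    (hP : algebraMap ℂ S F.Qp * P' = P * algebraMap ℂ S (F.Qp - lam q * F.Q0)) (k m : ℕ) (v : S)
    (u : ℕ → S) {Y : A} (hY : Y ∈ F.L (k + m)) :
    F.traces (k + 1) m ((down m fun j => bax q (s (k + (m - 1 - j))) P (P' * (v * u j))) * Y *
      up m fun j => bax q (s (k + (m - 1 - j))) (v * u j) 1) =
    (∏ j ∈ Finset.range m, ((P' * (v * u j) - P) * (1 - v * u j))) • F.traces k m Y := by
  induction m generalizing Y u with
  | zero => simp [down_zero, up_zero, traces]
  | succ m ih =>
    have e : ∀ j, m + 1 - 1 - (j + 1) = m - 1 - j := fun j => by omega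
    rw [down_succ_right, up_succ_left, traces_succ]
    simp only [e]
    rw [Nat.add_sub_cancel, Nat.sub_zero]
    have hd : (down m fun j => bax q (s (k + (m - 1 - j))) P (P' * (v * u (j + 1)))) ∈
        F.L (k + 1 + m) := down_mem fun j hj => bax_mem (F.s_mem' (by omega)) _ _
    have hu : (up m fun j => bax q (s (k + (m - 1 - j))) (v * u (j + 1)) 1) ∈ F.L (k + 1 + m) :=
      up_mem fun j hj => bax_mem (F.s_mem' (by omega)) _ _
    have hY' : Y ∈ F.L (k + m + 1) := hY
    have hb : ∀ a b : S, bax q (s (k + m)) a b ∈ F.L (k + m + 1 + 1) := fun a b =>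
      bax_mem (F.s_mem' (by omega)) _ _
    have hmid : bax q (s (k + m)) P (P' * (v * u 0)) * Y * bax q (s (k + m)) (v * u 0) 1 ∈
        F.L (k + m + 1 + 1) := mul_mem (mul_mem (hb _ _) (F.mono _ hY')) (hb _ _)
    have hc := F.tr_bax hP (k + m) (v * u 0) hY'
    rw [show k + m + 1 = k + 1 + m by omega] at hmid hc
    set d := down m fun j => bax q (s (k + (m - 1 - j))) P (P' * (v * u (j + 1)))
    set d' := up m fun j => bax q (s (k + (m - 1 - j))) (v * u (j + 1)) 1
    have e1 : d * bax q (s (k + m)) P (P' * (v * u 0)) * Y *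
        (bax q (s (k + m)) (v * u 0) 1 * d') =
        d * (bax q (s (k + m)) P (P' * (v * u 0)) * Y * bax q (s (k + m)) (v * u 0) 1) * d' := by
      simp only [mul_assoc]
    rw [e1, F.tr_right _ _ hu _ (mul_mem (F.mono _ hd) hmid), F.tr_left _ _ hd _ hmid, hc,
      mul_smul_comm, smul_mul_assoc, map_smul,
      ih (fun j => u (j + 1)) (F.tr_mem _ _ hY'), smul_smul, Finset.prod_range_succ']
    rw [mul_comm]
    rfl

/-- The scalar by which the crossings of two blocks cancel. -/
def crossScalar (P P' : S) (m n : ℕ) (u v : ℕ → S) : S :=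
  ∏ k ∈ Finset.range n, ∏ j ∈ Finset.range m, ((P' * (v k * u j) - P) * (1 - v k * u j))

/-- Each cancelled row lowers the traced strands by one place; after all rows the trace runs over
the first strands. -/
theorem traces_block {P P' : S}
    (hP : algebraMap ℂ S F.Qp * P' = P * algebraMap ℂ S (F.Qp - lam q * F.Q0)) (m n : ℕ)
    (u v : ℕ → S) {Y : A} (hY : Y ∈ F.L m) :
    F.traces n m (dualBlock q s P P' m n u v * Y * crossBlock q s m n u v) =
      crossScalar P P' m n u v • F.traces 0 m Y := by
  induction n with
  | zero => simp [dualBlock, crossBlock, down_zero, up_zero, crossScalar]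
  | succ n ih =>
    have hYn : dualBlock q s P P' m n u v * Y * crossBlock q s m n u v ∈ F.L (n + m) :=
      mul_mem (mul_mem (down_mem fun k hk => down_mem fun j hj =>
          bax_mem (F.s_mem' (by omega)) _ _) (F.mono' (by omega) hY))
        (up_mem fun k hk => up_mem fun j hj => bax_mem (F.s_mem' (by omega)) _ _)
    have hrow := F.traces_row hP n m (v n) u hYn
    rw [ih, smul_smul] at hrow
    rw [dualBlock, down_succ, crossBlock, up_succ, ← dualBlock, ← crossBlock, crossScalar,
      Finset.prod_range_succ, ← crossScalar, mul_comm (crossScalar _ _ _ _ _ _), ← hrow]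
    simp only [mul_assoc]

end TraceFrame

/-! #### Extension to power series -/

section SeriesFrame

open scoped PowerSeries

attribute [local instance] seriesAlgebra

variable {S A : Type*} [CommRing S] [Ring A] [Algebra S A]

/-- The power series with coefficients in a subalgebra. -/
def seriesSubalgebra (L : Subalgebra S A) : Subalgebra S⟦X⟧ A⟦X⟧ where
  carrier := {x | ∀ n, PowerSeries.coeff n x ∈ L}
  mul_mem' {a b} ha hb n := by
    rw [PowerSeries.coeff_mul]
    exact sum_mem fun i _ => mul_mem (ha _) (hb _)
  add_mem' {a b} ha hb n := by
    rw [map_add]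
    exact add_mem (ha n) (hb n)
  algebraMap_mem' c n := by
    rw [RingHom.algebraMap_toAlgebra', PowerSeries.coeff_map]
    exact Subalgebra.algebraMap_mem _ _

theorem C_mem_seriesSubalgebra {L : Subalgebra S A} {x : A} (h : x ∈ L) :
    PowerSeries.C x ∈ seriesSubalgebra L := fun n => by
  rw [PowerSeries.coeff_C]
  split_ifs
  · exact h
  · exact zero_mem L

/-- A linear map, applied to each coefficient. -/
def seriesMap (f : A →ₗ[S] A) : A⟦X⟧ →ₗ[S⟦X⟧] A⟦X⟧ where
  toFun x := PowerSeries.mk fun n => f (PowerSeries.coeff n x)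
  map_add' x y := by ext n; simp
  map_smul' c x := by
    ext n
    rw [PowerSeries.coeff_mk, coeff_series_smul, map_sum, RingHom.id_apply, coeff_series_smul]
    refine Finset.sum_congr rfl fun i _ => ?_
    rw [map_smul, PowerSeries.coeff_mk]

theorem coeff_seriesMap (f : A →ₗ[S] A) (x : A⟦X⟧) (n : ℕ) :
    PowerSeries.coeff n (seriesMap f x) = f (PowerSeries.coeff n x) := by
  show PowerSeries.coeff n (PowerSeries.mk fun n => f (PowerSeries.coeff n x)) = _
  rw [PowerSeries.coeff_mk]

variable [Algebra ℂ A] {q : ℂ} {s : ℕ → A}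

/-- The coefficientwise trace on power series. -/
def TraceFrame.series (F : TraceFrame S q s) :
    TraceFrame S⟦X⟧ q fun i => constSeries A (s i) where
  L n := seriesSubalgebra (F.L n)
  tr n := seriesMap (F.tr n)
  Q0 := F.Q0
  Qp := F.Qp
  mono n x hx k := F.mono n (hx k)
  s_mem n := C_mem_seriesSubalgebra (F.s_mem n)
  comm n i hi x hx := by
    ext k
    rw [constSeries_apply, PowerSeries.coeff_mul_C, PowerSeries.coeff_C_mul]
    exact F.comm n i hi _ (hx k)
  tr_mem n Y hY k := by
    rw [coeff_seriesMap]
    exact F.tr_mem n _ (hY k)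
  tr_left n X hX Y hY := by
    ext k
    rw [coeff_seriesMap, PowerSeries.coeff_mul, map_sum, PowerSeries.coeff_mul]
    refine Finset.sum_congr rfl fun i _ => ?_
    rw [F.tr_left n _ (hX _) _ (hY _), coeff_seriesMap]
  tr_right n X hX Y hY := by
    ext k
    rw [coeff_seriesMap, PowerSeries.coeff_mul, map_sum, PowerSeries.coeff_mul]
    refine Finset.sum_congr rfl fun i _ => ?_
    rw [F.tr_right n _ (hX _) _ (hY _), coeff_seriesMap]
  tr_one n := by
    ext k
    rw [coeff_seriesMap, PowerSeries.coeff_smul, PowerSeries.coeff_one]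
    split_ifs
    · rw [F.tr_one]
    · rw [map_zero, smul_zero]
  tr_conj n X hX := by
    ext k
    have e : hinv q (constSeries A (s n)) = PowerSeries.C (hinv q (s n)) := by
      rw [← constSeries_apply, hinv, hinv, map_sub, map_smul, map_one]
    rw [coeff_seriesMap, coeff_seriesMap, e, constSeries_apply, PowerSeries.coeff_mul_C,
      PowerSeries.coeff_C_mul, F.tr_conj n _ (hX k)]
  tr_s n := by
    ext k
    rw [coeff_seriesMap, PowerSeries.coeff_smul, PowerSeries.coeff_one, constSeries_apply,
      PowerSeries.coeff_C]
    split_ifs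
    · rw [F.tr_s]
    · rw [map_zero, smul_zero]
  cyclic n Y hY := by
    ext k
    simp only [coeff_seriesMap, constSeries_apply]
    rw [PowerSeries.coeff_mul_C, PowerSeries.coeff_C_mul, F.cyclic n _ (hY k)]

/-- The recursion for the coefficients of an inverse uses only the coefficients of the series and
the inverse of its constant term. -/
theorem inverse_mem_seriesSubalgebra {L : Subalgebra S A} {x : A⟦X⟧} (hx : x ∈ seriesSubalgebra L)
    (h : IsUnit x) (h0 : Ring.inverse (PowerSeries.constantCoeff x) ∈ L) :
    Ring.inverse x ∈ seriesSubalgebra L := by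
  obtain ⟨u, hu⟩ := PowerSeries.isUnit_iff_constantCoeff.mp h
  have e1 := PowerSeries.mul_invOfUnit x u hu.symm
  have e2 := PowerSeries.invOfUnit_mul x u hu.symm
  have e : Ring.inverse x = PowerSeries.invOfUnit x u := by
    have : x = ((⟨x, _, e1, e2⟩ : A⟦X⟧ˣ) : A⟦X⟧) := rfl
    rw [this, Ring.inverse_unit]
    rfl
  rw [← hu, Ring.inverse_unit] at h0
  rw [e]
  intro n
  induction n using Nat.strong_induction_on with
  | _ n ih =>
    rw [PowerSeries.coeff_invOfUnit]
    split_ifs with hn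
    · exact h0
    · refine mul_mem (neg_mem h0) (sum_mem fun i _ => ?_)
      split_ifs with hi
      · exact mul_mem (hx _) (ih _ hi)
      · exact zero_mem L

end SeriesFrame

/-! ### Commutation of the transfer matrices for generic parameters -/

section Absorb

variable {A : Type*} [Monoid A]

/-- The element `a` in front of `x` can be repeated as `b` after `x`. -/
def Absorb (a x b : A) : Prop := a * x = a * x * b

theorem Absorb.trans {a b c x y : A} (h : Absorb a x b) (h' : Absorb b y c) :
    Absorb a (x * y) c := by
  unfold Absorb at *
  calc a * (x * y) = a * x * b * y := by rw [← h, mul_assoc]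
    _ = a * x * (b * y * c) := by rw [← h', mul_assoc]
    _ = a * x * b * y * c := by simp only [mul_assoc]
    _ = _ := by rw [← h, mul_assoc a x]

theorem Absorb.mul {a a' b b' x : A} (h : Absorb a x a') (h' : Absorb b x b')
    (hab : Commute a b) : Absorb (a * b) x (a' * b') := by
  unfold Absorb at *
  calc a * b * x = a * (b * x) := mul_assoc _ _ _
    _ = b * (a * x) * b' := by
      rw [h', ← mul_assoc, ← mul_assoc, ← mul_assoc, hab.eq]
    _ = b * a * x * (a' * b') := by rw [h]; simp only [mul_assoc]
    _ = _ := by rw [hab.eq]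

theorem Absorb.of_commute {a x : A} (ha : a * a = a) (h : Commute a x) : Absorb a x a := by
  unfold Absorb
  rw [mul_assoc, ← h.eq, ← mul_assoc, ha]

end Absorb

/-! ### Factorization of the trace over two blocks -/

section Frame

variable {S A : Type*} [CommRing S] [Algebra ℂ S] [Ring A] [Algebra S A] [Algebra ℂ A]
  [IsScalarTower ℂ S A] {q : ℂ} {s σ : ℕ → A} {τ : A} {ν ν' : ℕ → ℕ × ℕ} {m n : ℕ}

theorem commute_dualProd (hs : ∀ N, IsHecke q N s) (P P' : S) {a : A}
    (ha : ∀ i, i + 1 < m → Commute a (s i)) (u : ℕ → S) : Commute a (dualProd hs P P' m u) := by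
  induction m with
  | zero => exact Commute.one_right _
  | succ m ih =>
    rw [dualProd_succ]
    exact (commute_down fun j hj => commute_bax (ha _ (by omega)) _ _).mul_right
      (ih fun i hi => ha i (by omega))

theorem dualProd_mem (hs : ∀ N, IsHecke q N s) (P P' : S) {T : Subalgebra S A}
    (hT : ∀ i, i + 1 < m → s i ∈ T) (u : ℕ → S) : dualProd hs P P' m u ∈ T := by
  induction m with
  | zero => exact one_mem T
  | succ m ih =>
    rw [dualProd_succ]
    exact mul_mem (down_mem fun j hj => TraceFrame.bax_mem (hT _ (by omega)) _ _)
      (ih fun i hi => hT i (by omega))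

theorem idemAt_mem {T : Subalgebra S A} {k : ℕ} (h : ∀ i, k ≤ i → i + 1 < k + m → s i ∈ T) :
    idemAt q s k ν m ∈ T := TraceFrame.strands_at_le h idem_mem_strands

theorem flipAt_mem {T : Subalgebra S A} {k : ℕ} (h : ∀ i, k ≤ i → i + 1 < k + m → s i ∈ T) :
    flipAt q s k ν m ∈ T := by
  have : strands (fun i => s (k + (m - 2 - i))) m ≤ T.restrictScalars ℂ :=
    Algebra.adjoin_le fun x ⟨i, hi, e⟩ => e ▸ h _ (by omega) (by omega)
  exact this idem_mem_strands

theorem commute_idemAt_idemAt (hs : ∀ N, IsHecke q N s) {k l : ℕ} (h : k + m ≤ l) :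
    Commute (idemAt q s k ν m) (idemAt q s l ν' n) :=
  commute_idemAt fun i hi _ => (commute_idemAt fun j _ hj =>
    (hs (i + j + 1)).far' (by omega) (by omega) (by omega)).symm

theorem commute_flipAt_idemAt (hs : ∀ N, IsHecke q N s) {k l : ℕ} (h : k + m ≤ l) :
    Commute (flipAt q s k ν m) (idemAt q s l ν' n) :=
  commute_idemAt fun i hi _ => (commute_flipAt fun j _ hj =>
    (hs (i + j + 1)).far' (by omega) (by omega) (by omega)).symm

theorem commute_idemAt_flipAt (hs : ∀ N, IsHecke q N s) {k l : ℕ} (h : k + m ≤ l) :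
    Commute (idemAt q s k ν m) (flipAt q s l ν' n) :=
  commute_flipAt fun i hi _ => (commute_idemAt fun j _ hj =>
    (hs (i + j + 1)).far' (by omega) (by omega) (by omega)).symm

theorem commute_flipAt_flipAt (hs : ∀ N, IsHecke q N s) {k l : ℕ} (h : k + m ≤ l) :
    Commute (flipAt q s k ν m) (flipAt q s l ν' n) :=
  commute_flipAt fun i hi _ => (commute_flipAt fun j _ hj =>
    (hs (i + j + 1)).far' (by omega) (by omega) (by omega)).symm

theorem IsAffine.commute_reflection_prod (h : IsAffine q σ τ) (ξ : S) (p : ℕ) {a : A}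
    (ha : ∀ i, i + 1 < m → Commute a (σ (p + i)))
    (hK : 0 < m → ∀ b, Commute a (dressed q σ τ ξ p b)) (u : ℕ → S) :
    Commute a ((h.reflection ξ p).prod m u) := by
  rcases Nat.eq_zero_or_pos m with rfl | hm
  · exact Commute.one_right _
  · exact (h.reflection ξ p).commute_prod (fun i b c hi => commute_bax (ha i hi) _ _) (hK hm)

theorem IsAffine.commute_idemAt_prod (h : IsAffine q σ τ) (ξ : S) (p : ℕ) {k : ℕ} (hk : m ≤ k)
    (u : ℕ → S) :
    Commute (idemAt q (fun i => σ (p + i)) k ν n) ((h.reflection ξ p).prod m u) :=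
  h.commute_reflection_prod ξ p (fun i hi => (commute_idemAt fun j hj _ =>
    (h.hecke (p + i + j + 1)).far' (by omega) (by omega) (by omega)).symm)
    (fun hm b => (commute_idemAt fun j hj _ => h.commute_dressed ξ (by omega) b).symm) u

theorem IsAffine.commute_flipAt_prod (h : IsAffine q σ τ) (ξ : S) (p : ℕ) {k : ℕ} (hk : m ≤ k)
    (u : ℕ → S) :
    Commute (flipAt q (fun i => σ (p + i)) k ν n) ((h.reflection ξ p).prod m u) :=
  h.commute_reflection_prod ξ p (fun i hi => (commute_flipAt fun j hj _ =>
    (h.hecke (p + i + j + 1)).far' (by omega) (by omega) (by omega)).symm)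
    (fun hm b => (commute_flipAt fun j hj _ => h.commute_dressed ξ (by omega) b).symm) u

theorem commute_idemAt_dualProd (hs : ∀ N, IsHecke q N s) (P P' : S) {k : ℕ} (hk : m ≤ k)
    (u : ℕ → S) : Commute (idemAt q s k ν n) (dualProd hs P P' m u) :=
  commute_dualProd hs P P' (fun i hi => (commute_idemAt fun j hj _ =>
    (hs (i + j + 1)).far' (by omega) (by omega) (by omega)).symm) u

theorem commute_flipAt_dualProd (hs : ∀ N, IsHecke q N s) (P P' : S) {k : ℕ} (hk : m ≤ k)
    (u : ℕ → S) : Commute (flipAt q s k ν n) (dualProd hs P P' m u) :=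
  commute_dualProd hs P P' (fun i hi => (commute_flipAt fun j hj _ =>
    (hs (i + j + 1)).far' (by omega) (by omega) (by omega)).symm) u

theorem IsAffine.prod_mem (h : IsAffine q σ τ) (ξ : S) (p : ℕ)
    (F : TraceFrame S q fun i => σ (p + i)) {u : ℕ → S}
    (hu : ∀ i < m, dressed q σ τ ξ p (u i) ∈ F.L 1) :
    (h.reflection ξ p).prod m u ∈ F.L m := by
  induction m with
  | zero => exact one_mem _
  | succ m ih =>
    rw [Reflection.prod_succ]
    exact mul_mem (mul_mem (F.mono _ (ih fun i hi => hu i (by omega)))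
      (up_mem fun j hj => TraceFrame.bax_mem (F.s_mem' (i := m - 1 - j) (by omega)) _ _))
      (F.mono' (by omega) (hu m (by omega)))

/-- The tableau `ν` and the parameter `x` can be used for fusion. -/
structure Fusible (τ : A) (ξ : S) (p : ℕ) (F : TraceFrame S q fun i => σ (p + i))
    (ν : ℕ → ℕ × ℕ) (m : ℕ) (x : S) : Prop where
  std : IsStandard ν m
  ne_zero : x ≠ 0
  indep : Indep 1 (x * x)
  unit : ∀ i < m, IsUnit (den S τ ξ (x * content S q ν i))
  mem : ∀ i < m, dressed q σ τ ξ p (x * content S q ν i) ∈ F.L 1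

/-- The transfer matrix. -/
def transfer (h : IsAffine q σ τ) (ξ : S) (p : ℕ) (F : TraceFrame S q fun i => σ (p + i))
    (ν : ℕ → ℕ × ℕ) (m : ℕ) (x : S) : A :=
  F.traces 0 m (idem q (fun i => σ (p + i)) ν m *
    (h.reflection ξ p).prod m fun i => x * content S q ν i)

/-- The transfer matrix with the dual boundary operator. -/
def dualTransfer (h : IsAffine q σ τ) (ξ : S) (p : ℕ) (F : TraceFrame S q fun i => σ (p + i))
    (P P' : S) (ν : ℕ → ℕ × ℕ) (m : ℕ) (x : S) : A :=
  F.traces 0 m (dualProd (isHecke_at h.hecke p) P P' m (fun i => x * content S q ν i) *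
    idem q (fun i => σ (p + i)) ν m * (h.reflection ξ p).prod m fun i => x * content S q ν i)

variable [IsDomain S] {ξ : S} {p : ℕ} {F : TraceFrame S q fun i => σ (p + i)} {x y P P' : S}

theorem Fusible.absorb_prod (hx : Fusible τ ξ p F ν m x) (h : IsAffine q σ τ) (hq : Generic q)
    (htf : TorsionFree S A) :
    Absorb (idemAt q (fun i => σ (p + i)) 0 ν m)
      ((h.reflection ξ p).prod m fun i => x * content S q ν i)
      (flipAt q (fun i => σ (p + i)) 0 ν m) := by
  rw [idemAt_zero fun i => σ (p + i)]
  exact idem_mul_prod h hq htf ξ p hx.std hx.ne_zero hx.indep hx.unit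

theorem Fusible.absorb_dualProd (hx : Fusible τ ξ p F ν m x) (hs : ∀ N, IsHecke q N s)
    (hq : Generic q) (P P' : S) :
    Absorb (flipAt q s 0 ν m) (dualProd hs P P' m fun i => x * content S q ν i)
      (idemAt q s 0 ν m) := by
  rw [idemAt_zero s]
  exact flipAt_mul_dualProd_idem hs hq hx.std P P' x

theorem Fusible.prod_mem (hx : Fusible τ ξ p F ν m x) (h : IsAffine q σ τ) :
    ((h.reflection ξ p).prod m fun i => x * content S q ν i) ∈ F.L m :=
  h.prod_mem ξ p F hx.mem

theorem Fusible.prod_cat_mem (hx : Fusible τ ξ p F ν m x) (hy : Fusible τ ξ p F ν' n y)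
    (h : IsAffine q σ τ) :
    ((h.reflection ξ p).prod (m + n) (Reflection.cat m (fun i => x * content S q ν i)
      fun i => y * content S q ν' i)) ∈ F.L (m + n) :=
  h.prod_mem ξ p F fun i hi => by
    unfold Reflection.cat
    split_ifs with h1
    · exact hx.mem i h1
    · exact hy.mem _ (by omega)

/-- Both operators split into the two blocks and a crossing. The crossings enclose the contribution
of the first block and cancel under the trace by `TraceFrame.traces_block`, once the idempotent of
the second block has been moved out from between them. -/
theorem traces_cat (hx : Fusible τ ξ p F ν m x) (hy : Fusible τ ξ p F ν' n y)
    (h : IsAffine q σ τ) (hq : Generic q) (htf : TorsionFree S A) (hyx : Indep 1 (y * x))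
    (hP : algebraMap ℂ S F.Qp * P' = P * algebraMap ℂ S (F.Qp - lam q * F.Q0)) :
    F.traces 0 (m + n) (dualProd (isHecke_at h.hecke p) P P' (m + n)
        (Reflection.cat m (fun i => x * content S q ν i) fun i => y * content S q ν' i) *
      (idemAt q (fun i => σ (p + i)) 0 ν m * idemAt q (fun i => σ (p + i)) m ν' n) *
      (h.reflection ξ p).prod (m + n)
        (Reflection.cat m (fun i => x * content S q ν i) fun i => y * content S q ν' i)) =
    TraceFrame.crossScalar P P' m n (fun i => x * content S q ν i) (fun i => y * content S q ν' i) •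
      (dualTransfer h ξ p F P P' ν m x * dualTransfer h ξ p F P P' ν' n y) := by
  have hs := isHecke_at h.hecke p
  rw [dualProd_cat, Reflection.prod_cat]
  have hsL : ∀ k i, i + 1 < k → σ (p + i) ∈ F.L k := fun k i hi => F.s_mem' (by omega)
  have hscyc : ∀ i, i + 1 < m + n → σ (p + i) ∈ F.cyc (m + n) := fun i hi => F.s_mem_cyc hi
  have hC : Absorb (idemAt q (fun i => σ (p + i)) m ν' n)
      ((h.reflection ξ p).crossing m n (fun i => x * content S q ν i) fun i => y * content S q ν' i)
      (idemAt q (fun i => σ (p + i)) 0 ν' n) :=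
    idemAt_mul_crossBlock (s := fun i => σ (p + i)) hs hq hy.std htf fun j => by
      rw [← mul_assoc]; exact hyx.mul_content j
  have hW := idemAt_mul_dualBlock (s := fun i => σ (p + i)) (m := m) hs hq hy.std P P'
    (fun i => x * content S q ν i) y
  have hB := hy.absorb_prod h hq htf
  have hD := hy.absorb_dualProd hs hq P P'
  have c1 := commute_idemAt_dualProd (ν := ν') (n := n) hs P P' le_rfl (m := m)
    fun i => x * content S q ν i
  have c2 := h.commute_idemAt_prod (ν := ν') (n := n) ξ p le_rfl (m := m)
    fun i => x * content S q ν i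
  have c3 : Commute (idemAt q (fun i => σ (p + i)) 0 ν m) (idemAt q (fun i => σ (p + i)) m ν' n) :=
    commute_idemAt_idemAt hs (by omega)
  have mDu : dualProd hs P P' m (fun i => x * content S q ν i) ∈ F.L m :=
    dualProd_mem hs P P' (fun i hi => hsL m i hi) _
  have mDv : dualProd hs P P' n (fun i => y * content S q ν' i) ∈ F.L n :=
    dualProd_mem hs P P' (fun i hi => hsL n i hi) _
  have mBu := hx.prod_mem h
  have mBv := hy.prod_mem h
  have mE : idemAt q (fun i => σ (p + i)) 0 ν m ∈ F.L m :=
    idemAt_mem fun i _ hi => hsL _ _ (by omega)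
  have mE' : idemAt q (fun i => σ (p + i)) 0 ν' n ∈ F.L n :=
    idemAt_mem fun i _ hi => hsL _ _ (by omega)
  have mEm : idemAt q (fun i => σ (p + i)) m ν' n ∈ F.L (m + n) :=
    idemAt_mem fun i _ hi => hsL _ _ (by omega)
  have mFl : flipAt q (fun i => σ (p + i)) 0 ν' n ∈ F.cyc (m + n) :=
    flipAt_mem fun i _ hi => hscyc _ (by omega)
  have mC : ((h.reflection ξ p).crossing m n (fun i => x * content S q ν i)
      fun i => y * content S q ν' i) ∈ F.L (m + n) :=
    up_mem fun k hk => up_mem fun j hj => TraceFrame.bax_mem (hsL _ (k + (m - 1 - j)) (by omega)) _ _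
  have mW : dualBlock q (fun i => σ (p + i)) P P' m n (fun i => x * content S q ν i)
      (fun i => y * content S q ν' i) ∈ F.L (m + n) :=
    down_mem fun k hk => down_mem fun j hj => TraceFrame.bax_mem (hsL _ _ (by omega)) _ _
  have hblock : F.traces n m _ = _ := F.traces_block (P := P) (P' := P') hP m n
    (fun i => x * content S q ν i) (fun i => y * content S q ν' i)
    (mul_mem (mul_mem mDu mE) mBu)
  have e0 : crossBlock q (fun i => σ (p + i)) m n (fun i => x * content S q ν i)
      (fun i => y * content S q ν' i) = (h.reflection ξ p).crossing m n
      (fun i => x * content S q ν i) fun i => y * content S q ν' i := rfl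
  rw [e0] at hblock
  have ct : ∀ t ∈ F.L 0, Commute t (dualProd hs P P' n fun i => y * content S q ν' i) :=
    fun t ht => commute_dualProd hs P P' (fun i _ => F.comm 0 i (Nat.zero_le i) t ht) _
  rw [dualTransfer, dualTransfer, ← idemAt_zero fun i => σ (p + i), ← idemAt_zero fun i => σ (p + i)]
  have mL0 : ∀ {k} {a : A}, k ≤ m + n → a ∈ F.L k → a ∈ F.L (m + n) := fun hk ha => F.mono' hk ha
  set Du := dualProd hs P P' m fun i => x * content S q ν i
  set Dv := dualProd hs P P' n fun i => y * content S q ν' i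
  set Bu := (h.reflection ξ p).prod m fun i => x * content S q ν i
  set Bv := (h.reflection ξ p).prod n fun i => y * content S q ν' i
  set C := (h.reflection ξ p).crossing m n (fun i => x * content S q ν i)
    fun i => y * content S q ν' i
  set W := dualBlock q (fun i => σ (p + i)) P P' m n (fun i => x * content S q ν i) fun i => y * content S q ν' i
  set E := idemAt q (fun i => σ (p + i)) 0 ν m
  set E' := idemAt q (fun i => σ (p + i)) 0 ν' n
  set Em := idemAt q (fun i => σ (p + i)) m ν' n
  set Fl := flipAt q (fun i => σ (p + i)) 0 ν' n
  have mDu' := mL0 (by omega) mDu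
  have mDv' := mL0 (by omega) mDv
  have mBu' := mL0 (by omega) mBu
  have mBv' := mL0 (by omega) mBv
  have mE0 := mL0 (by omega) mE
  have mE0' := mL0 (by omega) mE'
  unfold Absorb at hC hB hD
  -- The reversed idempotent produced by `Bv` travels around the trace to `Dv`, recreates `E'`
  -- behind it, and `W` carries this to the strands of `Em`. So `Em` is redundant and only `E'` in
  -- front of `Bv` remains.
  have key : F.traces 0 (m + n) (Dv * W * Du * (E * Em) * (Bu * C * Bv)) =
      F.traces 0 (m + n) (Dv * ((W * (Du * E * Bu) * C) * (E' * Bv))) := by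
    have s1 : Dv * W * Du * (E * Em) * (Bu * C * Bv) =
        Dv * W * (Du * E * Bu) * Em * C * E' * Bv * Fl := by
      calc Dv * W * Du * (E * Em) * (Bu * C * Bv)
          = Dv * W * Du * E * (Em * Bu) * C * Bv := by simp only [mul_assoc]
        _ = Dv * W * Du * E * Bu * (Em * C) * Bv := by rw [c2.eq]; simp only [mul_assoc]
        _ = Dv * W * Du * E * Bu * Em * C * (E' * Bv) := by rw [hC]; simp only [mul_assoc]
        _ = _ := by rw [hB]; simp only [mul_assoc]
    have cL : (Du * E * Bu) * Em = Em * (Du * E * Bu) := by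
      have := (c1.mul_right c3.symm).mul_right c2
      exact this.eq.symm
    have s2 : Fl * (Dv * W * (Du * E * Bu) * Em * C * E' * Bv) =
        Fl * (Dv * W * (Du * E * Bu) * C * E' * Bv) := by
      calc Fl * (Dv * W * (Du * E * Bu) * Em * C * E' * Bv)
          = (Fl * Dv) * W * ((Du * E * Bu) * Em) * C * E' * Bv := by simp only [mul_assoc]
        _ = Fl * Dv * E' * W * (Em * (Du * E * Bu)) * C * E' * Bv := by rw [cL, ← hD]
        _ = Fl * Dv * (E' * W * Em) * (Du * E * Bu) * C * E' * Bv := by simp only [mul_assoc]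
        _ = Fl * Dv * E' * W * (Du * E * Bu) * C * E' * Bv := by rw [← hW]; simp only [mul_assoc]
        _ = _ := by rw [← hD]; simp only [mul_assoc]
    have m1 : Dv * W * (Du * E * Bu) * Em * C * E' * Bv ∈ F.L (m + n) := by
      repeat' (first | assumption | apply mul_mem)
    have m2 : Dv * W * (Du * E * Bu) * C * E' * Bv ∈ F.L (m + n) := by
      repeat' (first | assumption | apply mul_mem)
    rw [s1, ← F.traces_cyc mFl m1, s2, F.traces_cyc mFl m2]
    congr 1
    calc Dv * W * (Du * E * Bu) * C * E' * Bv * Fl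
        = Dv * W * (Du * E * Bu) * C * (E' * Bv * Fl) := by simp only [mul_assoc]
      _ = _ := by rw [← hB]; simp only [mul_assoc]
  have mt : F.traces 0 m (Du * E * Bu) ∈ F.L 0 :=
    F.traces_mem (by rw [Nat.zero_add]; exact mul_mem (mul_mem mDu mE) mBu)
  have mWC : W * (Du * E * Bu) * C ∈ F.L (n + m) := by
    rw [add_comm n m]
    repeat' (first | assumption | apply mul_mem)
  have mEB : E' * Bv ∈ F.L n := mul_mem mE' mBv
  -- The enclosed partial trace becomes a scalar times an element of `L 0`, which commutes with the
  -- generators in `Dv` and can be taken out on the left.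
  rw [key, add_comm m n, F.traces_add, Nat.zero_add,
    F.traces_left mDv (mul_mem mWC (F.mono' (by omega) mEB)), F.traces_right mEB mWC, hblock,
    smul_mul_assoc, mul_smul_comm, map_smul, ← mul_assoc, ← (ct _ mt).eq, mul_assoc,
    F.traces_left mt (by rw [Nat.zero_add]; exact mul_mem mDv mEB), mul_assoc Dv]

end Frame

/-! ### Exchange of the blocks and removal of the dual operator -/

section Exchange

variable {S A : Type*} [CommRing S] [Algebra ℂ S] [Ring A] [Algebra S A] [Algebra ℂ A]
  [IsScalarTower ℂ S A] {q : ℂ} {s σ : ℕ → A} {τ : A} {ν ν' : ℕ → ℕ × ℕ} {m n : ℕ}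

/-- The scalar by which two exchanges of blocks cancel. -/
def swapScalar (q : ℂ) (m n : ℕ) (u v : ℕ → S) : S :=
  ∏ j ∈ Finset.range n, ∏ k ∈ Finset.range m,
    ((algebraMap ℂ S (lam q)) ^ 2 * v j * u k - (u k - v j) ^ 2)

theorem swapScalar_comm (q : ℂ) (m n : ℕ) (u v : ℕ → S) :
    swapScalar q n m v u = swapScalar q m n u v := by
  rw [swapScalar, swapScalar, Finset.prod_comm]
  refine Finset.prod_congr rfl fun j _ => Finset.prod_congr rfl fun k _ => ?_
  ring

theorem crossScalar_comm (P P' : S) (m n : ℕ) (u v : ℕ → S) :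
    TraceFrame.crossScalar P P' n m v u = TraceFrame.crossScalar P P' m n u v := by
  rw [TraceFrame.crossScalar, TraceFrame.crossScalar, Finset.prod_comm]
  refine Finset.prod_congr rfl fun j _ => Finset.prod_congr rfl fun k _ => ?_
  rw [mul_comm (u _)]

variable [IsDomain S] {ξ : S} {p : ℕ} {F : TraceFrame S q fun i => σ (p + i)} {x y P P' : S}

theorem absorb_swapBlock (hs : ∀ N, IsHecke q N s) (hq : Generic q) (htf : TorsionFree S A)
    (hν : IsStandard ν m) (hν' : IsStandard ν' n) (hyx : Indep y x) :
    Absorb (idemAt q s 0 ν' n * idemAt q s n ν m)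
      (swapBlock q s m n (fun i => x * content S q ν i) fun i => y * content S q ν' i)
      (idemAt q s 0 ν m * idemAt q s m ν' n) := by
  have h1 : Absorb (idemAt q s n ν m) _ _ := idemAt_mul_swapBlock_rows hs hq hν htf (n := n)
    (x := x) (v := fun i => y * content S q ν' i) fun k c hc => by
      refine hyx (c * (qContent q (ν' k))⁻¹) ?_
      have e : algebraMap ℂ S (qContent q (ν' k)) * algebraMap ℂ S (qContent q (ν' k))⁻¹ = 1 := by
        rw [← map_mul, mul_inv_cancel₀ (hq.qContent_ne_zero _), map_one]
      rw [map_mul, ← mul_assoc, ← hc, mul_assoc, e, mul_one]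
  have h2 : Absorb (idemAt q s 0 ν' n) _ _ := idemAt_mul_swapBlock_columns hs hq hν' (m := m)
    (fun i => x * content S q ν i) y
  have := h1.mul h2 (commute_idemAt_idemAt hs (by omega)).symm
  rwa [(commute_idemAt_idemAt hs (k := 0) (l := n) (by omega)).eq]

theorem Fusible.absorb_prod_cat (hx : Fusible τ ξ p F ν m x) (hy : Fusible τ ξ p F ν' n y)
    (h : IsAffine q σ τ) (hq : Generic q) (htf : TorsionFree S A) (hxy : Indep 1 (x * y)) :
    Absorb (idemAt q (fun i => σ (p + i)) 0 ν m * idemAt q (fun i => σ (p + i)) m ν' n)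
      ((h.reflection ξ p).prod (m + n)
        (Reflection.cat m (fun i => x * content S q ν i) fun i => y * content S q ν' i))
      (flipAt q (fun i => σ (p + i)) 0 ν' n * flipAt q (fun i => σ (p + i)) n ν m) := by
  have hs := isHecke_at h.hecke p
  rw [Reflection.prod_cat]
  have a1 := (hx.absorb_prod h hq htf).mul (Absorb.of_commute (idemAt_sq hs hq m hy.std)
    (h.commute_idemAt_prod ξ p le_rfl _)) (commute_idemAt_idemAt hs (by omega))
  have b1 : Absorb (flipAt q (fun i => σ (p + i)) 0 ν m) ((h.reflection ξ p).crossing m n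
      (fun i => x * content S q ν i) fun i => y * content S q ν' i)
      (flipAt q (fun i => σ (p + i)) n ν m) :=
    flipAt_mul_crossBlock (s := fun i => σ (p + i)) hs hq hx.std htf fun k => by
      rw [← mul_assoc]; exact hxy.mul_content k
  have b2 : Absorb (idemAt q (fun i => σ (p + i)) m ν' n) ((h.reflection ξ p).crossing m n
      (fun i => x * content S q ν i) fun i => y * content S q ν' i)
      (idemAt q (fun i => σ (p + i)) 0 ν' n) :=
    idemAt_mul_crossBlock (s := fun i => σ (p + i)) hs hq hy.std htf fun k => by
      rw [← mul_assoc, mul_comm y x]; exact hxy.mul_content k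
  have a2 := b1.mul b2 (commute_flipAt_idemAt hs (by omega))
  have a3 := (Absorb.of_commute (flipAt_sq hs hq n hx.std)
    (h.commute_flipAt_prod ξ p le_rfl fun i => y * content S q ν' i)).mul
      (hy.absorb_prod h hq htf) (commute_idemAt_flipAt hs (by omega)).symm
  have := (a1.trans a2).trans a3
  rwa [← (commute_flipAt_flipAt hs (k := 0) (l := n) (by omega)).eq] at this

theorem Fusible.absorb_dualProd_cat (hx : Fusible τ ξ p F ν m x) (hy : Fusible τ ξ p F ν' n y)
    (hs : ∀ N, IsHecke q N s) (hq : Generic q) (P P' : S) :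
    Absorb (flipAt q s 0 ν' n * flipAt q s n ν m)
      (dualProd hs P P' (m + n)
        (Reflection.cat m (fun i => x * content S q ν i) fun i => y * content S q ν' i))
      (idemAt q s 0 ν m * idemAt q s m ν' n) := by
  rw [dualProd_cat]
  have a1 := (hy.absorb_dualProd hs hq P P').mul (Absorb.of_commute (flipAt_sq hs hq n hx.std)
    (commute_flipAt_dualProd hs P P' le_rfl _)) (commute_flipAt_flipAt hs (by omega))
  have b1 : Absorb (idemAt q s 0 ν' n) (dualBlock q s P P' m n
      (fun i => x * content S q ν i) fun i => y * content S q ν' i) (idemAt q s m ν' n) :=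
    idemAt_mul_dualBlock hs hq hy.std P P' _ y
  have b2 : Absorb (flipAt q s n ν m) (dualBlock q s P P' m n
      (fun i => x * content S q ν i) fun i => y * content S q ν' i) (flipAt q s 0 ν m) :=
    flipAt_mul_dualBlock hs hq hx.std P P' _ x
  have a2 := b1.mul b2 (commute_idemAt_flipAt hs (by omega))
  have a3 := (Absorb.of_commute (idemAt_sq hs hq m hy.std)
    (commute_idemAt_dualProd hs P P' le_rfl fun i => x * content S q ν i)).mul
      (hx.absorb_dualProd hs hq P P') (commute_flipAt_idemAt hs (by omega)).symm
  have := (a1.trans a2).trans a3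
  rwa [← (commute_idemAt_idemAt hs (k := 0) (l := m) (by omega)).eq] at this

/-- The scalar is the product of the two opposite exchange operators. One of them exchanges the
blocks of the boundary operator, leaves it with reversed strands, moves cyclically to the dual
operator and exchanges the blocks there. Repeated idempotents let the two operators meet again, and
they give back the same scalar. -/
theorem traces_swap (hx : Fusible τ ξ p F ν m x) (hy : Fusible τ ξ p F ν' n y)
    (h : IsAffine q σ τ) (hq : Generic q) (htf : TorsionFree S A) (hyx' : Indep 1 (y * x))
    (hyx : Indep y x) (hxy : Indep x y) (P P' : S) :
    swapScalar q m n (fun i => x * content S q ν i) (fun i => y * content S q ν' i) •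
    F.traces 0 (m + n) (dualProd (isHecke_at h.hecke p) P P' (m + n)
        (Reflection.cat m (fun i => x * content S q ν i) fun i => y * content S q ν' i) *
      (idemAt q (fun i => σ (p + i)) 0 ν m * idemAt q (fun i => σ (p + i)) m ν' n) *
      (h.reflection ξ p).prod (m + n)
        (Reflection.cat m (fun i => x * content S q ν i) fun i => y * content S q ν' i)) =
    swapScalar q m n (fun i => x * content S q ν i) (fun i => y * content S q ν' i) •
    F.traces 0 (m + n) (dualProd (isHecke_at h.hecke p) P P' (m + n)
        (Reflection.cat n (fun i => y * content S q ν' i) fun i => x * content S q ν i) *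
      (idemAt q (fun i => σ (p + i)) 0 ν' n * idemAt q (fun i => σ (p + i)) n ν m) *
      (h.reflection ξ p).prod (m + n)
        (Reflection.cat n (fun i => y * content S q ν' i) fun i => x * content S q ν i)) := by
  have hs := isHecke_at h.hecke p
  have hsL : ∀ i, i + 1 < m + n → σ (p + i) ∈ F.L (m + n) := fun i hi => F.s_mem' (by omega)
  have hscyc : ∀ i, i + 1 < m + n → σ (p + i) ∈ F.cyc (m + n) := fun i hi => F.s_mem_cyc hi
  have r1 := swapBlock_mul_swapBlock hs m n (fun i => x * content S q ν i)
    (fun i => y * content S q ν' i)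
  have r2 := swapBlock_mul_swapBlock hs n m (fun i => y * content S q ν' i)
    (fun i => x * content S q ν i)
  rw [← swapScalar] at r1 r2
  rw [swapScalar_comm] at r2
  have hR : Absorb _ _ _ := absorb_swapBlock hs hq htf hx.std hy.std hyx
  have hR' : Absorb _ _ _ := absorb_swapBlock hs hq htf hy.std hx.std hxy
  have hB := hy.absorb_prod_cat hx h hq htf hyx'
  have hD := hy.absorb_dualProd_cat hx hs hq P P'
  have xB : swapBlock q (fun i => σ (p + i)) m n (fun i => x * content S q ν i)
      (fun i => y * content S q ν' i) * _ = _ * swapBlockRev q (fun i => σ (p + i)) m n _ _ :=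
    (h.reflection ξ p).exchange_mul_prod (fun i => x * content S q ν i)
    (fun i => y * content S q ν' i) m n
  have xD := dualProd_mul_swapBlock hs P P' m n (fun i => x * content S q ν i)
    (fun i => y * content S q ν' i)
  rw [add_comm n m] at hB hD
  have mB := hx.prod_cat_mem hy h
  have mB' := hy.prod_cat_mem hx h
  rw [add_comm n m] at mB'
  have mD : ∀ u, dualProd hs P P' (m + n) u ∈ F.L (m + n) := fun u => dualProd_mem hs P P' hsL u
  have mD1 := mD (Reflection.cat m (fun i => x * content S q ν i) fun i => y * content S q ν' i)
  have mD2 := mD (Reflection.cat n (fun i => y * content S q ν' i) fun i => x * content S q ν i)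
  have mI : ∀ k μ l, k + l ≤ m + n → idemAt q (fun i => σ (p + i)) k μ l ∈ F.L (m + n) :=
    fun k μ l hk => idemAt_mem fun i _ hi => hsL _ (by omega)
  have mE : idemAt q (fun i => σ (p + i)) 0 ν m * idemAt q (fun i => σ (p + i)) m ν' n ∈
      F.L (m + n) := mul_mem (mI _ _ _ (by omega)) (mI _ _ _ (by omega))
  have mE' : idemAt q (fun i => σ (p + i)) 0 ν' n * idemAt q (fun i => σ (p + i)) n ν m ∈
      F.L (m + n) := mul_mem (mI _ _ _ (by omega)) (mI _ _ _ (by omega))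
  have mJ : ∀ k μ l, k + l ≤ m + n → flipAt q (fun i => σ (p + i)) k μ l ∈ F.cyc (m + n) :=
    fun k μ l hk => flipAt_mem fun i _ hi => hscyc _ (by omega)
  have mF : flipAt q (fun i => σ (p + i)) 0 ν m * flipAt q (fun i => σ (p + i)) m ν' n ∈
      F.cyc (m + n) := mul_mem (mJ _ _ _ (by omega)) (mJ _ _ _ (by omega))
  have mRf : swapBlockRev q (fun i => σ (p + i)) m n (fun i => x * content S q ν i)
      (fun i => y * content S q ν' i) ∈ F.cyc (m + n) :=
    down_mem fun k hk => up_mem fun j hj => TraceFrame.bax_mem (hscyc _ (by omega)) _ _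
  have mR : ∀ (k l : ℕ) (u v : ℕ → S), k + l = m + n →
      swapBlock q (fun i => σ (p + i)) k l u v ∈ F.L (m + n) := fun k l u v hkl =>
    down_mem fun k hk => up_mem fun j hj => TraceFrame.bax_mem (hsL _ (by omega)) _ _
  have mR1 := mR m n (fun i => x * content S q ν i) (fun i => y * content S q ν' i) rfl
  have mR2 := mR n m (fun i => y * content S q ν' i) (fun i => x * content S q ν i)
    (add_comm n m)
  have sqE' : (idemAt q (fun i => σ (p + i)) 0 ν' n * idemAt q (fun i => σ (p + i)) n ν m) *
      (idemAt q (fun i => σ (p + i)) 0 ν' n * idemAt q (fun i => σ (p + i)) n ν m) =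
      idemAt q (fun i => σ (p + i)) 0 ν' n * idemAt q (fun i => σ (p + i)) n ν m := by
    have c : Commute (idemAt q (fun i => σ (p + i)) 0 ν' n) (idemAt q (fun i => σ (p + i)) n ν m) :=
      commute_idemAt_idemAt hs (by omega)
    rw [c.symm.mul_mul_mul_comm, idemAt_sq hs hq _ hx.std, idemAt_sq hs hq _ hy.std]
  unfold Absorb at hR hR' hB hD
  set R := swapBlock q (fun i => σ (p + i)) m n (fun i => x * content S q ν i)
      (fun i => y * content S q ν' i)
  set R' := swapBlock q (fun i => σ (p + i)) n m (fun i => y * content S q ν' i)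
      (fun i => x * content S q ν i)
  set Rf := swapBlockRev q (fun i => σ (p + i)) m n (fun i => x * content S q ν i)
      (fun i => y * content S q ν' i)
  set r := swapScalar q m n (fun i => x * content S q ν i) (fun i => y * content S q ν' i)
  set D := dualProd hs P P' (m + n)
    (Reflection.cat m (fun i => x * content S q ν i) fun i => y * content S q ν' i)
  set D' := dualProd hs P P' (m + n)
    (Reflection.cat n (fun i => y * content S q ν' i) fun i => x * content S q ν i)
  set B := (h.reflection ξ p).prod (m + n)
    (Reflection.cat m (fun i => x * content S q ν i) fun i => y * content S q ν' i)
  set B' := (h.reflection ξ p).prod (m + n)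
    (Reflection.cat n (fun i => y * content S q ν' i) fun i => x * content S q ν i)
  set E := idemAt q (fun i => σ (p + i)) 0 ν m * idemAt q (fun i => σ (p + i)) m ν' n
  set E' := idemAt q (fun i => σ (p + i)) 0 ν' n * idemAt q (fun i => σ (p + i)) n ν m
  set G := flipAt q (fun i => σ (p + i)) 0 ν m * flipAt q (fun i => σ (p + i)) m ν' n
  have s1 : r • (D * E * B) = D * E * R' * E' * B' * Rf := by
    calc r • (D * E * B) = D * E * (r • (1 : A)) * B := by
          rw [mul_smul_comm, mul_one, smul_mul_assoc]
      _ = D * (E * R') * R * B := by rw [← r1]; simp only [mul_assoc]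
      _ = D * (E * R' * E') * R * B := by rw [← hR']
      _ = D * E * R' * E' * (R * B) := by simp only [mul_assoc]
      _ = _ := by rw [xB]; simp only [mul_assoc]
  have s2 : Rf * (D * E * R' * E' * B') = D' * R * E * R' * E' * B' * G := by
    calc Rf * (D * E * R' * E' * B') = (Rf * D) * E * R' * (E' * B') := by simp only [mul_assoc]
      _ = D' * R * E * R' * (E' * B' * G) := by rw [← xD, ← hB]
      _ = _ := by simp only [mul_assoc]
  have s3 : G * (D' * R * E * R' * E' * B') = r • (G * (D' * E' * B')) := by
    calc G * (D' * R * E * R' * E' * B') = G * D' * R * E * R' * E' * B' := by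
          simp only [mul_assoc]
      _ = G * D' * E' * R * E * R' * E' * B' := by rw [← hD]
      _ = G * D' * (E' * R * E) * R' * E' * B' := by simp only [mul_assoc]
      _ = G * D' * E' * (R * R') * E' * B' := by rw [← hR]; simp only [mul_assoc]
      _ = r • (G * D' * (E' * E') * B') := by
        rw [r2]; simp only [mul_smul_comm, smul_mul_assoc, mul_one, mul_assoc]
      _ = _ := by rw [sqE']; simp only [mul_assoc]
  have s4 : D' * E' * B' * G = D' * E' * B' := by
    rw [mul_assoc D', mul_assoc D', ← hB]
  have m1 : D * E * R' * E' * B' ∈ F.L (m + n) := by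
    repeat' (first | assumption | apply mul_mem)
  have m2 : D' * R * E * R' * E' * B' ∈ F.L (m + n) := by
    repeat' (first | assumption | apply mul_mem)
  have m3 : D' * E' * B' ∈ F.L (m + n) := by
    repeat' (first | assumption | apply mul_mem)
  rw [← map_smul, s1, ← F.traces_cyc mRf m1, s2, ← F.traces_cyc mF m2, s3, map_smul,
    F.traces_cyc mF m3, s4]

/-- The transfer matrices with the dual boundary operator commute, up to a scalar. -/
theorem dualTransfer_comm (hx : Fusible τ ξ p F ν m x) (hy : Fusible τ ξ p F ν' n y)
    (h : IsAffine q σ τ) (hq : Generic q) (htf : TorsionFree S A) (hyx' : Indep 1 (y * x))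
    (hyx : Indep y x) (hxy : Indep x y)
    (hP : algebraMap ℂ S F.Qp * P' = P * algebraMap ℂ S (F.Qp - lam q * F.Q0)) :
    (swapScalar q m n (fun i => x * content S q ν i) (fun i => y * content S q ν' i) *
      TraceFrame.crossScalar P P' m n (fun i => x * content S q ν i)
        fun i => y * content S q ν' i) •
      (dualTransfer h ξ p F P P' ν m x * dualTransfer h ξ p F P P' ν' n y) =
    (swapScalar q m n (fun i => x * content S q ν i) (fun i => y * content S q ν' i) *
      TraceFrame.crossScalar P P' m n (fun i => x * content S q ν i)
        fun i => y * content S q ν' i) •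
      (dualTransfer h ξ p F P P' ν' n y * dualTransfer h ξ p F P P' ν m x) := by
  have key := traces_swap hx hy h hq htf hyx' hyx hxy P P'
  rw [traces_cat hx hy h hq htf hyx' hP] at key
  have e := traces_cat hy hx h hq htf (by rwa [mul_comm]) hP
  rw [add_comm n m, crossScalar_comm] at e
  rw [e, smul_smul, smul_smul] at key
  exact key

/-- On the reversed idempotent the dual operator is a scalar times the reversal O, so its trace is a
multiple of the trace of O E B. Primitivity gives E O⁻¹ E = c E, which makes the trace of E B equal
to c times that same trace. The number c may vanish; nothing is divided by it. -/
theorem dualTransfer_smul (hx : Fusible τ ξ p F ν m x) (h : IsAffine q σ τ) (hq : Generic q)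
    (htf : TorsionFree S A) (P P' : S) : ∃ c : ℂ,
    dualScalar q ν P P' x m • transfer h ξ p F ν m x = c • dualTransfer h ξ p F P P' ν m x := by
  have hs := isHecke_at h.hecke p
  have hB := hx.absorb_prod h hq htf
  have hD := flipAt_mul_dualProd hs hq hx.std P P' x
  have hO := flipAt_mul_reversal hs (ν := ν) (m := m)
  obtain ⟨O', hO', h1, h2⟩ := reversal_inv hs m
  obtain ⟨c, hc⟩ := (hs m).primitive hq (by omega) hx.std hO'
  have hsL : ∀ i, i + 1 < m → σ (p + i) ∈ F.L m := fun i hi => F.s_mem' (by omega)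
  have hscyc : ∀ i, i + 1 < m → σ (p + i) ∈ F.cyc m := fun i hi => F.s_mem_cyc hi
  have mFl : flipAt q (fun i => σ (p + i)) 0 ν m ∈ F.cyc m :=
    flipAt_mem fun i _ hi => hscyc _ (by omega)
  have mE : idem q (fun i => σ (p + i)) ν m ∈ F.cyc m := by
    rw [← idemAt_zero fun i => σ (p + i)]
    exact idemAt_mem fun i _ hi => hscyc _ (by omega)
  have mO' : O' ∈ F.cyc m := TraceFrame.strands_at_le (s := fun i => σ (p + i)) (k := 0) (m := m)
    (fun i _ hi => hscyc _ (by omega)) (by simpa only [Nat.zero_add] using hO')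
  have mO : reversal hs m ∈ F.cyc m := by
    have : ∀ l ≤ m, reversal hs l ∈ F.cyc m := by
      intro l hl
      induction l with
      | zero => exact one_mem _
      | succ l ih =>
        rw [reversal_succ, cycle]
        refine mul_mem (down_mem fun j hj => ?_) (ih (by omega))
        rw [hinv, ← algebraMap_smul S]
        exact sub_mem (hscyc (0 + (l + 1 - 2 - j)) (by omega)) ((F.cyc m).smul_mem (one_mem _) _)
    exact this m le_rfl
  have mB := hx.prod_mem h
  have mD : dualProd hs P P' m (fun i => x * content S q ν i) ∈ F.L m :=
    dualProd_mem hs P P' hsL _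
  have hE := (hs m).idem_sq hq (by omega) hx.std
  refine ⟨c, ?_⟩
  rw [transfer, dualTransfer]
  rw [idemAt_zero fun i => σ (p + i)] at hB
  unfold Absorb at hB
  set B := (h.reflection ξ p).prod m fun i => x * content S q ν i
  set D := dualProd hs P P' m fun i => x * content S q ν i
  set E := idem q (fun i => σ (p + i)) ν m
  set G := flipAt q (fun i => σ (p + i)) 0 ν m
  set O := reversal hs m
  set d := dualScalar q ν P P' x m
  have t1 : F.traces 0 m (D * E * B) = d • F.traces 0 m (O * (E * B)) := by
    have : G * (D * E * B) = d • (O * (E * B)) := by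
      rw [← mul_assoc, ← mul_assoc, hD, hO, smul_mul_assoc, smul_mul_assoc, mul_assoc O, hE,
        mul_assoc]
    rw [← map_smul, ← this, F.traces_cyc mFl (mul_mem (mul_mem mD mE.1) mB), mul_assoc, mul_assoc,
      ← hB]
  have hG : G = O * E * O' := by rw [← hO, mul_assoc, h1, mul_one]
  have t2 : F.traces 0 m (E * B) = c • F.traces 0 m (O * (E * B)) := by
    have e1 : E * B = E * B * (O * E) * O' := by
      rw [mul_assoc _ _ O', ← hG]; exact hB
    have e2 : E * O' * (E * B * O) = c • (E * B * O) := by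
      rw [← mul_assoc, ← mul_assoc, hc, smul_mul_assoc, smul_mul_assoc]
    have e3 : O' * (E * B * (O * E)) = O' * (E * B * O) * E := by simp only [mul_assoc]
    have m0 : E * B * (O * E) ∈ F.L m := mul_mem (mul_mem mE.1 mB) (mul_mem mO.1 mE.1)
    have m1 : O' * (E * B * O) ∈ F.L m := mul_mem mO'.1 (mul_mem (mul_mem mE.1 mB) mO.1)
    rw [e1, ← F.traces_cyc mO' m0, e3, ← F.traces_cyc mE m1, ← mul_assoc E O', e2,
      ← algebraMap_smul S c, map_smul, ← F.traces_cyc mO (mul_mem mE.1 mB), algebraMap_smul, ← e1]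
  rw [t1, t2, ← algebraMap_smul S c, ← algebraMap_smul S c, smul_comm]

/-- An equation of degree one with complex coefficients, not both zero, would make z a complex
number, contrary to independence, or zero. -/
theorem affine_ne_zero {a b c : ℂ} (hab : a ≠ 0 ∨ b ≠ 0) (hc : c ≠ 0) {z : S} (hz : z ≠ 0)
    (hi : Indep 1 z) : algebraMap ℂ S b * (z * algebraMap ℂ S c) - algebraMap ℂ S a ≠ 0 := by
  intro h0
  by_cases ha : a = 0
  · subst ha
    have hb := hab.resolve_left (not_not.mpr rfl)
    rw [map_zero, sub_zero, mul_eq_zero, mul_eq_zero, map_eq_zero, map_eq_zero] at h0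
    tauto
  · refine hi (b * c / a) ?_
    have e : algebraMap ℂ S a * algebraMap ℂ S (a⁻¹) = 1 := by
      rw [← map_mul, mul_inv_cancel₀ ha, map_one]
    rw [div_eq_mul_inv, map_mul, map_mul]
    linear_combination (-algebraMap ℂ S a⁻¹) * h0 - e

/-- The transfer matrices commute for generic parameters. -/
theorem transfer_comm (hx : Fusible τ ξ p F ν m x) (hy : Fusible τ ξ p F ν' n y)
    (h : IsAffine q σ τ) (hq : Generic q) (htf : TorsionFree S A) (hyx' : Indep 1 (y * x))
    (hxy : Indep x y) (hyx : Indep y x) :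
    transfer h ξ p F ν m x * transfer h ξ p F ν' n y =
      transfer h ξ p F ν' n y * transfer h ξ p F ν m x := by
  -- A nonzero pair (P, P') for the crossing relation exists for all trace constants. Being complex
  -- numbers, its members cannot cancel generic parameters.
  obtain ⟨a, b, hab, hP⟩ : ∃ a b : ℂ, (a ≠ 0 ∨ b ≠ 0) ∧ F.Qp * b = a * (F.Qp - lam q * F.Q0) := by
    by_cases h0 : F.Qp = 0 ∧ F.Qp - lam q * F.Q0 = 0
    · exact ⟨1, 0, Or.inl one_ne_zero, by rw [h0.2, mul_zero, mul_zero]⟩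
    · exact ⟨F.Qp, F.Qp - lam q * F.Q0, by tauto, rfl⟩
  have hP := congrArg (algebraMap ℂ S) hP
  rw [map_mul, map_mul] at hP
  have key := dualTransfer_comm hx hy h hq htf hyx' hyx hxy hP
  have hc := hq.qContent_ne_zero
  have hd : ∀ {μ : ℕ → ℕ × ℕ} {l : ℕ} {w : S}, Fusible τ ξ p F μ l w →
      dualScalar q μ (algebraMap ℂ S a) (algebraMap ℂ S b) w l ≠ 0 := by
    intro μ l w hw
    refine Finset.prod_ne_zero_iff.mpr fun i _ => Finset.prod_ne_zero_iff.mpr fun k _ => ?_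
    have := affine_ne_zero (c := qContent q (μ i) * qContent q (μ (k + 1))) hab
      (mul_ne_zero (hc _) (hc _)) (mul_ne_zero hw.ne_zero hw.ne_zero) hw.indep
    rw [map_mul] at this
    convert this using 1
    ring
  have hr : swapScalar q m n (fun i => x * content S q ν i) (fun i => y * content S q ν' i) ≠ 0 := by
    refine Finset.prod_ne_zero_iff.mpr fun j _ => Finset.prod_ne_zero_iff.mpr fun k _ => ?_
    rw [bax_norm hq.ne_zero, neg_ne_zero]
    have e : algebraMap ℂ S (qContent q (ν k)) * algebraMap ℂ S (qContent q (ν k))⁻¹ = 1 := by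
      rw [← map_mul, mul_inv_cancel₀ (hc _), map_one]
    refine mul_ne_zero (fun h0 => hxy (q ^ 2 * qContent q (ν' j) * (qContent q (ν k))⁻¹) ?_)
      fun h0 => hxy (q⁻¹ ^ 2 * qContent q (ν' j) * (qContent q (ν k))⁻¹) ?_
    · rw [map_mul, map_mul]
      linear_combination algebraMap ℂ S (qContent q (ν k))⁻¹ * h0 - x * e
    · rw [map_mul, map_mul]
      linear_combination algebraMap ℂ S (qContent q (ν k))⁻¹ * h0 - x * e
  have hk : TraceFrame.crossScalar (algebraMap ℂ S a) (algebraMap ℂ S b) m n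
      (fun i => x * content S q ν i) (fun i => y * content S q ν' i) ≠ 0 := by
    refine Finset.prod_ne_zero_iff.mpr fun k _ => Finset.prod_ne_zero_iff.mpr fun j _ => ?_
    refine mul_ne_zero ?_ fun h0 => hyx' (qContent q (ν' k) * qContent q (ν j)) ?_
    · have := affine_ne_zero (c := qContent q (ν' k) * qContent q (ν j)) hab
        (mul_ne_zero (hc _) (hc _)) (mul_ne_zero hy.ne_zero hx.ne_zero) hyx'
      rw [map_mul] at this
      convert this using 1
      ring
    · rw [map_mul]
      linear_combination h0
  obtain ⟨c, hc1⟩ := dualTransfer_smul hx h hq htf (algebraMap ℂ S a) (algebraMap ℂ S b)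
  obtain ⟨c', hc2⟩ := dualTransfer_smul hy h hq htf (algebraMap ℂ S a) (algebraMap ℂ S b)
  have hD : ∀ {a b : A} {r : S}, r ≠ 0 → r • a = r • b → a = b := fun hr e =>
    sub_eq_zero.mp (htf _ _ hr (by rw [smul_sub, e, sub_self]))
  have key := hD (mul_ne_zero hr hk) key
  refine hD (mul_ne_zero (hd hx) (hd hy)) ?_
  rw [← smul_mul_smul_comm, hc1, hc2, mul_comm (dualScalar q ν _ _ _ _), ← smul_mul_smul_comm,
    hc1, hc2, smul_mul_smul_comm, smul_mul_smul_comm, key, mul_comm c]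

end Exchange

/-! ### Deformation of the parameters -/

section Deformation

open scoped PowerSeries

attribute [local instance] seriesAlgebra

variable {S A : Type*} [CommRing S] [Algebra ℂ S] [Ring A] [Algebra S A] [Algebra ℂ A]
  [IsScalarTower ℂ S A] {q : ℂ} {σ : ℕ → A} {τ : A} {ν ν' : ℕ → ℕ × ℕ} {m n : ℕ}

theorem dressed_mem {T : Subalgebra S A} {p : ℕ} {ξ y : S} (hτ : τ ∈ T) (hσ : ∀ j < p, σ j ∈ T)
    (hi : Ring.inverse (den S τ ξ y) ∈ T) : dressed q σ τ ξ p y ∈ T := by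
  induction p with
  | zero =>
    exact mul_mem (sub_mem (T.smul_mem hτ _) (T.smul_mem (one_mem T) _)) hi
  | succ p ih =>
    have hb := TraceFrame.bax_mem (q := q) (hσ p (by omega)) y 1
    exact mul_mem (mul_mem hb (ih fun j hj => hσ j (by omega))) hb

/-- Comparing one coefficient leaves a single candidate for the proportionality constant. -/
theorem indep_of_coeff (k : ℕ) {a b : S⟦X⟧} (hb : PowerSeries.coeff k b = 1)
    (h : ∀ c : ℂ, algebraMap ℂ S c = PowerSeries.coeff k a → a ≠ b * algebraMap ℂ S⟦X⟧ c) :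
    Indep a b := by
  intro c hc
  refine h c ?_ hc
  have := congrArg (PowerSeries.coeff k) hc
  rw [PowerSeries.algebraMap_apply, PowerSeries.coeff_mul_C, hb, one_mul] at this
  exact this.symm

theorem evalZero_traces (s : ℕ → A) (F : TraceFrame S q s) (a k : ℕ) (Y : A⟦X⟧) :
    evalZero A (F.series.traces a k Y) = F.traces a k (evalZero A Y) := by
  induction k generalizing Y with
  | zero => rfl
  | succ k ih =>
    rw [TraceFrame.traces_succ, TraceFrame.traces_succ, ih]
    congr 1
    rw [evalZero_apply, evalZero_apply, ← PowerSeries.coeff_zero_eq_constantCoeff_apply,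
      ← PowerSeries.coeff_zero_eq_constantCoeff_apply]
    exact coeff_seriesMap (F.tr (a + k)) Y 0

variable {ξ : S} {p : ℕ} {F : TraceFrame S q fun i => σ (p + i)} {x y : S}

theorem evalZero_den (ξ : S) (z : S⟦X⟧) :
    evalZero A (den S⟦X⟧ (constSeries A τ) (constSeries S ξ) z) = den S τ ξ (evalZero S z) := by
  rw [map_den (ψ := evalZero S) evalZero_smul, evalZero_constSeries, evalZero_constSeries]

theorem evalZero_mul_content {z : S⟦X⟧} (hz : evalZero S z = x) (i : ℕ) :
    evalZero S (z * content S⟦X⟧ q ν i) = x * content S q ν i := by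
  rw [map_mul, hz, AlgHom.commutes]

theorem evalZero_transfer (h : IsAffine q σ τ) {z : S⟦X⟧} (hz : evalZero S z = x)
    (hu : ∀ i < m, IsUnit (den S τ ξ (x * content S q ν i))) :
    evalZero A (transfer (h.map (constSeries A)) (constSeries S ξ) p F.series ν m z) =
      transfer h ξ p F ν m x := by
  rw [transfer, transfer, evalZero_traces, map_mul]
  congr 2
  · rw [map_idem]
    simp only [evalZero_constSeries]
  · refine (h.map (constSeries A)).map_prod h (ψ := evalZero S) evalZero_smul
      (fun _ => evalZero_constSeries _) (evalZero_constSeries _) (evalZero_constSeries _) p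
      (fun i _ => evalZero_mul_content hz i) fun i hi => isUnit_of_evalZero ?_
    rw [evalZero_den, evalZero_mul_content hz]
    exact hu i hi

theorem fusible_series (hν : IsStandard ν m) {z : S⟦X⟧} (hz : evalZero S z = x)
    (hz0 : z ≠ 0) (hi : Indep 1 (z * z)) (hτ : τ ∈ F.L 1) (hσ : ∀ j < p, σ j ∈ F.L 1)
    (hu : ∀ i < m, IsUnit (den S τ ξ (x * content S q ν i)))
    (hm : ∀ i < m, Ring.inverse (den S τ ξ (x * content S q ν i)) ∈ F.L 1) :
    Fusible (σ := fun i => constSeries A (σ i)) (constSeries A τ) (constSeries S ξ) p F.series ν m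
      z where
  std := hν
  ne_zero := hz0
  indep := hi
  unit i hi := isUnit_of_evalZero (by rw [evalZero_den, evalZero_mul_content hz]; exact hu i hi)
  mem i hi := by
    have hτ' : constSeries A τ ∈ F.series.L 1 := C_mem_seriesSubalgebra hτ
    have e : evalZero A (den S⟦X⟧ (constSeries A τ) (constSeries S ξ) (z * content S⟦X⟧ q ν i)) =
        den S τ ξ (x * content S q ν i) := by rw [evalZero_den, evalZero_mul_content hz]
    refine dressed_mem hτ' (fun j hj => C_mem_seriesSubalgebra (hσ j hj)) ?_
    refine inverse_mem_seriesSubalgebra (sub_mem (Subalgebra.smul_mem _ hτ' _)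
      (Subalgebra.smul_mem _ (one_mem _) _)) (isUnit_of_evalZero (by rw [e]; exact hu i hi)) ?_
    rw [← evalZero_apply, e]
    exact hm i hi

/-- The transfer matrices commute whenever they are defined. -/
theorem transfer_comm_of_isUnit [IsDomain S] (h : IsAffine q σ τ) (hq : Generic q)
    (htf : TorsionFree S A) (hν : IsStandard ν m) (hν' : IsStandard ν' n) (hτ : τ ∈ F.L 1)
    (hσ : ∀ j < p, σ j ∈ F.L 1) (hx : ∀ i < m, IsUnit (den S τ ξ (x * content S q ν i)))
    (hy : ∀ i < n, IsUnit (den S τ ξ (y * content S q ν' i)))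
    (hx' : ∀ i < m, Ring.inverse (den S τ ξ (x * content S q ν i)) ∈ F.L 1)
    (hy' : ∀ i < n, Ring.inverse (den S τ ξ (y * content S q ν' i)) ∈ F.L 1) :
    transfer h ξ p F ν m x * transfer h ξ p F ν' n y =
      transfer h ξ p F ν' n y * transfer h ξ p F ν m x := by
  -- The deformations x + t and y + t² have different orders. The coefficients at t and t² make the
  -- parameters independent of each other, and those at t², t³, t⁴ make the two squares and the
  -- product nonconstant.
  set X' : S⟦X⟧ := PowerSeries.C x + PowerSeries.X with hX'
  set Y' : S⟦X⟧ := PowerSeries.C y + PowerSeries.X ^ 2 with hY'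
  have ex : evalZero S X' = x := by simp [hX', evalZero_apply]
  have ey : evalZero S Y' = y := by simp [hY', evalZero_apply]
  have cX : PowerSeries.coeff 1 X' = 1 := by simp [hX']
  have cY : PowerSeries.coeff 2 Y' = 1 := by simp [hY', PowerSeries.coeff_X_pow]
  have cX2 : PowerSeries.coeff 2 X' = 0 := by simp [hX', PowerSeries.coeff_X]
  have cY1 : PowerSeries.coeff 1 Y' = 0 := by
    simp [hY', PowerSeries.coeff_X_pow]
  have nX : X' ≠ 0 := fun h0 => by rw [h0, map_zero] at cX; exact zero_ne_one cX
  have nY : Y' ≠ 0 := fun h0 => by rw [h0, map_zero] at cY; exact zero_ne_one cY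
  have one : ∀ (k : ℕ) {b : S⟦X⟧}, k ≠ 0 → PowerSeries.coeff k b = 1 → Indep 1 b :=
    fun k b hk hb => indep_of_coeff k hb fun c hc h0 => by
      rw [PowerSeries.coeff_one, if_neg hk] at hc
      rw [PowerSeries.algebraMap_apply, hc, map_zero, mul_zero] at h0
      exact one_ne_zero h0
  have iXX : Indep 1 (X' * X') := one 2 two_ne_zero (by
    simp [hX', PowerSeries.coeff_mul, Finset.Nat.antidiagonal_succ, PowerSeries.coeff_C,
      PowerSeries.coeff_X])
  have iYY : Indep 1 (Y' * Y') := one 4 four_ne_zero (by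
    simp [hY', PowerSeries.coeff_mul, Finset.Nat.antidiagonal_succ, PowerSeries.coeff_C,
      PowerSeries.coeff_X_pow])
  have iYX : Indep 1 (Y' * X') := one 3 three_ne_zero (by
    simp [hX', hY', PowerSeries.coeff_mul, Finset.Nat.antidiagonal_succ, PowerSeries.coeff_C,
      PowerSeries.coeff_X_pow, PowerSeries.coeff_X])
  have iY : Indep X' Y' := indep_of_coeff 2 cY fun c hc h0 => by
    rw [cX2] at hc
    rw [PowerSeries.algebraMap_apply, hc, map_zero, mul_zero] at h0
    exact nX h0
  have iX : Indep Y' X' := indep_of_coeff 1 cX fun c hc h0 => by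
    rw [cY1] at hc
    rw [PowerSeries.algebraMap_apply, hc, map_zero, mul_zero] at h0
    exact nY h0
  have key := congrArg (evalZero A) (transfer_comm (fusible_series hν ex nX iXX hτ hσ hx hx')
    (fusible_series hν' ey nY iYY hτ hσ hy hy') (h.map (constSeries A)) hq htf.series iYX iY iX)
  rwa [map_mul, map_mul, evalZero_transfer h ex hx, evalZero_transfer h ey hy] at key

end Deformation

/-! ### The affine Hecke algebra -/

section AffineHecke

open BaxterizedHecke (Hecke Gen Rel gen τUnit level MarkovTrace σInv)
open BaxterizedHecke (Hecke.mk Hecke.mk_rel)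

variable (q : ℂ) (f : ℂ[X])

theorem isAffine (hq : q ≠ 0) : IsAffine q (BaxterizedHecke.σ q f) (BaxterizedHecke.τ q f 0) where
  hecke N :=
    { quad := fun i _ => by
        have h := (BaxterizedHecke.σ_mul_σInv q f hq i).1
        rw [σInv, Algebra.algebraMap_eq_smul_one, mul_sub, mul_smul_comm, mul_one] at h
        exact sub_eq_iff_eq_add.mp h
      braid := fun i _ => by
        have h := Hecke.mk_rel q f (Rel.braid (q := q) (f := f) i)
        simp only [map_mul] at h
        exact h
      far := fun i j hij _ => by
        have h := Hecke.mk_rel q f (Rel.far (q := q) (f := f) i j hij)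
        simp only [map_mul] at h
        exact h }
  -- With τ_2 = σ_1 τ_1 σ_1 this is the commutativity of τ_1 and τ_2.
  refl := by
    have h0 := Hecke.mk_rel q f (Rel.t_succ (q := q) (f := f) 0)
    have h1 := Hecke.mk_rel q f (Rel.t_comm (q := q) (f := f) 0 1)
    rw [map_mul, map_mul, h0] at h1
    simp only [map_mul, ← mul_assoc] at h1
    exact h1
  comm i hi := by
    have h := Hecke.mk_rel q f (Rel.t_s (q := q) (f := f) 0 i (by omega) (by omega))
    simp only [map_mul] at h
    exact h

variable {q f}

theorem σ_mem_level {i n : ℕ} (h : i + 1 < n) : BaxterizedHecke.σ q f i ∈ level q f n :=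
  Algebra.subset_adjoin (Or.inl ⟨i, h, rfl⟩)

theorem τ_mem_level {n : ℕ} (h : 0 < n) : BaxterizedHecke.τ q f 0 ∈ level q f n :=
  Algebra.subset_adjoin (Or.inr ⟨h, Or.inl rfl⟩)

theorem τUnit_inv_mem_level {n : ℕ} (h : 0 < n) :
    (((τUnit q f)⁻¹ : (Hecke q f)ˣ) : Hecke q f) ∈ level q f n :=
  Algebra.subset_adjoin (Or.inr ⟨h, Or.inr rfl⟩)

theorem level_mono {k n : ℕ} (h : k ≤ n) : level q f k ≤ level q f n :=
  Algebra.adjoin_mono (Set.union_subset_union (fun _ ⟨i, hi, e⟩ => ⟨i, by omega, e⟩)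
    fun _ ⟨h0, e⟩ => ⟨by omega, e⟩)

theorem commute_of_mem_level (hq : q ≠ 0) {n i : ℕ} (h : n ≤ i) {x : Hecke q f} (hx : x ∈ level q f n) :
    Commute x (BaxterizedHecke.σ q f i) := by
  have ha := isAffine q f hq
  induction hx using Algebra.adjoin_induction with
  | mem a ha' =>
    rcases ha' with ⟨j, hj, rfl⟩ | ⟨h0, rfl | rfl⟩
    · exact (ha.hecke (i + 1)).far j i (by omega) (by omega)
    · exact ha.comm i (by omega)
    · have : Commute ((τUnit q f : (Hecke q f)ˣ) : Hecke q f) (BaxterizedHecke.σ q f i) :=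
        ha.comm i (by omega)
      exact this.units_inv_left
  | algebraMap c => exact Algebra.commutes c _
  | add a b _ _ ha hb => exact ha.add_left hb
  | mul a b _ _ ha hb => exact ha.mul_left hb

/-- The Markov trace over the strands from `p` on. -/
def markovFrame (hq : q ≠ 0) (M : MarkovTrace q f) (p : ℕ) :
    TraceFrame ℂ q fun i => BaxterizedHecke.σ q f (p + i) where
  L n := level q f (p + n)
  tr n := M.tr (p + n)
  Q0 := M.Q0
  Qp := M.Qplus
  mono n := level_mono (by omega)
  s_mem n := σ_mem_level (by omega)
  comm n i hi x hx := commute_of_mem_level hq (by omega) hx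
  tr_mem n := M.tr_mem (p + n)
  tr_left n X hX Y hY := by
    have := M.tr_bimodule (p + n) X hX 1 (one_mem _) Y hY
    rwa [mul_one, mul_one] at this
  tr_right n X hX Y hY := by
    have := M.tr_bimodule (p + n) 1 (one_mem _) X hX Y hY
    rwa [one_mul, one_mul] at this
  tr_one n := M.tr_of_level (p + n) 1 (one_mem _)
  tr_conj n X hX := by
    have := M.tr_conj (p + n) X hX
    rwa [σInv, Algebra.algebraMap_eq_smul_one] at this
  tr_s n := by
    have := M.tr_σ (p + n) 1 (one_mem _) 1 (one_mem _)
    rwa [one_mul, mul_one, mul_one] at this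
  cyclic n := M.tr_cyclic (p + n)

/-- The one-dimensional representation in which `σ_i` acts by `q` and `τ_1` by a nonzero root
of `f`. -/
theorem exists_character {a : ℂ} (ha : a ≠ 0) (hf : f.eval a = 0) :
    ∃ χ : Hecke q f →ₐ[ℂ] ℂ, χ (BaxterizedHecke.τ q f 0) = a := by
  let g : Gen → ℂ := fun g => match g with
    | .s _ => q
    | .t i => a * q ^ (2 * i)
    | .tInv => a⁻¹
  have hg : ∀ x, FreeAlgebra.lift ℂ g (gen x) = g x := fun x => FreeAlgebra.lift_ι_apply _ _
  let χ : RingQuot (Rel q f) →ₐ[ℂ] ℂ := RingQuot.liftAlgHom ℂ ⟨FreeAlgebra.lift ℂ g, by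
    intro x y h
    cases h with
    | braid i => simp only [map_mul, hg, g]
    | far i j h => simp only [map_mul, hg, g]
    | quad i => simp only [map_mul, map_sub, map_add, AlgHom.commutes, hg, g, map_zero,
        Algebra.algebraMap_self, RingHom.id_apply, sub_self, zero_mul]
    | t_succ j => simp only [map_mul, hg, g]; ring
    | t_comm l j => simp only [map_mul, hg, g]; ring
    | t_s j i h h' => simp only [map_mul, hg, g]; ring
    | t_inv => simp only [map_mul, hg, g, map_one]; field_simp; simp
    | inv_t => simp only [map_mul, hg, g, map_one]; field_simp; simp
    | poly =>
      rw [← Polynomial.aeval_algHom_apply, map_zero, hg]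
      simp [g, hf]⟩
  refine ⟨χ, ?_⟩
  have : χ (RingQuot.mkAlgHom ℂ (Rel q f) (gen (.t 0))) = FreeAlgebra.lift ℂ g (gen (.t 0)) :=
    RingQuot.liftAlgHom_mkAlgHom_apply _ _ _ _
  refine this.trans ?_
  rw [hg]
  simp [g]

theorem inverse_mem_of_mul_eq_one {R A : Type*} [CommRing R] [Ring A] [Algebra R A]
    {L : Subalgebra R A} {x b : A} (h : x * b = 1) (h' : b * x = 1) (hb : b ∈ L) :
    Ring.inverse x ∈ L := by
  have : Ring.inverse ((⟨x, b, h, h'⟩ : Aˣ) : A) = b := Ring.inverse_unit _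
  rwa [← this] at hb

/-- The bimodule property of the trace needs the inverse inside the algebra on finitely many
strands, whereas regularity only gives it in the whole algebra. If y and ξ are nonzero, dividing f
by X - ξ / y writes the inverse as a polynomial in τ_1; the cases with y or ξ zero are explicit. -/
theorem inverse_den_mem_level {n : ℕ} (hn : 0 < n) {ξ y : ℂ}
    (hu : IsUnit (den ℂ (BaxterizedHecke.τ q f 0) ξ y)) :
    Ring.inverse (den ℂ (BaxterizedHecke.τ q f 0) ξ y) ∈ level q f n := by
  have hτ := τ_mem_level (q := q) (f := f) hn
  by_cases hy : y = 0
  · subst hy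
    by_cases hξ : ξ = 0
    · subst hξ
      rw [den, zero_smul, zero_smul, sub_zero, Ring.inverse_zero]
      exact zero_mem _
    · refine inverse_mem_of_mul_eq_one (b := (-ξ⁻¹) • 1) ?_ ?_
        (Subalgebra.smul_mem _ (one_mem _) _) <;>
      · rw [den, zero_smul, zero_sub, ← neg_smul, smul_mul_smul_comm, mul_one]
        simp [hξ]
  by_cases hξ : ξ = 0
  · subst hξ
    refine inverse_mem_of_mul_eq_one (b := y⁻¹ • (((τUnit q f)⁻¹ : (Hecke q f)ˣ) : Hecke q f))
      ?_ ?_ (Subalgebra.smul_mem _ (τUnit_inv_mem_level hn) _)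
    · rw [den, zero_smul, sub_zero, smul_mul_smul_comm, mul_inv_cancel₀ hy, one_smul]
      exact (τUnit q f).mul_inv
    · rw [den, zero_smul, sub_zero, smul_mul_smul_comm, inv_mul_cancel₀ hy, one_smul]
      exact (τUnit q f).inv_mul
  have hden : den ℂ (BaxterizedHecke.τ q f 0) ξ y =
      y • aeval (BaxterizedHecke.τ q f 0) (X - C (ξ / y)) := by
    rw [den, map_sub, aeval_X, aeval_C, Algebra.algebraMap_eq_smul_one, smul_sub, smul_smul,
      mul_div_cancel₀ _ hy]
  -- At a root of f the one-dimensional representation with τ_1 = ξ / y would send the invertible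
  -- denominator to zero.
  by_cases hf : f.eval (ξ / y) = 0
  · obtain ⟨χ, hχ⟩ := exists_character (q := q) (div_ne_zero hξ hy) hf
    have := hu.map χ
    rw [hden, map_smul, ← Polynomial.aeval_algHom_apply, hχ] at this
    simp at this
  · obtain ⟨g, hg⟩ := Polynomial.X_sub_C_dvd_sub_C_eval (a := ξ / y) (p := f)
    have h0 : aeval (BaxterizedHecke.τ q f 0) f = 0 := by
      have := Hecke.mk_rel q f (Rel.poly (q := q) (f := f))
      rwa [← Polynomial.aeval_algHom_apply, map_zero] at this
    have h1 := congrArg (aeval (BaxterizedHecke.τ q f 0)) hg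
    have h2 := h1
    rw [map_sub, h0, aeval_C, map_mul, zero_sub, Algebra.algebraMap_eq_smul_one] at h1
    rw [map_sub, h0, aeval_C, mul_comm, map_mul, zero_sub, Algebra.algebraMap_eq_smul_one] at h2
    have e : y * (-(f.eval (ξ / y))⁻¹ * y⁻¹) * -(f.eval (ξ / y)) = 1 := by field_simp
    refine inverse_mem_of_mul_eq_one
      (b := (-(f.eval (ξ / y))⁻¹ * y⁻¹) • aeval (BaxterizedHecke.τ q f 0) g) ?_ ?_
      (Subalgebra.smul_mem _ (aeval_mem hτ g) _)
    · rw [hden, smul_mul_smul_comm, ← h1, ← neg_smul, smul_smul, e, one_smul]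
    · rw [hden, smul_mul_smul_comm, ← h2, ← neg_smul, smul_smul, mul_comm _ y, e, one_smul]

end AffineHecke

/-! ### Tableaux and transfer matrices of the affine Hecke algebra -/

section Link

open scoped PowerSeries
open BaxterizedHecke (Hecke MarkovTrace StandardTableau)

attribute [local instance] seriesAlgebra

theorem prod_ofFn_eq_up {M : Type*} [Monoid M] {n : ℕ} {g : Fin n → M} {f : ℕ → M}
    (h : ∀ k : Fin n, g k = f k) : (List.ofFn g).prod = up n f := by
  induction n generalizing f with
  | zero => rfl
  | succ n ih =>
    rw [List.ofFn_succ, List.prod_cons, up_succ_left, h 0,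
      ih (f := fun i => f (i + 1)) fun k => h k.succ]
    rfl

theorem exists_prod_ofFn_eq_smul {S A : Type*} [CommRing S] [Ring A] [Algebra S A] {n : ℕ}
    {g : Fin n → A} {f : ℕ → A} (h : ∀ k : Fin n, ∃ c : S, g k = c • f k) :
    ∃ c : S, (List.ofFn g).prod = c • up n f := by
  induction n generalizing f with
  | zero => exact ⟨1, by rw [one_smul]; rfl⟩
  | succ n ih =>
    obtain ⟨c, hc⟩ := h 0
    obtain ⟨d, hd⟩ := ih (f := fun i => f (i + 1)) fun k => h k.succ
    refine ⟨c * d, ?_⟩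
    rw [List.ofFn_succ, List.prod_cons, up_succ_left, hd, hc, smul_mul_smul_comm]
    rfl

theorem Reflection.prod_eq_up {M P : Type*} [Monoid M] (X : Reflection M P) (m : ℕ) (w : ℕ → P) :
    X.prod m w = up m fun i => (up i fun j => X.T (i - 1 - j) (w i) (w j)) * X.K (w i) := by
  induction m with
  | zero => rfl
  | succ m ih => rw [prod_succ, ih, up_succ, mul_assoc]

section Tableau

variable {m : ℕ} (T : StandardTableau m)

/-- The sequence of the nodes of a tableau. -/
def nodeSeq (k : ℕ) : ℕ × ℕ := if h : k < m then T.node ⟨k, h⟩ else (0, 0)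

theorem nodeSeq_val (k : Fin m) : nodeSeq T k = T.node k := dif_pos k.isLt

theorem node_injective : Function.Injective T.node := fun _ _ h =>
  T.pos.injective (Subtype.ext h)

/-- The comparison runs from `a` along its row to the column of the larger node and then down that
column; both steps stay in the diagram. -/
theorem exists_node_of_le {a : ℕ × ℕ} {l : Fin m} (h : a ≤ T.node l) :
    ∃ k, T.node k = a ∧ k ≤ l := by
  have hS : ∀ b, b ≤ T.node l → ∃ k, T.node k = b := fun b hb => by
    have hmem : b ∈ T.shape.cells := T.shape.isLowerSet hb (T.pos l).2
    exact ⟨T.pos.symm ⟨b, hmem⟩, by rw [StandardTableau.node, Equiv.apply_symm_apply]⟩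
  obtain ⟨k, hk⟩ := hS a h
  obtain ⟨k', hk'⟩ := hS (a.1, (T.node l).2) ⟨h.1, le_rfl⟩
  refine ⟨k, hk, ?_⟩
  have h1 : k ≤ k' := by
    rcases h.2.lt_or_eq with h2 | h2
    · exact (T.row_increasing k k' (by
        show (T.node k).1 = (T.node k').1
        rw [hk, hk']) (by
        show (T.node k).2 < (T.node k').2
        rw [hk, hk']
        exact h2)).le
    · exact (node_injective T (hk.trans ((Prod.ext rfl h2 : a = (a.1, (T.node l).2)).trans hk'.symm))).le
  have h3 : k' ≤ l := by
    rcases h.1.lt_or_eq with h2 | h2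
    · exact (T.col_increasing k' l (by
        show (T.node k').2 = (T.node l).2
        rw [hk']) (by
        show (T.node k').1 < (T.node l).1
        rw [hk']
        exact h2)).le
    · exact (node_injective T (hk'.trans (Prod.ext h2 rfl))).le
  exact h1.trans h3

theorem nodes_nodeSeq (k : Fin m) : nodes (nodeSeq T) k = T.initialNodes k := by
  ext a
  simp only [nodes, StandardTableau.initialNodes, Finset.mem_image, Finset.mem_range,
    Finset.mem_filter, Finset.mem_univ, true_and]
  constructor
  · rintro ⟨l, hl, rfl⟩
    exact ⟨⟨l, hl.trans k.isLt⟩, hl, (nodeSeq_val T ⟨l, _⟩).symm⟩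
  · rintro ⟨l, hl, rfl⟩
    exact ⟨l, hl, nodeSeq_val T l⟩

theorem isStandard_nodeSeq : IsStandard (nodeSeq T) m := by
  intro k hk
  have e := nodes_nodeSeq T ⟨k, hk⟩
  have e' := nodeSeq_val T ⟨k, hk⟩
  simp only at e e'
  have mem : ∀ a, a ∈ T.initialNodes ⟨k, hk⟩ ↔ ∃ l, l < ⟨k, hk⟩ ∧ T.node l = a := fun a => by
    simp [StandardTableau.initialNodes]
  rw [e, e']
  refine mem_addable_of (fun b a hab hb => ?_) (fun h => ?_) fun a ha hne => ?_
  · rw [Finset.mem_coe, mem] at hb ⊢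
    obtain ⟨l, hl, rfl⟩ := hb
    obtain ⟨l', hl', hle⟩ := exists_node_of_le T hab
    exact ⟨l', hle.trans_lt hl, hl'⟩
  · obtain ⟨l, hl, h⟩ := (mem _).mp h
    exact hl.ne (node_injective T h)
  · obtain ⟨l, hl, hle⟩ := exists_node_of_le T ha
    exact (mem _).mpr ⟨l, lt_of_le_of_ne hle fun h => hne (by rw [← hl, h]), hl⟩

end Tableau

variable {q : ℂ} {f : ℂ[X]} {m : ℕ}

theorem jucysMurphy_eq_jm (p k : ℕ) :
    BaxterizedHecke.jucysMurphy q f p k = jm (fun i => BaxterizedHecke.σ q f (p + i)) k := by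
  induction k with
  | zero => rfl
  | succ k ih => rw [BaxterizedHecke.jucysMurphy, ih, jm_succ]

theorem idempotent_eq_idem (T : StandardTableau m) (p : ℕ) :
    BaxterizedHecke.idempotent q f T p =
      idem q (fun i => BaxterizedHecke.σ q f (p + i)) (nodeSeq T) m :=
  prod_ofFn_eq_up fun k => by
    rw [jucysMurphy_eq_jm, lagrange, nodes_nodeSeq, nodeSeq_val]
    rfl

theorem scalar_mul (c : ℂ⟦X⟧) (a : (Hecke q f)⟦X⟧) : BaxterizedHecke.scalar q f c * a = c • a := rfl

theorem scalar_eq (c : ℂ⟦X⟧) : BaxterizedHecke.scalar q f c = c • (1 : (Hecke q f)⟦X⟧) := by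
  rw [← scalar_mul, mul_one]

/-- The generators over the power series. -/
abbrev seriesσ (q : ℂ) (f : ℂ[X]) (i : ℕ) : (Hecke q f)⟦X⟧ :=
  constSeries _ (BaxterizedHecke.σ q f i)

theorem X_eq_smul_bax (i : ℕ) {y : ℂ⟦X⟧} (hy : IsUnit (1 - y)) :
    BaxterizedHecke.X q f i y = (1 - y)⁻¹ • bax q (seriesσ q f i) y 1 := by
  have h : (1 - y)⁻¹ * (1 - y) = 1 := PowerSeries.inv_mul_cancel _ fun h0 => by
    have := hy.map (PowerSeries.constantCoeff (R := ℂ))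
    rw [h0] at this
    exact not_isUnit_zero this
  rw [BaxterizedHecke.X, bax, scalar_eq, smul_add, smul_smul, smul_smul, h, one_smul,
    PowerSeries.algebraMap_apply, mul_comm]
  rfl

theorem tauX_eq_smul_dressed (ξ : ℂ⟦X⟧) (p : ℕ) {y : ℂ⟦X⟧} (hy : 0 < p → IsUnit (1 - y)) :
    ∃ c : ℂ⟦X⟧, BaxterizedHecke.tauX q f ξ p y =
      c • dressed q (seriesσ q f) (constSeries _ (BaxterizedHecke.τ q f 0)) ξ p y := by
  induction p with
  | zero =>
    refine ⟨1, ?_⟩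
    rw [one_smul, BaxterizedHecke.tauX, BaxterizedHecke.tauOne, scalar_mul,
      scalar_eq (ξ * y ^ 2), scalar_eq ξ]
    rfl
  | succ p ih =>
    have hy := hy (Nat.succ_pos p)
    obtain ⟨c, hc⟩ := ih fun _ => hy
    refine ⟨(1 - y)⁻¹ * c * (1 - y)⁻¹, ?_⟩
    rw [BaxterizedHecke.tauX, hc, X_eq_smul_bax p hy, smul_mul_smul_comm, smul_mul_smul_comm]
    rfl

theorem fusedB_eq_smul_prod
    (h : IsAffine q (seriesσ q f) (constSeries _ (BaxterizedHecke.τ q f 0))) {ξ x : ℂ⟦X⟧} {p : ℕ}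
    {T : StandardTableau m} (hx : BaxterizedHecke.IsRegular q f ξ p T x) :
    ∃ c : ℂ⟦X⟧, BaxterizedHecke.fusedB q f ξ p (T.content q) x =
      c • (h.reflection ξ p).prod m fun i => x * content ℂ⟦X⟧ q (nodeSeq T) i := by
  have hC : ∀ i : Fin m, content ℂ⟦X⟧ q (nodeSeq T) i = PowerSeries.C (T.content q i) := fun i => by
    rw [content, nodeSeq_val, PowerSeries.algebraMap_apply]
    rfl
  rw [Reflection.prod_eq_up]
  refine exists_prod_ofFn_eq_smul fun i => ?_
  obtain ⟨c, hc⟩ := tauX_eq_smul_dressed (q := q) (f := f) ξ p fun hp => hx.dressing hp i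
  obtain ⟨d, hd⟩ : ∃ d : ℂ⟦X⟧, BaxterizedHecke.backX q f p i (fun k => x ^ 2 * PowerSeries.C
      (T.content q i * T.content q (Fin.castLE i.isLt.le k))) =
      d • up i fun j => (h.reflection ξ p).T (i - 1 - j)
        (x * content ℂ⟦X⟧ q (nodeSeq T) i) (x * content ℂ⟦X⟧ q (nodeSeq T) j) := by
    refine exists_prod_ofFn_eq_smul fun k => ⟨(1 - x ^ 2 * PowerSeries.C
      (T.content q i * T.content q (Fin.castLE i.isLt.le k)))⁻¹,
      (X_eq_smul_bax _ (hx.bulk i _ k.isLt)).trans ?_⟩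
    congr 1
    have e : x * content ℂ⟦X⟧ q (nodeSeq T) i * (x * content ℂ⟦X⟧ q (nodeSeq T) k) =
        x ^ 2 * PowerSeries.C (T.content q i * T.content q (Fin.castLE i.isLt.le k)) := by
      rw [hC i, show content ℂ⟦X⟧ q (nodeSeq T) k = _ from hC (Fin.castLE i.isLt.le k), map_mul]
      ring
    show _ = bax q (seriesσ q f (p + (i - 1 - k))) _ 1
    rw [e, Fin.val_rev, Nat.sub_sub, add_comm 1]
  refine ⟨d * c, ?_⟩
  rw [hc, hd, smul_mul_smul_comm, hC i]
  rfl

theorem trRange_eq_traces (hq : q ≠ 0) (M : MarkovTrace q f) (p k : ℕ) (Y : (Hecke q f)⟦X⟧) :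
    M.trRange p k Y = (markovFrame hq M p).series.traces 0 k Y := by
  induction k generalizing Y with
  | zero => rfl
  | succ k ih =>
    rw [MarkovTrace.trRange, ih, TraceFrame.traces_succ, Nat.zero_add]
    rfl

theorem transferMatrix_eq_smul_transfer (hq : q ≠ 0) (M : MarkovTrace q f) {ξ x : ℂ⟦X⟧} {p : ℕ}
    {T : StandardTableau m} (hx : BaxterizedHecke.IsRegular q f ξ p T x) :
    ∃ c : ℂ⟦X⟧, BaxterizedHecke.transferMatrix M ξ p T x =
      c • transfer ((isAffine q f hq).map (constSeries _)) ξ p (markovFrame hq M p).series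
        (nodeSeq T) m x := by
  obtain ⟨c, hc⟩ := fusedB_eq_smul_prod ((isAffine q f hq).map (constSeries _)) hx
  refine ⟨c, ?_⟩
  rw [BaxterizedHecke.transferMatrix, trRange_eq_traces hq, transfer, ← map_smul,
    BaxterizedHecke.projectedB, hc, mul_smul_comm, idempotent_eq_idem, ← constSeries_apply,
    map_idem]

theorem isRegular_den {ξ x : ℂ⟦X⟧} {p : ℕ} {T : StandardTableau m}
    (hx : BaxterizedHecke.IsRegular q f ξ p T x) (i : ℕ) (hi : i < m) :
    IsUnit (den ℂ⟦X⟧ (constSeries _ (BaxterizedHecke.τ q f 0)) ξ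
      (x * content ℂ⟦X⟧ q (nodeSeq T) i)) := by
  have h := hx.boundary ⟨i, hi⟩
  rw [scalar_mul, scalar_eq] at h
  have e : content ℂ⟦X⟧ q (nodeSeq T) i = PowerSeries.C (T.content q ⟨i, hi⟩) := by
    rw [content, nodeSeq, dif_pos hi, PowerSeries.algebraMap_apply]
    rfl
  rw [e]
  exact h

theorem inverse_den_mem_series {n : ℕ} (hn : 0 < n) {ξ y : ℂ⟦X⟧}
    (hu : IsUnit (den ℂ⟦X⟧ (constSeries _ (BaxterizedHecke.τ q f 0)) ξ y)) :
    Ring.inverse (den ℂ⟦X⟧ (constSeries _ (BaxterizedHecke.τ q f 0)) ξ y) ∈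
      seriesSubalgebra (BaxterizedHecke.level q f n) := by
  have hτ : constSeries _ (BaxterizedHecke.τ q f 0) ∈
      seriesSubalgebra (BaxterizedHecke.level q f n) := C_mem_seriesSubalgebra (τ_mem_level hn)
  have e : evalZero _ (den ℂ⟦X⟧ (constSeries _ (BaxterizedHecke.τ q f 0)) ξ y) =
      den ℂ (BaxterizedHecke.τ q f 0) (evalZero ℂ ξ) (evalZero ℂ y) := by
    rw [map_den (ψ := evalZero ℂ) evalZero_smul, evalZero_constSeries]
  refine inverse_mem_seriesSubalgebra (sub_mem (Subalgebra.smul_mem _ hτ _)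
    (Subalgebra.smul_mem _ (one_mem _) _)) hu ?_
  rw [← evalZero_apply, e]
  refine inverse_den_mem_level hn ?_
  rw [← e]
  exact hu.map _

theorem torsionFree_hecke : TorsionFree ℂ (Hecke q f) := fun _ _ hs h =>
  (smul_eq_zero.mp h).resolve_left hs

end Link

end HeckeFusion

end

open BaxterizedHecke in
theorem corollary5p3 (q : ℂ) (hq0 : q ≠ 0) (hq : ∀ k : ℕ, 0 < k → q ^ k ≠ 1)
    (f : Polynomial ℂ) (M : MarkovTrace q f) (ξ : PowerSeries ℂ) (p : ℕ)
    {m n : ℕ} (T : StandardTableau m) (T' : StandardTableau n) (x z : PowerSeries ℂ)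
    (hx : IsRegular q f ξ p T x) (hz : IsRegular q f ξ p T' z) :
    transferMatrix M ξ p T x * transferMatrix M ξ p T' z =
      transferMatrix M ξ p T' z * transferMatrix M ξ p T x := by
  let _ := HeckeFusion.seriesAlgebra ℂ (Hecke q f)
  obtain ⟨c, hc⟩ := HeckeFusion.transferMatrix_eq_smul_transfer hq0 M hx
  obtain ⟨d, hd⟩ := HeckeFusion.transferMatrix_eq_smul_transfer hq0 M hz
  -- The scalars here are already the power series in h, since ξ, x and z depend on h; the
  -- deformation variable is a further one.
  have key := HeckeFusion.transfer_comm_of_isUnit (F := (HeckeFusion.markovFrame hq0 M p).series)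
    ((HeckeFusion.isAffine q f hq0).map (HeckeFusion.constSeries _)) ⟨hq0, hq⟩
    HeckeFusion.torsionFree_hecke.series (HeckeFusion.isStandard_nodeSeq T)
    (HeckeFusion.isStandard_nodeSeq T')
    (HeckeFusion.C_mem_seriesSubalgebra (HeckeFusion.τ_mem_level (by omega)))
    (fun j hj => HeckeFusion.C_mem_seriesSubalgebra (HeckeFusion.σ_mem_level (by omega)))
    (HeckeFusion.isRegular_den hx) (HeckeFusion.isRegular_den hz)
    (fun i hi => HeckeFusion.inverse_den_mem_series (by omega) (HeckeFusion.isRegular_den hx i hi))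
    (fun i hi => HeckeFusion.inverse_den_mem_series (by omega) (HeckeFusion.isRegular_den hz i hi))
  rw [hc, hd, smul_mul_smul_comm, smul_mul_smul_comm, key, mul_comm]
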